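/- **Theorem 1 (nonnegative sparse recovery).** For an $n\times n$ real matrix $M$ and $p\ge 1$ let $\|M\|_{Ep}=\bigl(\sum_{i,j}|M_{ij}|^p\bigr)^{1/p}$ be its entrywise $p$-norm, and let $\|M\|_{E^kp}$, the $k$-residual entrywise $p$-norm, be the entrywise $p$-norm of the matrix obtained from $M$ by replacing the $k$ entries with the largest absolute values (ties resolved arbitrarily; all entries if $k\ge n^2$) with $0$. The model of computation is a deterministic real RAM with unit-cost operations on machine words of $O(\log(n+k/\varepsilon))$ bits and exact unit-cost arithmetic and comparisons on real numbers; space is counted in memory cells, and memory may initially hold arbitrary contents. Let $\mathrm{Sort}(m)\ge m$ be an upper bound for the running time of some sorting program for this machine that sorts $m$ real keys, together with their original positions, in space $O(m)$ with words of $O(\log m)$ bits. Then there is a deterministic algorithm (one fixed program using this sorting program) that, for all integers $n\ge 1$, $k\ge 1$, every real $0<\varepsilon<1$ and all nonnegative real $n\times n$ matrices $A$ and $B$, with $C=AB$, takes $n$, $k$, $\varepsilon$ as parameters, reads $A$ in column-major order and $B$ in row-major order in a single pass over each, and returns, as a list of (row, column, value) triples with distinct positions, a matrix $\widehat C$ such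 that for every real $p\ge 1$ $$\|C-\widehat C\|_{Ep}\;\le\;(1+\varepsilon)^{1/p}\Bigl(\frac{\varepsilon}{k}\Bigr)^{1-1/p}\|C\|_{E^k1}.$$ The algorithm runs in time $O\bigl(n\cdot \mathrm{Sort}(n)+nk/\varepsilon\bigr)$ and space $O(n+k/\varepsilon)$, with constants that do not depend on $n,k,\varepsilon,A,B$. -/

import Mathlib

/-! A deterministic real RAM with two read-once input tapes, and the matrix norms of the statement.

A program uses finitely many natural and real scalar variables and finitely many natural and real
arrays (all named by natural numbers).  Natural numbers are machine words of bounded size; real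
numbers can be added, subtracted, multiplied, divided and compared exactly, but neither rounded
nor converted to words. -/

namespace RealRAM

/-- Word-valued expressions. -/
inductive NExp where
  | lit (c : ℕ)
  | var (x : ℕ)
  | get (a : ℕ) (e : NExp)
  | add (e f : NExp)
  | sub (e f : NExp)
  | mul (e f : NExp)
  | div (e f : NExp)

/-- Real-valued expressions. -/
inductive RExp where
  | lit (c : ℕ)
  | var (x : ℕ)
  | get (a : ℕ) (e : NExp)
  | add (e f : RExp)
  | sub (e f : RExp)
  | mul (e f : RExp)
  | div (e f : RExp)

/-- Tests. -/
inductive BExp where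
  | nlt (e f : NExp)
  | neq (e f : NExp)
  | rlt (e f : RExp)
  | not (b : BExp)
  | and (b c : BExp)

/-- Programs. `read τ x` moves the next number of the input tape `τ` into the real variable `x`;
no other instruction accesses the tapes, so every tape is scanned at most once, from left to
right. -/
inductive Stmt where
  | skip
  | setN (x : ℕ) (e : NExp)
  | setR (x : ℕ) (e : RExp)
  | putN (a : ℕ) (i e : NExp)
  | putR (a : ℕ) (i : NExp) (e : RExp)
  | read (τ : Fin 2) (x : ℕ)
  | seq (p q : Stmt)
  | ite (b : BExp) (p q : Stmt)
  | loop (b : BExp) (p : Stmt)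

/-- A memory state: scalar variables `nv`, `rv`, arrays `na`, `ra`, and the unread parts of the two
input tapes. -/
structure State where
  nv : ℕ → ℕ
  rv : ℕ → ℝ
  na : ℕ → ℕ → ℕ
  ra : ℕ → ℕ → ℝ
  tape : Fin 2 → List ℝ

/-- A computed natural number is available only if it fits into a word, that is, is at most `W`. -/
def word (W v : ℕ) : Option ℕ := if v ≤ W then some v else none

/-- Value of a word expression on a machine whose arrays have `S` cells each and whose words are at
most `W`; `none` if an array is accessed out of range or a result does not fit into a word.
Subtraction is truncated and division is rounded down (and not defined for divisor `0`). -/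
def NExp.eval (S W : ℕ) (s : State) : NExp → Option ℕ
  | .lit c => word W c
  | .var x => some (s.nv x)
  | .get a e => (e.eval S W s).bind fun i => if i < S then some (s.na a i) else none
  | .add e f => (e.eval S W s).bind fun x => (f.eval S W s).bind fun y => word W (x + y)
  | .sub e f => (e.eval S W s).bind fun x => (f.eval S W s).bind fun y => some (x - y)
  | .mul e f => (e.eval S W s).bind fun x => (f.eval S W s).bind fun y => word W (x * y)
  | .div e f => (e.eval S W s).bind fun x => (f.eval S W s).bind fun y =>
      if y = 0 then none else some (x / y)

/-- Value of a real expression; division by `0` is not defined. -/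
noncomputable def RExp.eval (S W : ℕ) (s : State) : RExp → Option ℝ
  | .lit c => some (c : ℝ)
  | .var x => some (s.rv x)
  | .get a e => (e.eval S W s).bind fun i => if i < S then some (s.ra a i) else none
  | .add e f => (e.eval S W s).bind fun x => (f.eval S W s).bind fun y => some (x + y)
  | .sub e f => (e.eval S W s).bind fun x => (f.eval S W s).bind fun y => some (x - y)
  | .mul e f => (e.eval S W s).bind fun x => (f.eval S W s).bind fun y => some (x * y)
  | .div e f => (e.eval S W s).bind fun x => (f.eval S W s).bind fun y =>
      if y = 0 then none else some (x / y)

/-- Value of a test; conjunction is evaluated lazily. -/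
noncomputable def BExp.eval (S W : ℕ) (s : State) : BExp → Option Bool
  | .nlt e f => (e.eval S W s).bind fun x => (f.eval S W s).bind fun y => some (decide (x < y))
  | .neq e f => (e.eval S W s).bind fun x => (f.eval S W s).bind fun y => some (decide (x = y))
  | .rlt e f => (e.eval S W s).bind fun x => (f.eval S W s).bind fun y => some (decide (x < y))
  | .not b => (b.eval S W s).bind fun x => some (!x)
  | .and b c => (b.eval S W s).bind fun x => if x then c.eval S W s else some false

/-- `Exec S W p s s' t`: on the machine whose arrays have `S` cells each and whose words are at most
`W`, the program `p` started in `s` halts in `s'` after `t` steps, without an undefined operation.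
Every executed instruction and every evaluated test costs one step.  (The expressions in a program
have constant size, and a program uses a constant number of variables and arrays, so `t` is the
running time and `S` the space up to constant factors.) -/
inductive Exec (S W : ℕ) : Stmt → State → State → ℕ → Prop
  | skip (s : State) : Exec S W .skip s s 1
  | setN {s : State} {x : ℕ} {e : NExp} {v : ℕ} (he : e.eval S W s = some v) :
      Exec S W (.setN x e) s { s with nv := Function.update s.nv x v } 1
  | setR {s : State} {x : ℕ} {e : RExp} {v : ℝ} (he : e.eval S W s = some v) :
      Exec S W (.setR x e) s { s with rv := Function.update s.rv x v } 1
  | putN {s : State} {a : ℕ} {i e : NExp} {j v : ℕ} (hi : i.eval S W s = some j) (hj : j < S)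
      (he : e.eval S W s = some v) :
      Exec S W (.putN a i e) s
        { s with na := Function.update s.na a (Function.update (s.na a) j v) } 1
  | putR {s : State} {a : ℕ} {i : NExp} {e : RExp} {j : ℕ} {v : ℝ}
      (hi : i.eval S W s = some j) (hj : j < S) (he : e.eval S W s = some v) :
      Exec S W (.putR a i e) s
        { s with ra := Function.update s.ra a (Function.update (s.ra a) j v) } 1
  | read {s : State} {τ : Fin 2} {x : ℕ} {v : ℝ} {l : List ℝ} (h : s.tape τ = v :: l) :
      Exec S W (.read τ x) s
        { s with rv := Function.update s.rv x v, tape := Function.update s.tape τ l } 1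
  | seq {p q : Stmt} {s s' s'' : State} {t t' : ℕ} (hp : Exec S W p s s' t)
      (hq : Exec S W q s' s'' t') : Exec S W (.seq p q) s s'' (t + t')
  | iteTrue {b : BExp} {p q : Stmt} {s s' : State} {t : ℕ} (hb : b.eval S W s = some true)
      (hp : Exec S W p s s' t) : Exec S W (.ite b p q) s s' (t + 1)
  | iteFalse {b : BExp} {p q : Stmt} {s s' : State} {t : ℕ} (hb : b.eval S W s = some false)
      (hq : Exec S W q s s' t) : Exec S W (.ite b p q) s s' (t + 1)
  | loopDone {b : BExp} {p : Stmt} {s : State} (hb : b.eval S W s = some false) :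
      Exec S W (.loop b p) s s 1
  | loopStep {b : BExp} {p : Stmt} {s s' s'' : State} {t t' : ℕ}
      (hb : b.eval S W s = some true) (hp : Exec S W p s s' t)
      (hl : Exec S W (.loop b p) s' s'' t') : Exec S W (.loop b p) s s'' (t + t' + 1)

/-- The machine is deterministic: a halting run is unique. -/
theorem Exec.deterministic {S W : ℕ} {p : Stmt} {s s₁ s₂ : State} {t₁ t₂ : ℕ}
    (h₁ : Exec S W p s s₁ t₁) (h₂ : Exec S W p s s₂ t₂) : s₁ = s₂ ∧ t₁ = t₂ := by
  induction h₁ generalizing s₂ t₂ with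
  | seq hp hq ihp ihq =>
    cases h₂ with
    | seq hp' hq' =>
      obtain ⟨rfl, rfl⟩ := ihp hp'
      obtain ⟨rfl, rfl⟩ := ihq hq'
      exact ⟨rfl, rfl⟩
  | iteTrue hb hp ih =>
    cases h₂ with
    | iteTrue hb' hp' => obtain ⟨rfl, rfl⟩ := ih hp'; exact ⟨rfl, rfl⟩
    | iteFalse hb' hp' => simp [hb] at hb'
  | iteFalse hb hp ih =>
    cases h₂ with
    | iteTrue hb' hp' => simp [hb] at hb'
    | iteFalse hb' hp' => obtain ⟨rfl, rfl⟩ := ih hp'; exact ⟨rfl, rfl⟩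
  | loopDone hb =>
    cases h₂ with
    | loopDone hb' => exact ⟨rfl, rfl⟩
    | loopStep hb' hp' hl' => simp [hb] at hb'
  | loopStep hb hp hl ihp ihl =>
    cases h₂ with
    | loopDone hb' => simp [hb] at hb'
    | loopStep hb' hp' hl' =>
      obtain ⟨rfl, rfl⟩ := ihp hp'
      obtain ⟨rfl, rfl⟩ := ihl hl'
      exact ⟨rfl, rfl⟩
  | _ => cases h₂; simp_all

/-- `P` is a sorting program with running time at most `sortTime` and linear space: started on `m` real
keys (`m` in word variable `0`, the keys in the first `m` cells of real array `0`, and arbitrary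
contents everywhere else), it puts the keys into nondecreasing order in place and records in word
array `0` which key came from which position; it leaves the input tapes alone.  Words have
`O(log m)` bits. -/
def IsSorter (P : Stmt) (sortTime : ℕ → ℕ) : Prop :=
  ∃ c d : ℕ, ∀ (m : ℕ) (s : State), s.nv 0 = m →
    ∃ (s' : State) (t : ℕ), Exec (c * (m + 1)) ((c * (m + 1)) ^ d) P s s' t ∧ t ≤ sortTime m ∧
      s'.tape = s.tape ∧
      (∀ i j, i < j → j < m → s'.ra 0 i ≤ s'.ra 0 j) ∧
      ∃ π : Equiv.Perm (Fin m), ∀ i : Fin m,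
        s'.na 0 i = π i ∧ s'.ra 0 i = s.ra 0 (π i)

/-- The entries of a matrix, row after row. -/
def rowMajor {n : ℕ} (M : Matrix (Fin n) (Fin n) ℝ) : List ℝ :=
  (List.finRange n).flatMap fun i => (List.finRange n).map fun j => M i j

/-- The entries of a matrix, column after column. -/
def colMajor {n : ℕ} (M : Matrix (Fin n) (Fin n) ℝ) : List ℝ := rowMajor M.transpose

/-- `s` is a start state for the input `n, k, ε, A, B`: the parameters are in the first scalar
variables, tape `0` holds `A` in column-major order, tape `1` holds `B` in row-major order.  The
rest of the memory is arbitrary. -/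
def IsInput {n : ℕ} (s : State) (k : ℕ) (ε : ℝ) (A B : Matrix (Fin n) (Fin n) ℝ) : Prop :=
  s.nv 0 = n ∧ s.nv 1 = k ∧ s.rv 0 = ε ∧ s.tape 0 = colMajor A ∧ s.tape 1 = rowMajor B

/-- In the state `s` the memory holds the matrix `M` as a list of at most `S` triples (row, column,
value) with distinct positions, in word arrays `0`, `1` and real array `0`, the length of the list
being in word variable `0`; the entries of `M` at all other positions are `0`. -/
def IsOutput {n : ℕ} (S : ℕ) (s : State) (M : Matrix (Fin n) (Fin n) ℝ) : Prop :=
  s.nv 0 ≤ S ∧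
  (∀ l < s.nv 0, s.na 0 l < n ∧ s.na 1 l < n) ∧
  (∀ l < s.nv 0, ∀ l' < s.nv 0, s.na 0 l = s.na 0 l' → s.na 1 l = s.na 1 l' → l = l') ∧
  ∀ i j : Fin n, M i j =
    ∑ l ∈ Finset.range (s.nv 0), if s.na 0 l = i ∧ s.na 1 l = j then s.ra 0 l else 0

end RealRAM

namespace EntryNorm

/-- The entrywise `p`-norm of a matrix. -/
noncomputable def entryNorm {n : ℕ} (p : ℝ) (M : Matrix (Fin n) (Fin n) ℝ) : ℝ :=
  (∑ i, ∑ j, |M i j| ^ p) ^ (1 / p)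

/-- `T` consists of `k` positions (all of them if there are fewer than `k`) at which `M` has its
largest absolute values. -/
def IsTop {n : ℕ} (M : Matrix (Fin n) (Fin n) ℝ) (k : ℕ) (T : Finset (Fin n × Fin n)) : Prop :=
  T.card = min k (n * n) ∧ ∀ e ∈ T, ∀ e' ∉ T, |M e'.1 e'.2| ≤ |M e.1 e.2|

theorem exists_isTop {n : ℕ} (M : Matrix (Fin n) (Fin n) ℝ) (k : ℕ) : ∃ T, IsTop M k T := by
  induction k with
  | zero => exact ⟨∅, by simp, by simp⟩
  | succ k ih =>
    obtain ⟨T, hc, hT⟩ := ih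
    by_cases hne : (Finset.univ \ T).Nonempty
    · obtain ⟨x, hx, hmax⟩ :=
        Finset.exists_max_image (Finset.univ \ T) (fun e => |M e.1 e.2|) hne
      have hxT : x ∉ T := by simpa using hx
      refine ⟨insert x T, ?_, ?_⟩
      · have hlt : T.card < n * n := by
          have h := Finset.card_lt_univ_of_notMem hxT
          simpa using h
        rw [Finset.card_insert_of_notMem hxT]
        omega
      · intro e he e' he'
        rw [Finset.mem_insert, not_or] at he'
        rcases Finset.mem_insert.1 he with rfl | he
        · exact hmax e' (by simpa using he'.2)
        · exact hT e he e' he'.2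
    · have hu : T = Finset.univ := by
        rw [Finset.not_nonempty_iff_eq_empty, Finset.sdiff_eq_empty_iff_subset] at hne
        exact Finset.univ_subset_iff.1 hne
      subst hu
      refine ⟨Finset.univ, ?_, by simp⟩
      simp only [Finset.card_univ, Fintype.card_prod, Fintype.card_fin] at hc ⊢
      omega

/-- The positions of the `k` largest absolute values, ties resolved arbitrarily. -/
noncomputable def topEntries {n : ℕ} (M : Matrix (Fin n) (Fin n) ℝ) (k : ℕ) :
    Finset (Fin n × Fin n) :=
  Classical.choose (exists_isTop M k)

/-- The `k`-residual entrywise `p`-norm: the entrywise `p`-norm after the `k` entries with the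
largest absolute values have been replaced with `0`. -/
noncomputable def residualNorm {n : ℕ} (k : ℕ) (p : ℝ) (M : Matrix (Fin n) (Fin n) ℝ) : ℝ :=
  entryNorm p (Matrix.of fun i j => if (i, j) ∈ topEntries M k then 0 else M i j)

end EntryNorm

/-!
The algorithm runs through the outer products `a bᵀ` of the columns `a` of `A` and the rows `b` of
`B`, and maintains a sparse matrix `Z` with `0 ≤ Z ≤ Y`, where `Y` is the sum of the outer products
seen so far. A matrix is made sparse by subtracting a threshold `θ` from all its entries and
cutting off at `0`. Let `Δ` be the sum of all thresholds used; then `Y - Z ≤ Δ` entrywise. Every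
threshold is chosen such that at least `ell = k + ⌈k / ε⌉` entries reach it (or it is `0`), so that
subtracting it removes at least `ell * θ` from the sum of the entries. Hence `ell * Δ ≤ ‖C - Z‖₁`
in the end (`LowerApprox`). On the other hand, splitting off the `k` largest entries of `C = A B`
shows `‖C - Z‖₁ ≤ k * Δ + R`, where `R` is the residual norm. These inequalities together give
`Δ ≤ (ε / k) * R` and `‖C - Z‖₁ ≤ (1 + ε) * R`, and the bound for `p` follows from
`‖D‖_p ^ p ≤ ‖D‖_∞ ^ (p - 1) * ‖D‖₁` (`EntryNorm.entryNorm_sub_le`).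

For the running time, each outer product has to be processed in time linear in `n + ell`, besides
sorting its two factors; this uses two kinds of thresholds.

* For the outer product of two sorted factors, only the products at positions `2 ^ a - 1`,
  `2 ^ b - 1` are considered. Such a sample stands for about `2 ^ (a + b)` products, and the largest
  sample such that the samples not below it weigh at least `4 * ell` is a threshold that at least `ell`
  products reach and less than `4 * ell` products exceed (`OuterProduct.sampleWeight_le`,
  `OuterProduct.card_lt_lt`). The exceeding products form an initial segment of every row, and are
  added to the list of the entries of `Z` row by row, by means of a dense work row
  (`RealRAM.mergeProg_spec`).
* The list may then have up to `64 * 16 ^ h ≥ 8 * ell` entries. A threshold that at most half as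
  many entries exceed and at least a quarter as many reach is found by repeatedly ranking the
  elements of small groups and keeping every eighth element of each group, with groups that become larger
  while the number of elements shrinks (`RealRAM.roundLoop_spec`, `RealRAM.selectProg_spec`).

Programs are verified with total correctness triples with a time bound (`RealRAM.Run`). A program
changes only the memory that occurs in it as a target (`RealRAM.Frame`), and the given sorting
program is moved to the memory with names from `100` on (`RealRAM.Exec.shift`), out of the way of
the rest.

The memory is used as follows. Variables: `nv 0` is `n`, `nv 1` is `k`, `nv 2` is `ell`, `nv 3` is
the capacity of the lists, `nv 4` and `nv 6` are the lengths of the two lists, `nv 5` is the number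
of outer products seen, `rv 0` is `ε`, and `rv 1`, `rv 2` are the two thresholds. Lists of triples
are in `na 0`, `na 1`, `ra 0` (the entries of `Z`) and in `na 2`, `na 3`, `ra 1` (after merging).
The array `ra 2` is the work row; `ra 3` is the column `a`, `ra 4` and `ra 5` are the sorted
factors, `na 4` records the positions of the entries of `ra 5`, and `ra 6`, `ra 7` are used by the
selection.
-/

namespace RealRAM

/-! ### Updating memory states -/

namespace State

/-- The state after word variable `x` received the value `v`. -/
def setN (s : State) (x v : ℕ) : State := { s with nv := Function.update s.nv x v }

/-- The state after real variable `x` received the value `v`. -/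
def setR (s : State) (x : ℕ) (v : ℝ) : State := { s with rv := Function.update s.rv x v }

/-- The state after cell `i` of word array `a` received the value `v`. -/
def putN (s : State) (a i v : ℕ) : State :=
  { s with na := Function.update s.na a (Function.update (s.na a) i v) }

/-- The state after cell `i` of real array `a` received the value `v`. -/
def putR (s : State) (a i : ℕ) (v : ℝ) : State :=
  { s with ra := Function.update s.ra a (Function.update (s.ra a) i v) }

/-- The state after the rest of tape `τ` became `l`. -/
def setTape (s : State) (τ : Fin 2) (l : List ℝ) : State :=
  { s with tape := Function.update s.tape τ l }

variable (s : State) (x y a b i j : ℕ) (v : ℕ) (r : ℝ) (τ σ : Fin 2) (l : List ℝ)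

@[simp] theorem setN_nv : (s.setN x v).nv y = if y = x then v else s.nv y :=
  Function.update_apply ..
@[simp] theorem setN_rv : (s.setN x v).rv = s.rv := rfl
@[simp] theorem setN_na : (s.setN x v).na = s.na := rfl
@[simp] theorem setN_ra : (s.setN x v).ra = s.ra := rfl
@[simp] theorem setN_tape : (s.setN x v).tape = s.tape := rfl
@[simp] theorem setR_rv : (s.setR x r).rv y = if y = x then r else s.rv y :=
  Function.update_apply ..
@[simp] theorem setR_nv : (s.setR x r).nv = s.nv := rfl
@[simp] theorem setR_na : (s.setR x r).na = s.na := rfl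
@[simp] theorem setR_ra : (s.setR x r).ra = s.ra := rfl
@[simp] theorem setR_tape : (s.setR x r).tape = s.tape := rfl
@[simp] theorem putN_na :
    (s.putN a i v).na b j = if b = a ∧ j = i then v else s.na b j := by
  by_cases h : b = a
  · subst h; simp [putN, Function.update_apply]
  · simp [putN, h]
@[simp] theorem putN_nv : (s.putN a i v).nv = s.nv := rfl
@[simp] theorem putN_rv : (s.putN a i v).rv = s.rv := rfl
@[simp] theorem putN_ra : (s.putN a i v).ra = s.ra := rfl
@[simp] theorem putN_tape : (s.putN a i v).tape = s.tape := rfl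
@[simp] theorem putR_ra :
    (s.putR a i r).ra b j = if b = a ∧ j = i then r else s.ra b j := by
  by_cases h : b = a
  · subst h; simp [putR, Function.update_apply]
  · simp [putR, h]
@[simp] theorem putR_nv : (s.putR a i r).nv = s.nv := rfl
@[simp] theorem putR_rv : (s.putR a i r).rv = s.rv := rfl
@[simp] theorem putR_na : (s.putR a i r).na = s.na := rfl
@[simp] theorem putR_tape : (s.putR a i r).tape = s.tape := rfl
@[simp] theorem setTape_tape :
    (s.setTape τ l).tape σ = if σ = τ then l else s.tape σ := Function.update_apply ..
@[simp] theorem setTape_nv : (s.setTape τ l).nv = s.nv := rfl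
@[simp] theorem setTape_rv : (s.setTape τ l).rv = s.rv := rfl
@[simp] theorem setTape_na : (s.setTape τ l).na = s.na := rfl
@[simp] theorem setTape_ra : (s.setTape τ l).ra = s.ra := rfl

end State

/-! ### Values of expressions and the conditions under which they are defined -/

/-- The value of a word expression where it is defined (see `NExp.ok`). -/
@[simp] def NExp.val (s : State) : NExp → ℕ
  | .lit c => c
  | .var x => s.nv x
  | .get a e => s.na a (e.val s)
  | .add e f => e.val s + f.val s
  | .sub e f => e.val s - f.val s
  | .mul e f => e.val s * f.val s
  | .div e f => e.val s / f.val s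

/-- The word expression is defined: no overflow, no division by `0`, no access out of range. -/
@[simp] def NExp.ok (S W : ℕ) (s : State) : NExp → Prop
  | .lit c => c ≤ W
  | .var _ => True
  | .get _ e => e.ok S W s ∧ e.val s < S
  | .add e f => e.ok S W s ∧ f.ok S W s ∧ e.val s + f.val s ≤ W
  | .sub e f => e.ok S W s ∧ f.ok S W s
  | .mul e f => e.ok S W s ∧ f.ok S W s ∧ e.val s * f.val s ≤ W
  | .div e f => e.ok S W s ∧ f.ok S W s ∧ f.val s ≠ 0

theorem NExp.eval_eq {S W : ℕ} {s : State} {e : NExp} (h : e.ok S W s) :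
    e.eval S W s = some (e.val s) := by
  induction e <;> simp_all [NExp.eval, word]

/-- The value of a real expression where it is defined (see `RExp.ok`). -/
@[simp] noncomputable def RExp.val (s : State) : RExp → ℝ
  | .lit c => (c : ℝ)
  | .var x => s.rv x
  | .get a e => s.ra a (e.val s)
  | .add e f => e.val s + f.val s
  | .sub e f => e.val s - f.val s
  | .mul e f => e.val s * f.val s
  | .div e f => e.val s / f.val s

/-- The real expression is defined: no division by `0`, no access out of range. -/
@[simp] def RExp.ok (S W : ℕ) (s : State) : RExp → Prop
  | .lit _ => True
  | .var _ => True
  | .get _ e => e.ok S W s ∧ e.val s < S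
  | .add e f => e.ok S W s ∧ f.ok S W s
  | .sub e f => e.ok S W s ∧ f.ok S W s
  | .mul e f => e.ok S W s ∧ f.ok S W s
  | .div e f => e.ok S W s ∧ f.ok S W s ∧ f.val s ≠ 0

theorem RExp.eval_eq {S W : ℕ} {s : State} {e : RExp} (h : e.ok S W s) :
    e.eval S W s = some (e.val s) := by
  induction e <;> simp_all [RExp.eval, NExp.eval_eq]

/-- The truth value of a test where it is defined (see `BExp.ok`). -/
@[simp] def BExp.val (s : State) : BExp → Prop
  | .nlt e f => e.val s < f.val s
  | .neq e f => e.val s = f.val s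
  | .rlt e f => e.val s < f.val s
  | .not b => ¬ b.val s
  | .and b c => b.val s ∧ c.val s

/-- The test is defined; the second part of a conjunction matters only if the first one holds. -/
@[simp] def BExp.ok (S W : ℕ) (s : State) : BExp → Prop
  | .nlt e f => e.ok S W s ∧ f.ok S W s
  | .neq e f => e.ok S W s ∧ f.ok S W s
  | .rlt e f => e.ok S W s ∧ f.ok S W s
  | .not b => b.ok S W s
  | .and b c => b.ok S W s ∧ (b.val s → c.ok S W s)

open Classical in
theorem BExp.eval_eq {S W : ℕ} {s : State} {b : BExp} (h : b.ok S W s) :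
    b.eval S W s = some (decide (b.val s)) := by
  induction b with
  | nlt e f | neq e f =>
    simp only [BExp.eval, NExp.eval_eq h.1, NExp.eval_eq h.2, Option.bind_some, BExp.val]
    congr
  | rlt e f =>
    simp only [BExp.eval, RExp.eval_eq h.1, RExp.eval_eq h.2, Option.bind_some, BExp.val]
    congr
  | not b ih => by_cases hb : b.val s <;> simp [BExp.eval, ih h, hb]
  | and b c ihb ihc =>
    by_cases hb : b.val s
    · simp [BExp.eval, ihb h.1, hb, ihc (h.2 hb)]
    · simp [BExp.eval, ihb h.1, hb]

theorem BExp.eval_true {S W : ℕ} {s : State} {b : BExp} (h : b.ok S W s) (hv : b.val s) :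
    b.eval S W s = some true := by simp [BExp.eval_eq h, hv]

theorem BExp.eval_false {S W : ℕ} {s : State} {b : BExp} (h : b.ok S W s) (hv : ¬ b.val s) :
    b.eval S W s = some false := by simp [BExp.eval_eq h, hv]

/-! ### The memory a program may change -/

namespace Stmt

/-- Word variables assigned by a program. -/
def wnv : Stmt → List ℕ
  | .setN x _ => [x]
  | .seq p q | .ite _ p q => wnv p ++ wnv q
  | .loop _ p => wnv p
  | _ => []

/-- Real variables assigned by a program. -/
def wrv : Stmt → List ℕ
  | .setR x _ | .read _ x => [x]
  | .seq p q | .ite _ p q => wrv p ++ wrv q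
  | .loop _ p => wrv p
  | _ => []

/-- Word arrays written by a program. -/
def wna : Stmt → List ℕ
  | .putN a _ _ => [a]
  | .seq p q | .ite _ p q => wna p ++ wna q
  | .loop _ p => wna p
  | _ => []

/-- Real arrays written by a program. -/
def wra : Stmt → List ℕ
  | .putR a _ _ => [a]
  | .seq p q | .ite _ p q => wra p ++ wra q
  | .loop _ p => wra p
  | _ => []

/-- Tapes read by a program. -/
def rtape : Stmt → List (Fin 2)
  | .read τ _ => [τ]
  | .seq p q | .ite _ p q => rtape p ++ rtape q
  | .loop _ p => rtape p
  | _ => []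

end Stmt

/-- `s'` differs from `s` at most in memory that the program `p` may change. -/
structure Frame (p : Stmt) (s s' : State) : Prop where
  nv : ∀ x, x ∉ p.wnv → s'.nv x = s.nv x
  rv : ∀ x, x ∉ p.wrv → s'.rv x = s.rv x
  na : ∀ x, x ∉ p.wna → s'.na x = s.na x
  ra : ∀ x, x ∉ p.wra → s'.ra x = s.ra x
  tape : ∀ x, x ∉ p.rtape → s'.tape x = s.tape x

theorem Frame.refl (p : Stmt) (s : State) : Frame p s s :=
  ⟨fun _ _ => rfl, fun _ _ => rfl, fun _ _ => rfl, fun _ _ => rfl, fun _ _ => rfl⟩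

theorem Frame.trans {p : Stmt} {s s' s'' : State} (h : Frame p s s') (h' : Frame p s' s'') :
    Frame p s s'' :=
  ⟨fun x hx => (h'.nv x hx).trans (h.nv x hx), fun x hx => (h'.rv x hx).trans (h.rv x hx),
    fun x hx => (h'.na x hx).trans (h.na x hx), fun x hx => (h'.ra x hx).trans (h.ra x hx),
    fun x hx => (h'.tape x hx).trans (h.tape x hx)⟩

theorem Exec.frame {S W : ℕ} {p : Stmt} {s s' : State} {t : ℕ} (h : Exec S W p s s' t) :
    Frame p s s' := by
  induction h with
  | skip s => exact Frame.refl _ _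
  | seq hp hq ihp ihq =>
    constructor <;> intro x hx <;>
      simp only [Stmt.wnv, Stmt.wrv, Stmt.wna, Stmt.wra, Stmt.rtape, List.mem_append, not_or] at hx
    · rw [ihq.nv x hx.2, ihp.nv x hx.1]
    · rw [ihq.rv x hx.2, ihp.rv x hx.1]
    · rw [ihq.na x hx.2, ihp.na x hx.1]
    · rw [ihq.ra x hx.2, ihp.ra x hx.1]
    · rw [ihq.tape x hx.2, ihp.tape x hx.1]
  | iteTrue hb hp ih =>
    constructor <;> intro x hx <;>
      simp only [Stmt.wnv, Stmt.wrv, Stmt.wna, Stmt.wra, Stmt.rtape, List.mem_append, not_or] at hx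
    exacts [ih.nv x hx.1, ih.rv x hx.1, ih.na x hx.1, ih.ra x hx.1, ih.tape x hx.1]
  | iteFalse hb hp ih =>
    constructor <;> intro x hx <;>
      simp only [Stmt.wnv, Stmt.wrv, Stmt.wna, Stmt.wra, Stmt.rtape, List.mem_append, not_or] at hx
    exacts [ih.nv x hx.2, ih.rv x hx.2, ih.na x hx.2, ih.ra x hx.2, ih.tape x hx.2]
  | loopDone hb => exact Frame.refl _ _
  | loopStep hb hp hl ihp ihl =>
    exact Frame.trans ⟨ihp.nv, ihp.rv, ihp.na, ihp.ra, ihp.tape⟩ ihl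
  | _ =>
    constructor <;> intro x hx <;>
      simp_all [Stmt.wnv, Stmt.wrv, Stmt.wna, Stmt.wra, Stmt.rtape]

/-! ### Reasoning about terminating runs -/

/-- Started in `s`, the program `p` halts after at most `T` steps in a state that satisfies `Q`. -/
def Run (S W : ℕ) (p : Stmt) (s : State) (T : ℕ) (Q : State → Prop) : Prop :=
  ∃ s' t, Exec S W p s s' t ∧ t ≤ T ∧ Q s'

namespace Run

variable {S W : ℕ} {p q : Stmt} {s : State} {T T' : ℕ} {Q Q' : State → Prop}

theorem weaken (h : Run S W p s T Q) (hT : T ≤ T')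
    (hQ : ∀ s', Frame p s s' → Q s' → Q' s') : Run S W p s T' Q' := by
  obtain ⟨s', t, he, ht, hq⟩ := h
  exact ⟨s', t, he, ht.trans hT, hQ s' he.frame hq⟩

theorem skip (h : Q s) : Run S W .skip s 1 Q := ⟨_, _, .skip s, le_rfl, h⟩

theorem setN {x : ℕ} {e : NExp} (he : e.ok S W s) (h : Q (s.setN x (e.val s))) :
    Run S W (.setN x e) s 1 Q := ⟨_, _, .setN (NExp.eval_eq he), le_rfl, h⟩

theorem setR {x : ℕ} {e : RExp} (he : e.ok S W s) (h : Q (s.setR x (e.val s))) :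
    Run S W (.setR x e) s 1 Q := ⟨_, _, .setR (RExp.eval_eq he), le_rfl, h⟩

theorem putN {a : ℕ} {i e : NExp} (hi : i.ok S W s) (hS : i.val s < S) (he : e.ok S W s)
    (h : Q (s.putN a (i.val s) (e.val s))) : Run S W (.putN a i e) s 1 Q :=
  ⟨_, _, .putN (NExp.eval_eq hi) hS (NExp.eval_eq he), le_rfl, h⟩

theorem putR {a : ℕ} {i : NExp} {e : RExp} (hi : i.ok S W s) (hS : i.val s < S)
    (he : e.ok S W s) (h : Q (s.putR a (i.val s) (e.val s))) : Run S W (.putR a i e) s 1 Q :=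
  ⟨_, _, .putR (NExp.eval_eq hi) hS (RExp.eval_eq he), le_rfl, h⟩

theorem read {τ : Fin 2} {x : ℕ} {v : ℝ} {l : List ℝ} (hl : s.tape τ = v :: l)
    (h : Q ((s.setR x v).setTape τ l)) : Run S W (.read τ x) s 1 Q :=
  ⟨_, _, .read hl, le_rfl, h⟩

theorem seq (h : Run S W p s T fun s' => Run S W q s' T' Q) :
    Run S W (.seq p q) s (T + T') Q := by
  obtain ⟨s', t, he, ht, s'', t', he', ht', hq⟩ := h
  exact ⟨s'', _, he.seq he', by omega, hq⟩

theorem ite {b : BExp} (hb : b.ok S W s) (hp : b.val s → Run S W p s T Q)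
    (hq : ¬ b.val s → Run S W q s T Q) : Run S W (.ite b p q) s (T + 1) Q := by
  by_cases hv : b.val s
  · obtain ⟨s', t, he, ht, h⟩ := hp hv
    exact ⟨s', _, .iteTrue (BExp.eval_true hb hv) he, by omega, h⟩
  · obtain ⟨s', t, he, ht, h⟩ := hq hv
    exact ⟨s', _, .iteFalse (BExp.eval_false hb hv) he, by omega, h⟩

theorem setN_seq {x : ℕ} {e : NExp} (he : e.ok S W s)
    (h : Run S W q (s.setN x (e.val s)) T Q) : Run S W (.seq (.setN x e) q) s (T + 1) Q := by
  rw [add_comm]; exact seq (setN he h)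

theorem setR_seq {x : ℕ} {e : RExp} (he : e.ok S W s)
    (h : Run S W q (s.setR x (e.val s)) T Q) : Run S W (.seq (.setR x e) q) s (T + 1) Q := by
  rw [add_comm]; exact seq (setR he h)

theorem putN_seq {a : ℕ} {i e : NExp} (hi : i.ok S W s) (hS : i.val s < S) (he : e.ok S W s)
    (h : Run S W q (s.putN a (i.val s) (e.val s)) T Q) :
    Run S W (.seq (.putN a i e) q) s (T + 1) Q := by
  rw [add_comm]; exact seq (putN hi hS he h)

theorem putR_seq {a : ℕ} {i : NExp} {e : RExp} (hi : i.ok S W s) (hS : i.val s < S)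
    (he : e.ok S W s) (h : Run S W q (s.putR a (i.val s) (e.val s)) T Q) :
    Run S W (.seq (.putR a i e) q) s (T + 1) Q := by
  rw [add_comm]; exact seq (putR hi hS he h)

theorem read_seq {τ : Fin 2} {x : ℕ} {v : ℝ} {l : List ℝ} (hl : s.tape τ = v :: l)
    (h : Run S W q ((s.setR x v).setTape τ l) T Q) :
    Run S W (.seq (.read τ x) q) s (T + 1) Q := by
  rw [add_comm]; exact seq (read hl h)

/-- The loop rule. The invariant `I s f` carries a bound `f` on the remaining running time, from
which every round of the loop is paid; it may use that `s` differs from the start state only in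
memory that the body may change. -/
theorem loop {b : BExp} (I : State → ℕ → Prop) {s₀ : State} {f₀ : ℕ} (h₀ : I s₀ f₀)
    (step : ∀ s f, Frame p s₀ s → I s f → b.ok S W s ∧
      (¬ b.val s → 1 ≤ f ∧ Q s) ∧
      (b.val s → ∃ T f', T + f' + 1 ≤ f ∧ Run S W p s T fun s' => I s' f')) :
    Run S W (.loop b p) s₀ f₀ Q := by
  suffices ∀ f s, Frame p s₀ s → I s f → Run S W (.loop b p) s f Q from
    this f₀ s₀ (.refl _ _) h₀
  intro f
  induction f using Nat.strong_induction_on with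
  | _ f ih =>
    intro s hF hI
    obtain ⟨hok, hfalse, htrue⟩ := step s f hF hI
    by_cases hv : b.val s
    · obtain ⟨T, f', hf, s', t, he, ht, hI'⟩ := htrue hv
      obtain ⟨s'', t', he', ht', hQ⟩ := ih f' (by omega) s' (hF.trans he.frame) hI'
      exact ⟨s'', _, .loopStep (BExp.eval_true hok hv) he he', by omega, hQ⟩
    · obtain ⟨hf, hQ⟩ := hfalse hv
      exact ⟨s, _, .loopDone (BExp.eval_false hok hv), hf, hQ⟩

end Run

theorem Frame.setN {s : State} {x v : ℕ} (p : Stmt) (hx : x ∈ p.wnv) :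
    Frame p s (s.setN x v) where
  nv y hy := by
    have : y ≠ x := fun h => hy (h ▸ hx)
    simp [this]
  rv _ _ := rfl
  na _ _ := rfl
  ra _ _ := rfl
  tape _ _ := rfl

/-- `for i := 0 to b - 1 do p`, where `b` is evaluated anew in every round. -/
def Stmt.forUp (i : ℕ) (b : NExp) (p : Stmt) : Stmt :=
  .seq (.setN i (.lit 0)) (.loop (.nlt (.var i) b) (.seq p (.setN i (.add (.var i) (.lit 1)))))

theorem Frame.forUp_of_loop {i : ℕ} {b : NExp} {p : Stmt} {s₀ s : State}
    (hF : Frame (.seq p (.setN i (.add (.var i) (.lit 1)))) (s₀.setN i 0) s) :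
    Frame (Stmt.forUp i b p) s₀ s := by
  refine Frame.trans (s' := s₀.setN i 0) ?_ ?_
  · constructor <;> intro y hy <;> simp_all [Stmt.forUp, Stmt.wnv]
  · constructor <;> intro y hy <;>
      simp only [Stmt.forUp, Stmt.wnv, Stmt.wrv, Stmt.wna, Stmt.wra, Stmt.rtape, List.mem_append,
        not_or] at hy
    exacts [hF.nv y (by simpa [Stmt.wnv] using hy.2), hF.rv y (by simpa [Stmt.wrv] using hy.2),
      hF.na y (by simpa [Stmt.wna] using hy.2), hF.ra y (by simpa [Stmt.wra] using hy.2),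
      hF.tape y (by simpa [Stmt.rtape] using hy.2)]

/-- The rule for counting loops with a fixed bound `m`, where round `x` takes time `T x`. -/
theorem Run.forUp_sum {S W : ℕ} {p : Stmt} {s₀ : State} {i : ℕ} {b : NExp} (m : ℕ) (T : ℕ → ℕ)
    (I : ℕ → State → Prop) (hW : m < W)
    (hb : ∀ s, Frame (Stmt.forUp i b p) s₀ s → b.ok S W s ∧ b.val s = m)
    (h₀ : I 0 (s₀.setN i 0))
    (step : ∀ x s, x < m → Frame (Stmt.forUp i b p) s₀ s → s.nv i = x → I x s →
      Run S W p s (T x) fun s' => s'.nv i = x ∧ I (x + 1) (s'.setN i (x + 1))) :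
    Run S W (Stmt.forUp i b p) s₀ (∑ x ∈ Finset.range m, (T x + 2) + 2) fun s' => I m s' := by
  refine Run.setN_seq (by simp) ?_
  refine Run.loop (fun s f => ∃ x d, x + d = m ∧
      f = ∑ y ∈ Finset.range d, (T (x + y) + 2) + 1 ∧ s.nv i = x ∧ I x s)
    ⟨0, m, by simp, by simp, by simp, h₀⟩ ?_
  rintro s f hF ⟨x, d, rfl, rfl, hi, hI⟩
  have hF' := Frame.forUp_of_loop (b := b) hF
  obtain ⟨hbo, hbv⟩ := hb s hF'
  refine ⟨by simp [hbo], fun hv => ?_, fun hv => ?_⟩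
  · obtain rfl : d = 0 := by simp [hi, hbv] at hv; omega
    exact ⟨by omega, hI⟩
  · obtain ⟨d, rfl⟩ : ∃ d', d = d' + 1 :=
      Nat.exists_eq_add_one.2 (by simpa [hi, hbv] using hv)
    refine ⟨T x + 1, _, ?_, Run.seq ((step x s (by omega) hF' hi hI).weaken le_rfl
      fun s' _ hs' => Run.setN (by simp; omega) ⟨x + 1, d, by omega, rfl, by simp [hs'.1], ?_⟩)⟩
    · rw [Finset.sum_range_succ' _ d]
      have h : ∑ y ∈ Finset.range d, (T (x + (y + 1)) + 2) =
          ∑ y ∈ Finset.range d, (T (x + 1 + y) + 2) :=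
        Finset.sum_congr rfl fun y _ => by rw [add_assoc x, add_comm 1]
      rw [h, add_zero]
      omega
    · simpa [hs'.1] using hs'.2

/-- The rule for counting loops with a fixed bound `m` and a bound `T` on the time of a round. -/
theorem Run.forUp {S W : ℕ} {p : Stmt} {s₀ : State} {i : ℕ} {b : NExp} (m T : ℕ)
    (I : ℕ → State → Prop) (hW : m < W)
    (hb : ∀ s, Frame (Stmt.forUp i b p) s₀ s → b.ok S W s ∧ b.val s = m)
    (h₀ : I 0 (s₀.setN i 0))
    (step : ∀ x s, x < m → Frame (Stmt.forUp i b p) s₀ s → s.nv i = x → I x s →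
      Run S W p s T fun s' => s'.nv i = x ∧ I (x + 1) (s'.setN i (x + 1))) :
    Run S W (Stmt.forUp i b p) s₀ (m * (T + 2) + 2) fun s' => I m s' := by
  simpa using Run.forUp_sum m (fun _ => T) I hW hb h₀ step

/-- `for i := 1, 2, 4, 8, ... while i ≤ b do p`. -/
def Stmt.forPow (i : ℕ) (b : NExp) (p : Stmt) : Stmt :=
  .seq (.setN i (.lit 1))
    (.loop (.not (.nlt b (.var i))) (.seq p (.setN i (.mul (.lit 2) (.var i)))))

/-- The rule for loops over powers of `2` with a fixed bound `m`. -/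
theorem Run.forPow {S W : ℕ} {p : Stmt} {s₀ : State} {i : ℕ} {b : NExp} (m T : ℕ)
    (I : ℕ → State → Prop) (hW : 2 * m + 1 < W)
    (hb : ∀ s, Frame (Stmt.forPow i b p) s₀ s → b.ok S W s ∧ b.val s = m)
    (h₀ : I 0 (s₀.setN i 1))
    (step : ∀ x s, x < m.size → Frame (Stmt.forPow i b p) s₀ s → s.nv i = 2 ^ x → I x s →
      Run S W p s T fun s' => s'.nv i = 2 ^ x ∧ I (x + 1) (s'.setN i (2 ^ (x + 1)))) :
    Run S W (Stmt.forPow i b p) s₀ (m.size * (T + 2) + 2) fun s' => I m.size s' := by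
  refine Run.setN_seq (by simp; omega) ?_
  refine Run.loop (fun s f => ∃ x d, x + d = m.size ∧ f = d * (T + 2) + 1 ∧
    s.nv i = 2 ^ x ∧ I x s) ⟨0, m.size, by simp, by simp, by simp, h₀⟩ ?_
  rintro s f hF ⟨x, d, hx, rfl, hi, hI⟩
  have hF' : Frame (Stmt.forPow i b p) s₀ s :=
    Frame.trans (s' := s₀.setN i 1) (by
      constructor <;> intro y hy <;> simp_all [Stmt.forPow, Stmt.wnv]) (by
      constructor <;> intro y hy <;>
        simp only [Stmt.forPow, Stmt.wnv, Stmt.wrv, Stmt.wna, Stmt.wra, Stmt.rtape,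
          List.mem_append, not_or] at hy
      exacts [hF.nv y (by simpa [Stmt.wnv] using hy.2), hF.rv y (by simpa [Stmt.wrv] using hy.2),
        hF.na y (by simpa [Stmt.wna] using hy.2), hF.ra y (by simpa [Stmt.wra] using hy.2),
        hF.tape y (by simpa [Stmt.rtape] using hy.2)])
  obtain ⟨hbo, hbv⟩ := hb s hF'
  have hiff : (BExp.not (.nlt b (.var i))).val s ↔ x < m.size := by
    simp [hbv, hi, Nat.lt_size]
  refine ⟨by simp [hbo], fun hv => ?_, fun hv => ?_⟩
  · rw [hiff] at hv
    obtain rfl : x = m.size := by omega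
    exact ⟨by omega, hI⟩
  · rw [hiff] at hv
    obtain ⟨d, rfl⟩ : ∃ d', d = d' + 1 := Nat.exists_eq_add_one.2 (by omega)
    refine ⟨T + 1, _, ?_, Run.seq ((step x s hv hF' hi hI).weaken le_rfl
      fun s' _ hs' => Run.setN ?_ ⟨x + 1, d, by omega, rfl, ?_, ?_⟩)⟩
    · ring_nf; omega
    · have := Nat.lt_size.1 hv
      simp [hs'.1]; omega
    · simp [hs'.1, pow_succ, mul_comm]
    · simpa [hs'.1, pow_succ, mul_comm] using hs'.2

/-! ### Larger machines, and moving a program to other memory -/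

theorem word_mono {W W' v u : ℕ} (hW : W ≤ W') (h : word W v = some u) : word W' v = some u := by
  unfold word at *
  split_ifs at h with h'
  rw [if_pos (h'.trans hW), h]

theorem NExp.eval_mono {S S' W W' : ℕ} (hS : S ≤ S') (hW : W ≤ W') {s : State} {e : NExp} {v : ℕ}
    (h : e.eval S W s = some v) : e.eval S' W' s = some v := by
  induction e generalizing v with
  | lit c => exact word_mono hW h
  | var x => exact h
  | get a e ih =>
    simp only [NExp.eval, Option.bind_eq_some_iff] at h ⊢
    obtain ⟨i, hi, h⟩ := h
    refine ⟨i, ih hi, ?_⟩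
    split_ifs at h with h'
    rw [if_pos (h'.trans_le hS), h]
  | add e f ihe ihf =>
    simp only [NExp.eval, Option.bind_eq_some_iff] at h ⊢
    obtain ⟨x, hx, y, hy, h⟩ := h
    exact ⟨x, ihe hx, y, ihf hy, word_mono hW h⟩
  | mul e f ihe ihf =>
    simp only [NExp.eval, Option.bind_eq_some_iff] at h ⊢
    obtain ⟨x, hx, y, hy, h⟩ := h
    exact ⟨x, ihe hx, y, ihf hy, word_mono hW h⟩
  | sub e f ihe ihf =>
    simp only [NExp.eval, Option.bind_eq_some_iff] at h ⊢
    obtain ⟨x, hx, y, hy, h⟩ := h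
    exact ⟨x, ihe hx, y, ihf hy, h⟩
  | div e f ihe ihf =>
    simp only [NExp.eval, Option.bind_eq_some_iff] at h ⊢
    obtain ⟨x, hx, y, hy, h⟩ := h
    exact ⟨x, ihe hx, y, ihf hy, h⟩

theorem RExp.eval_mono {S S' W W' : ℕ} (hS : S ≤ S') (hW : W ≤ W') {s : State} {e : RExp} {v : ℝ}
    (h : e.eval S W s = some v) : e.eval S' W' s = some v := by
  induction e generalizing v with
  | lit c => exact h
  | var x => exact h
  | get a e =>
    simp only [RExp.eval, Option.bind_eq_some_iff] at h ⊢
    obtain ⟨i, hi, h⟩ := h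
    refine ⟨i, NExp.eval_mono hS hW hi, ?_⟩
    split_ifs at h with h'
    rw [if_pos (h'.trans_le hS), h]
  | _ e f ihe ihf =>
    simp only [RExp.eval, Option.bind_eq_some_iff] at h ⊢
    obtain ⟨x, hx, y, hy, h⟩ := h
    exact ⟨x, ihe hx, y, ihf hy, h⟩

theorem BExp.eval_mono {S S' W W' : ℕ} (hS : S ≤ S') (hW : W ≤ W') {s : State} {b : BExp}
    {v : Bool} (h : b.eval S W s = some v) : b.eval S' W' s = some v := by
  induction b generalizing v with
  | nlt e f | neq e f =>
    simp only [BExp.eval, Option.bind_eq_some_iff] at h ⊢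
    obtain ⟨x, hx, y, hy, h⟩ := h
    exact ⟨x, NExp.eval_mono hS hW hx, y, NExp.eval_mono hS hW hy, h⟩
  | rlt e f =>
    simp only [BExp.eval, Option.bind_eq_some_iff] at h ⊢
    obtain ⟨x, hx, y, hy, h⟩ := h
    exact ⟨x, RExp.eval_mono hS hW hx, y, RExp.eval_mono hS hW hy, h⟩
  | not b ih =>
    simp only [BExp.eval, Option.bind_eq_some_iff] at h ⊢
    obtain ⟨x, hx, h⟩ := h
    exact ⟨x, ih hx, h⟩
  | and b c ihb ihc =>
    simp only [BExp.eval, Option.bind_eq_some_iff] at h ⊢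
    obtain ⟨x, hx, h⟩ := h
    refine ⟨x, ihb hx, ?_⟩
    cases x
    · exact h
    · exact ihc h

/-- A run remains possible on a machine with more cells and longer words. -/
theorem Exec.mono {S S' W W' : ℕ} (hS : S ≤ S') (hW : W ≤ W') {p : Stmt} {s s' : State} {t : ℕ}
    (h : Exec S W p s s' t) : Exec S' W' p s s' t := by
  induction h with
  | skip s => exact .skip s
  | setN he => exact .setN (NExp.eval_mono hS hW he)
  | setR he => exact .setR (RExp.eval_mono hS hW he)
  | putN hi hj he =>
    exact .putN (NExp.eval_mono hS hW hi) (Nat.lt_of_lt_of_le hj hS)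
      (NExp.eval_mono hS hW he)
  | putR hi hj he =>
    exact .putR (NExp.eval_mono hS hW hi) (Nat.lt_of_lt_of_le hj hS)
      (RExp.eval_mono hS hW he)
  | read h => exact .read h
  | seq _ _ ihp ihq => exact .seq ihp ihq
  | iteTrue hb _ ih => exact .iteTrue (BExp.eval_mono hS hW hb) ih
  | iteFalse hb _ ih => exact .iteFalse (BExp.eval_mono hS hW hb) ih
  | loopDone hb => exact .loopDone (BExp.eval_mono hS hW hb)
  | loopStep hb _ _ ihp ihl => exact .loopStep (BExp.eval_mono hS hW hb) ihp ihl

/-- The expression with the number `k` added to the names of all variables and arrays. -/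
def NExp.shift (k : ℕ) : NExp → NExp
  | .lit c => .lit c
  | .var x => .var (x + k)
  | .get a e => .get (a + k) (e.shift k)
  | .add e f => .add (e.shift k) (f.shift k)
  | .sub e f => .sub (e.shift k) (f.shift k)
  | .mul e f => .mul (e.shift k) (f.shift k)
  | .div e f => .div (e.shift k) (f.shift k)

/-- The expression with the number `k` added to the names of all variables and arrays. -/
def RExp.shift (k : ℕ) : RExp → RExp
  | .lit c => .lit c
  | .var x => .var (x + k)
  | .get a e => .get (a + k) (e.shift k)
  | .add e f => .add (e.shift k) (f.shift k)
  | .sub e f => .sub (e.shift k) (f.shift k)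
  | .mul e f => .mul (e.shift k) (f.shift k)
  | .div e f => .div (e.shift k) (f.shift k)

/-- The test with the number `k` added to the names of all variables and arrays. -/
def BExp.shift (k : ℕ) : BExp → BExp
  | .nlt e f => .nlt (e.shift k) (f.shift k)
  | .neq e f => .neq (e.shift k) (f.shift k)
  | .rlt e f => .rlt (e.shift k) (f.shift k)
  | .not b => .not (b.shift k)
  | .and b c => .and (b.shift k) (c.shift k)

/-- The program with the number `k` added to the names of all variables and arrays. It leaves the
variables and arrays with names below `k` alone. -/
def Stmt.shift (k : ℕ) : Stmt → Stmt
  | .skip => .skip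
  | .setN x e => .setN (x + k) (e.shift k)
  | .setR x e => .setR (x + k) (e.shift k)
  | .putN a i e => .putN (a + k) (i.shift k) (e.shift k)
  | .putR a i e => .putR (a + k) (i.shift k) (e.shift k)
  | .read τ x => .read τ (x + k)
  | .seq p q => .seq (p.shift k) (q.shift k)
  | .ite b p q => .ite (b.shift k) (p.shift k) (q.shift k)
  | .loop b p => .loop (b.shift k) (p.shift k)

/-- The memory that a program moved by `k` sees. -/
def State.above (k : ℕ) (s : State) : State where
  nv x := s.nv (x + k)
  rv x := s.rv (x + k)
  na x := s.na (x + k)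
  ra x := s.ra (x + k)
  tape := s.tape

/-- The memory `s` with everything named `k` or higher replaced by the memory `u`. -/
def State.glue (k : ℕ) (s u : State) : State where
  nv x := if x < k then s.nv x else u.nv (x - k)
  rv x := if x < k then s.rv x else u.rv (x - k)
  na x := if x < k then s.na x else u.na (x - k)
  ra x := if x < k then s.ra x else u.ra (x - k)
  tape := u.tape

theorem NExp.eval_shift {S W k : ℕ} {s : State} (e : NExp) :
    (e.shift k).eval S W s = e.eval S W (s.above k) := by
  induction e <;> simp_all [NExp.eval, NExp.shift, State.above]

theorem RExp.eval_shift {S W k : ℕ} {s : State} (e : RExp) :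
    (e.shift k).eval S W s = e.eval S W (s.above k) := by
  induction e <;> simp_all [RExp.eval, RExp.shift, NExp.eval_shift] <;> simp [State.above]

theorem BExp.eval_shift {S W k : ℕ} {s : State} (b : BExp) :
    (b.shift k).eval S W s = b.eval S W (s.above k) := by
  induction b <;> simp_all [BExp.eval, BExp.shift, NExp.eval_shift, RExp.eval_shift]

@[simp] theorem State.above_glue (k : ℕ) (s u : State) : (s.glue k u).above k = u := by
  simp [State.above, State.glue]

theorem State.glue_above (k : ℕ) (s : State) : s.glue k (s.above k) = s := by
  cases s
  simp only [State.above, State.glue, State.mk.injEq, and_true]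
  refine ⟨?_, ?_, ?_, ?_⟩ <;> ext x <;> split_ifs with h <;>
    first | rfl | rw [Nat.sub_add_cancel (not_lt.1 h)]

theorem glue_update {α : Type*} (k x : ℕ) (f g : ℕ → α) (v : α) :
    (fun y => if y < k then f y else Function.update g x v (y - k)) =
      Function.update (fun y => if y < k then f y else g (y - k)) (x + k) v := by
  ext y
  by_cases hy : y < k
  · have : y ≠ x + k := by omega
    simp [hy, this]
  · by_cases h : y = x + k
    · simp [h]
    · have : y - k ≠ x := by omega
      simp [hy, h, this]

/-- A moved program does in the high part of the memory what the original program does, and keeps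
the low part. -/
theorem Exec.shift {S W k : ℕ} {p : Stmt} {u u' : State} {t : ℕ} (h : Exec S W p u u' t)
    (s : State) : Exec S W (p.shift k) (s.glue k u) (s.glue k u') t := by
  induction h with
  | skip => exact .skip _
  | @setN w x e v he =>
    have := Exec.setN (s := s.glue k w) (x := x + k) (e := e.shift k)
      (by rw [NExp.eval_shift, State.above_glue]; exact he)
    convert this using 1
    · rfl
    simp only [State.glue, State.mk.injEq, and_self, and_true]
    exact glue_update ..
  | @setR w x e v he =>
    have := Exec.setR (s := s.glue k w) (x := x + k) (e := e.shift k)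
      (by rw [RExp.eval_shift, State.above_glue]; exact he)
    convert this using 1
    · rfl
    simp only [State.glue, State.mk.injEq, and_self, and_true, true_and]
    exact glue_update ..
  | @putN w a i e j v hi hj he =>
    have := Exec.putN (s := s.glue k w) (a := a + k) (i := i.shift k) (e := e.shift k)
      (by rw [NExp.eval_shift, State.above_glue]; exact hi) hj
      (by rw [NExp.eval_shift, State.above_glue]; exact he)
    convert this using 1
    · rfl
    simp only [State.glue, State.mk.injEq, and_self, and_true, true_and]
    rw [glue_update]; simp
  | @putR w a i e j v hi hj he =>
    have := Exec.putR (s := s.glue k w) (a := a + k) (i := i.shift k) (e := e.shift k)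
      (by rw [NExp.eval_shift, State.above_glue]; exact hi) hj
      (by rw [RExp.eval_shift, State.above_glue]; exact he)
    convert this using 1
    · rfl
    simp only [State.glue, State.mk.injEq, and_true, true_and]
    rw [glue_update]; simp
  | @read w τ x v l h =>
    have := Exec.read (S := S) (W := W) (s := s.glue k w) (τ := τ) (x := x + k) h
    convert this using 1
    · rfl
    simp only [State.glue, State.mk.injEq, and_true, true_and]
    exact glue_update ..
  | seq _ _ ihp ihq => exact .seq ihp ihq
  | iteTrue hb _ ih => exact .iteTrue (by rw [BExp.eval_shift, State.above_glue]; exact hb) ih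
  | iteFalse hb _ ih => exact .iteFalse (by rw [BExp.eval_shift, State.above_glue]; exact hb) ih
  | loopDone hb => exact .loopDone (by rw [BExp.eval_shift, State.above_glue]; exact hb)
  | loopStep hb _ _ ihp ihl =>
    exact .loopStep (by rw [BExp.eval_shift, State.above_glue]; exact hb) ihp ihl

end RealRAM

open Finset

/-! ### A threshold for the products of two sorted sequences -/

namespace OuterProduct

open Classical in
/-- The total weight of the sample products `f (2 ^ a - 1) * g (2 ^ b - 1)` that are at least `θ`,
where the weight of a sample is `2 ^ (a + b)`. -/
noncomputable def sampleWeight (n : ℕ) (f g : ℕ → ℝ) (θ : ℝ) : ℕ :=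
  ∑ a ∈ range n.size, ∑ b ∈ range n.size,
    if θ ≤ f (2 ^ a - 1) * g (2 ^ b - 1) then 2 ^ (a + b) else 0

variable {n : ℕ} {f g : ℕ → ℝ}

theorem two_pow_sub_one_lt {a : ℕ} (ha : a < n.size) : 2 ^ a - 1 < n := by
  have h := Nat.lt_size.1 ha
  have : 0 < 2 ^ a := by positivity
  omega

theorem mul_le_mul_of_antitone (hf : ∀ i j, i ≤ j → j < n → f j ≤ f i)
    (hg : ∀ i j, i ≤ j → j < n → g j ≤ g i) (hf0 : ∀ i < n, 0 ≤ f i) (hg0 : ∀ i < n, 0 ≤ g i)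
    {i i' j j' : ℕ} (hi : i ≤ i') (hi' : i' < n) (hj : j ≤ j') (hj' : j' < n) :
    f i' * g j' ≤ f i * g j :=
  mul_le_mul (hf i i' hi hi') (hg j j' hj hj') (hg0 _ hj') (hf0 _ (hi.trans_lt hi'))

open Classical in
/-- Every product of positions `i ∈ [2 ^ a - 1, 2 ^ (a + 1) - 1)` and
`j ∈ [2 ^ b - 1, 2 ^ (b + 1) - 1)` is at most the sample at the corner of this block. -/
theorem card_lt_le_sum_samples (hf : ∀ i j, i ≤ j → j < n → f j ≤ f i)
    (hg : ∀ i j, i ≤ j → j < n → g j ≤ g i) (hf0 : ∀ i < n, 0 ≤ f i) (hg0 : ∀ i < n, 0 ≤ g i)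
    (θ : ℝ) :
    #{e ∈ range n ×ˢ range n | θ < f e.1 * g e.2} ≤
      ∑ c ∈ range n.size ×ˢ range n.size with θ < f (2 ^ c.1 - 1) * g (2 ^ c.2 - 1),
        2 ^ (c.1 + c.2) := by
  have key : ∀ i < n, ∃ a < n.size, 2 ^ a - 1 ≤ i ∧ i < 2 ^ (a + 1) - 1 := by
    intro i hi
    have h1 := Nat.pow_log_le_self 2 (Nat.succ_ne_zero i)
    have h2 := Nat.lt_pow_succ_log_self (b := 2) (by norm_num) (i + 1)
    refine ⟨Nat.log 2 (i + 1), Nat.lt_size.2 (h1.trans hi), ?_, ?_⟩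
    · simp only [Nat.succ_eq_add_one] at h1; omega
    · omega
  calc #{e ∈ range n ×ˢ range n | θ < f e.1 * g e.2}
      ≤ #(({c ∈ range n.size ×ˢ range n.size | θ < f (2 ^ c.1 - 1) * g (2 ^ c.2 - 1)}).biUnion
          fun c => Ico (2 ^ c.1 - 1) (2 ^ (c.1 + 1) - 1) ×ˢ
            Ico (2 ^ c.2 - 1) (2 ^ (c.2 + 1) - 1)) := by
        refine card_le_card fun e he => ?_
        simp only [mem_filter, mem_product, mem_range] at he
        obtain ⟨⟨h1, h2⟩, h3⟩ := he
        obtain ⟨a, ha, ha1, ha2⟩ := key _ h1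
        obtain ⟨b, hb, hb1, hb2⟩ := key _ h2
        simp only [mem_biUnion, mem_filter, mem_product, mem_range, mem_Ico]
        exact ⟨(a, b), ⟨⟨ha, hb⟩, h3.trans_le (mul_le_mul_of_antitone hf hg hf0 hg0 ha1 h1 hb1 h2)⟩,
          ⟨ha1, ha2⟩, hb1, hb2⟩
    _ ≤ _ := by
        refine card_biUnion_le.trans (sum_le_sum fun c _ => le_of_eq ?_)
        have h : ∀ a : ℕ, 2 ^ (a + 1) - 1 - (2 ^ a - 1) = 2 ^ a := fun a => by
          have : 0 < 2 ^ a := by positivity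
          rw [pow_succ]; omega
        rw [card_product, Nat.card_Ico, Nat.card_Ico, h, h, pow_add]

open Classical in
/-- If `sampleWeight` is less than `w` at every sample that exceeds `θ`, then fewer than `w`
products exceed `θ`: they lie in the blocks of these samples, whose sizes are the weights. -/
theorem card_lt_lt (hf : ∀ i j, i ≤ j → j < n → f j ≤ f i)
    (hg : ∀ i j, i ≤ j → j < n → g j ≤ g i) (hf0 : ∀ i < n, 0 ≤ f i) (hg0 : ∀ i < n, 0 ≤ g i)
    {θ : ℝ} {w : ℕ} (hw : 0 < w)
    (h : ∀ a < n.size, ∀ b < n.size, θ < f (2 ^ a - 1) * g (2 ^ b - 1) →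
      sampleWeight n f g (f (2 ^ a - 1) * g (2 ^ b - 1)) < w) :
    #{e ∈ range n ×ˢ range n | θ < f e.1 * g e.2} < w := by
  refine (card_lt_le_sum_samples hf hg hf0 hg0 θ).trans_lt ?_
  by_cases hne : ({c ∈ range n.size ×ˢ range n.size |
      θ < f (2 ^ c.1 - 1) * g (2 ^ c.2 - 1)}).Nonempty
  · -- the samples above `θ` are those that are at least as large as the smallest of them
    obtain ⟨c, hc, hmin⟩ := exists_min_image _
      (fun c : ℕ × ℕ => f (2 ^ c.1 - 1) * g (2 ^ c.2 - 1)) hne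
    simp only [mem_filter, mem_product, mem_range] at hc hmin
    refine lt_of_eq_of_lt ?_ (h c.1 hc.1.1 c.2 hc.1.2 hc.2)
    rw [sampleWeight, ← sum_product', sum_filter]
    refine sum_congr rfl fun e he => ?_
    simp only [mem_product, mem_range] at he
    refine if_congr ⟨fun h' => hmin e ⟨he, h'⟩, fun h' => hc.2.trans_le h'⟩ rfl rfl
  · rw [not_nonempty_iff_eq_empty.1 hne, sum_empty]
    exact hw

open Classical in
/-- Every product of positions `i ∈ [2 ^ a / 2, 2 ^ a)` and `j ∈ [2 ^ b / 2, 2 ^ b)` is at least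
the sample of weight `2 ^ (a + b)`. These blocks are disjoint, and each of them contains at least a
quarter as many positions as its sample weighs. -/
theorem sampleWeight_le (hf : ∀ i j, i ≤ j → j < n → f j ≤ f i)
    (hg : ∀ i j, i ≤ j → j < n → g j ≤ g i) (hf0 : ∀ i < n, 0 ≤ f i) (hg0 : ∀ i < n, 0 ≤ g i)
    (θ : ℝ) :
    sampleWeight n f g θ ≤ 4 * #{e ∈ range n ×ˢ range n | θ ≤ f e.1 * g e.2} := by
  have hsize : ∀ a i : ℕ, i ∈ Ico (2 ^ a / 2) (2 ^ a) → i.size = a := by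
    intro a i hi
    rw [mem_Ico] at hi
    refine le_antisymm (Nat.size_le.2 hi.2) ?_
    cases a with
    | zero => simp
    | succ a => exact Nat.lt_size.2 (by have := hi.1; rw [pow_succ] at this; omega)
  have hcard : ∀ a : ℕ, 2 ^ a ≤ 2 * #(Ico (2 ^ a / 2) (2 ^ a)) := by
    intro a
    rw [Nat.card_Ico]; omega
  calc sampleWeight n f g θ
      = ∑ c ∈ range n.size ×ˢ range n.size with θ ≤ f (2 ^ c.1 - 1) * g (2 ^ c.2 - 1),
          2 ^ (c.1 + c.2) := by
        rw [sampleWeight, ← sum_product', sum_filter]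
    _ ≤ ∑ c ∈ range n.size ×ˢ range n.size with θ ≤ f (2 ^ c.1 - 1) * g (2 ^ c.2 - 1),
          4 * #(Ico (2 ^ c.1 / 2) (2 ^ c.1) ×ˢ Ico (2 ^ c.2 / 2) (2 ^ c.2)) := by
        refine sum_le_sum fun c _ => ?_
        rw [card_product, pow_add]
        calc 2 ^ c.1 * 2 ^ c.2 ≤ _ := Nat.mul_le_mul (hcard c.1) (hcard c.2)
          _ = _ := by ring
    _ = 4 * #(({c ∈ range n.size ×ˢ range n.size | θ ≤ f (2 ^ c.1 - 1) * g (2 ^ c.2 - 1)}).biUnion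
          fun c => Ico (2 ^ c.1 / 2) (2 ^ c.1) ×ˢ Ico (2 ^ c.2 / 2) (2 ^ c.2)) := by
        rw [← mul_sum, card_biUnion]
        intro c _ c' _ hne
        refine disjoint_left.2 fun e he he' => hne ?_
        rw [mem_product] at he he'
        exact Prod.ext ((hsize _ _ he.1).symm.trans (hsize _ _ he'.1))
          ((hsize _ _ he.2).symm.trans (hsize _ _ he'.2))
    _ ≤ _ := by
        refine Nat.mul_le_mul_left _ (card_le_card fun e he => ?_)
        simp only [mem_biUnion, mem_filter, mem_product, mem_range, mem_Ico] at he ⊢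
        obtain ⟨c, ⟨⟨hc1, hc2⟩, hθ⟩, ⟨_, h1⟩, _, h2⟩ := he
        have k1 := two_pow_sub_one_lt hc1
        have k2 := two_pow_sub_one_lt hc2
        exact ⟨⟨by omega, by omega⟩, hθ.trans
          (mul_le_mul_of_antitone hf hg hf0 hg0 (by omega) k1 (by omega) k2)⟩

theorem sampleWeight_le_sq (n : ℕ) (f g : ℕ → ℝ) (θ : ℝ) : sampleWeight n f g θ ≤ (2 * n) ^ 2 := by
  have h : ∑ a ∈ range n.size, 2 ^ a ≤ 2 * n := by
    rcases Nat.eq_zero_or_pos n with rfl | hn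
    · simp
    · obtain ⟨d, hd⟩ : ∃ d, n.size = d + 1 :=
        Nat.exists_eq_add_one.2 (Nat.size_pos.2 hn)
      have h1 : 2 ^ d ≤ n := Nat.lt_size.1 (by omega)
      have h2 := Nat.geomSum_eq (le_refl 2) n.size
      rw [hd, pow_succ] at h2
      rw [hd, h2]; simp; omega
  calc sampleWeight n f g θ ≤ ∑ a ∈ range n.size, ∑ b ∈ range n.size, 2 ^ a * 2 ^ b := by
        refine sum_le_sum fun a _ => sum_le_sum fun b _ => ?_
        rw [pow_add]; split_ifs <;> simp
    _ = (∑ a ∈ range n.size, 2 ^ a) ^ 2 := by rw [sq, sum_mul_sum]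
    _ ≤ _ := Nat.pow_le_pow_left h 2

/-- The fourth power of a logarithm is dominated by a linear function, so that four nested loops
over the powers of `2` up to `n` are affordable. -/
theorem size_pow_four_le (hn : 1 ≤ n) : n.size ^ 4 ≤ 50 * n := by
  have key : ∀ d : ℕ, (d + 1) ^ 4 ≤ 50 * 2 ^ d := by
    intro d
    rcases lt_or_ge d 6 with h | h
    · interval_cases d <;> norm_num
    · induction d, h using Nat.le_induction with
      | base => norm_num
      | succ d hd ih =>
        have h1 : (d + 1 + 1) ^ 4 ≤ 2 * (d + 1) ^ 4 := by
          obtain ⟨x, rfl⟩ := Nat.exists_eq_add_of_le hd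
          ring_nf; nlinarith [sq_nonneg x]
        have h2 : 2 ^ (d + 1) = 2 * 2 ^ d := by ring
        omega
  obtain ⟨d, hd⟩ : ∃ d, n.size = d + 1 := Nat.exists_eq_add_one.2 (Nat.size_pos.2 hn)
  have h1 : 2 ^ d ≤ n := Nat.lt_size.1 (by omega)
  have h2 := key d
  rw [hd]; omega

end OuterProduct

/-! ### Approximate selection -/

namespace Selection

open Classical in
/-- The number of the first `m` elements of a sequence with a given property. -/
noncomputable def count (p : ℝ → Prop) (v : ℕ → ℝ) (m : ℕ) : ℕ :=
  ∑ x ∈ range m, if p (v x) then 1 else 0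

open Classical in
/-- The number of the first `m` elements of a sequence that precede the element at position `x` in
decreasing order, equal elements being ordered by position. -/
noncomputable def rank (v : ℕ → ℝ) (m x : ℕ) : ℕ :=
  ∑ y ∈ range m, if v x < v y ∨ v x = v y ∧ y < x then 1 else 0

variable {v w : ℕ → ℝ} {m : ℕ}

open Classical in
theorem count_eq_card (p : ℝ → Prop) (v : ℕ → ℝ) (m : ℕ) :
    count p v m = #{x ∈ range m | p (v x)} := by
  rw [count, card_filter]

open Classical in
theorem rank_eq_card (v : ℕ → ℝ) (m x : ℕ) :
    rank v m x = #{y ∈ range m | v x < v y ∨ v x = v y ∧ y < x} := by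
  rw [rank, card_filter]

theorem count_congr (p : ℝ → Prop) (h : ∀ x < m, v x = w x) : count p v m = count p w m := by
  rw [count, count]
  exact sum_congr rfl fun x hx => by rw [h x (mem_range.1 hx)]

theorem count_eq_self {p : ℝ → Prop} (h : ∀ x < m, p (v x)) : count p v m = m := by
  classical
  rw [count_eq_card, filter_true_of_mem fun x hx => h x (mem_range.1 hx), card_range]

open Classical in
theorem rank_succ (v : ℕ → ℝ) (m x : ℕ) :
    rank v (m + 1) x = rank v m x + if v x < v m ∨ v x = v m ∧ m < x then 1 else 0 :=
  sum_range_succ ..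

theorem count_le (p : ℝ → Prop) (v : ℕ → ℝ) (m : ℕ) : count p v m ≤ m := by
  classical
  rw [count_eq_card]
  exact (card_filter_le _ _).trans (by simp)

theorem rank_le (v : ℕ → ℝ) (m x : ℕ) : rank v m x ≤ m := by
  classical
  rw [rank_eq_card]
  exact (card_filter_le _ _).trans (by simp)

/-- The elements with an upward closed property come first in decreasing order. -/
theorem rank_lt_count_iff {p : ℝ → Prop} (hp : ∀ a b, a ≤ b → p a → p b) {x : ℕ} (hx : x < m) :
    rank v m x < count p v m ↔ p (v x) := by
  classical
  rw [rank_eq_card, count_eq_card]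
  constructor
  · intro h
    by_contra hpx
    refine absurd (card_le_card ?_) (not_le.2 h)
    intro y hy
    simp only [mem_filter, mem_range] at hy ⊢
    refine ⟨hy.1, Or.inl ?_⟩
    by_contra hle
    exact hpx (hp _ _ (not_lt.1 hle) hy.2)
  · intro hpx
    refine card_lt_card ((ssubset_iff_of_subset ?_).2 ⟨x, ?_, ?_⟩)
    · intro y hy
      simp only [mem_filter, mem_range] at hy ⊢
      refine ⟨hy.1, hp _ _ ?_ hpx⟩
      rcases hy.2 with h | h
      · exact h.le
      · exact h.1.le
    · simp [hx, hpx]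
    · simp

theorem rank_lt {x : ℕ} (hx : x < m) : rank v m x < m := by
  have h : count (fun _ => True) v m = m := by simp [count]
  simpa [h] using (rank_lt_count_iff (v := v) (p := fun _ => True) (by simp) hx).2 trivial

theorem rank_injOn : Set.InjOn (rank v m) (range m) := by
  classical
  have key : ∀ x ∈ range m, ∀ y ∈ range m, (v x < v y ∨ v x = v y ∧ y < x) →
      rank v m y < rank v m x := by
    intro x hx y hy hlt
    rw [rank_eq_card, rank_eq_card]
    refine card_lt_card ((ssubset_iff_of_subset ?_).2 ⟨y, ?_, by simp⟩)
    · intro z hz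
      simp only [mem_filter, mem_range] at hz ⊢
      refine ⟨hz.1, ?_⟩
      rcases hlt with h | h <;> rcases hz.2 with h' | h'
      · exact Or.inl (h.trans h')
      · exact Or.inl (h'.1 ▸ h)
      · exact Or.inl (h.1 ▸ h')
      · exact Or.inr ⟨h.1.trans h'.1, h'.2.trans h.2⟩
    · exact mem_filter.2 ⟨hy, hlt⟩
  intro x hx y hy hxy
  by_contra hne
  rcases lt_trichotomy (v x) (v y) with h | h | h
  · exact (key x hx y hy (Or.inl h)).ne hxy.symm
  · rcases lt_or_gt_of_ne hne with h' | h'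
    · exact (key y hy x hx (Or.inr ⟨h.symm, h'⟩)).ne hxy
    · exact (key x hx y hy (Or.inr ⟨h, h'⟩)).ne hxy.symm
  · exact (key y hy x hx (Or.inl h)).ne hxy

theorem exists_rank_eq {r : ℕ} (hr : r < m) : ∃ x < m, rank v m x = r := by
  have h := surj_on_of_inj_on_of_card_le (s := range m) (t := range m) (fun x _ => rank v m x)
    (fun x hx => mem_range.2 (rank_lt (mem_range.1 hx)))
    (fun x y hx hy hxy => rank_injOn (mem_coe.2 hx) (mem_coe.2 hy) hxy) le_rfl r (mem_range.2 hr)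
  obtain ⟨x, hx, h⟩ := h
  exact ⟨x, mem_range.1 hx, h.symm⟩

/-- If every eighth element of a sequence in decreasing order is kept, then the number of elements
with an upward closed property is divided by `8` and rounded up. -/
theorem count_every_eighth {p : ℝ → Prop} (hp : ∀ a b, a ≤ b → p a → p b) {g : ℕ}
    (hw : ∀ x < 8 * g, 8 ∣ rank v (8 * g) x → w (rank v (8 * g) x / 8) = v x) :
    count p v (8 * g) ≤ 8 * count p w g ∧ 8 * count p w g ≤ count p v (8 * g) + 7 := by
  classical
  have hle := count_le p v (8 * g)
  have h : count p w g = (count p v (8 * g) + 7) / 8 := by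
    rw [count_eq_card p w]
    have : {x ∈ range g | p (w x)} = range ((count p v (8 * g) + 7) / 8) := by
      ext q
      simp only [mem_filter, mem_range]
      constructor
      · rintro ⟨hq, h⟩
        obtain ⟨x, hx, hr⟩ := exists_rank_eq (v := v) (m := 8 * g) (r := 8 * q) (by omega)
        have := hw x hx (by simp [hr])
        rw [hr, Nat.mul_div_cancel_left _ (by norm_num)] at this
        rw [this, ← rank_lt_count_iff hp hx, hr] at h
        omega
      · intro h
        have hq : q < g := by omega
        obtain ⟨x, hx, hr⟩ := exists_rank_eq (v := v) (m := 8 * g) (r := 8 * q) (by omega)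
        have := hw x hx (by simp [hr])
        rw [hr, Nat.mul_div_cancel_left _ (by norm_num)] at this
        rw [this, ← rank_lt_count_iff hp hx, hr]
        omega
    rw [this, card_range]
  omega

theorem count_add (p : ℝ → Prop) (v : ℕ → ℝ) (a b : ℕ) :
    count p v (a + b) = count p v a + count p (fun x => v (a + x)) b := by
  simp only [count, sum_range_add]

/-- The effect of one round: in each of `q` groups of `8 * g` elements every eighth one is kept. -/
theorem count_groups {p : ℝ → Prop} (hp : ∀ a b, a ≤ b → p a → p b) {g : ℕ} (q : ℕ)
    (hw : ∀ u < q, ∀ x < 8 * g, 8 ∣ rank (fun y => v (u * (8 * g) + y)) (8 * g) x →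
      w (u * g + rank (fun y => v (u * (8 * g) + y)) (8 * g) x / 8) = v (u * (8 * g) + x)) :
    count p v (q * (8 * g)) ≤ 8 * count p w (q * g) ∧
      8 * count p w (q * g) ≤ count p v (q * (8 * g)) + 7 * q := by
  induction q with
  | zero => simp [count]
  | succ q ih =>
    have h1 := ih fun u hu => hw u (by omega)
    have h2 := count_every_eighth hp (v := fun x => v (q * (8 * g) + x))
      (w := fun x => w (q * g + x)) (g := g) (hw q (by omega))
    rw [add_mul, add_mul, one_mul, one_mul, count_add, count_add]
    omega

end Selection

/-! ### Lists of matrix entries -/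

/-- The triples `(R l, C l, X l)`, `l < m`, list the entries of `Y` at the positions in `T`, each
position once. -/
structure Listing (T : Finset (ℕ × ℕ)) (Y : ℕ → ℕ → ℝ) (m : ℕ) (R C : ℕ → ℕ) (X : ℕ → ℝ) :
    Prop where
  card_eq : #T = m
  image_eq : (range m).image (fun l => (R l, C l)) = T
  val_eq : ∀ l < m, X l = Y (R l) (C l)

namespace Listing

variable {T : Finset (ℕ × ℕ)} {Y : ℕ → ℕ → ℝ} {m : ℕ} {R C : ℕ → ℕ} {X : ℕ → ℝ}

theorem mem (h : Listing T Y m R C X) {l : ℕ} (hl : l < m) : (R l, C l) ∈ T := by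
  rw [← h.image_eq]
  exact mem_image_of_mem _ (mem_range.2 hl)

theorem exists_of_mem (h : Listing T Y m R C X) {i j : ℕ} (hij : (i, j) ∈ T) :
    ∃ l < m, R l = i ∧ C l = j := by
  rw [← h.image_eq, mem_image] at hij
  obtain ⟨l, hl, h'⟩ := hij
  exact ⟨l, mem_range.1 hl, by simpa using h'⟩

theorem inj (h : Listing T Y m R C X) {l l' : ℕ} (hl : l < m) (hl' : l' < m) (hR : R l = R l')
    (hC : C l = C l') : l = l' := by
  have hinj : Set.InjOn (fun l => (R l, C l)) (range m) := by
    rw [← card_image_iff, h.image_eq, h.card_eq, card_range]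
  exact hinj (by simpa using hl) (by simpa using hl') (by simp [hR, hC])

theorem empty (Y : ℕ → ℕ → ℝ) (R C : ℕ → ℕ) (X : ℕ → ℝ) : Listing ∅ Y 0 R C X :=
  ⟨rfl, rfl, by simp⟩

theorem append (h : Listing T Y m R C X) {i j : ℕ} (hij : (i, j) ∉ T) {R' C' : ℕ → ℕ}
    {X' : ℕ → ℝ} (hR : ∀ l, R' l = if l = m then i else R l)
    (hC : ∀ l, C' l = if l = m then j else C l) (hX : ∀ l, X' l = if l = m then Y i j else X l) :
    Listing (insert (i, j) T) Y (m + 1) R' C' X' where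
  card_eq := by rw [card_insert_of_notMem hij, h.card_eq]
  image_eq := by
    rw [range_add_one, image_insert, ← h.image_eq]
    congr 1
    · simp [hR, hC]
    · refine image_congr fun l hl => ?_
      have : l ≠ m := by have := mem_range.1 (mem_coe.1 hl); omega
      simp [hR, hC, this]
  val_eq l hl := by
    by_cases hlm : l = m
    · simp [hR, hC, hX, hlm]
    · simp [hR, hC, hX, hlm, h.val_eq l (by omega)]

open Classical in
/-- The list determines the matrix. -/
theorem sum_eq (h : Listing T Y m R C X) (i j : ℕ) (h0 : (i, j) ∉ T → Y i j = 0) :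
    Y i j = ∑ l ∈ range m, if R l = i ∧ C l = j then X l else 0 := by
  by_cases hij : (i, j) ∈ T
  · obtain ⟨l, hl, rfl, rfl⟩ := h.exists_of_mem hij
    rw [sum_eq_single_of_mem l (mem_range.2 hl)]
    · simp [h.val_eq l hl]
    · intro l' hl' hne
      exact if_neg fun h' => hne (h.inj (mem_range.1 hl') hl h'.1 h'.2)
  · rw [h0 hij, sum_eq_zero]
    intro l hl
    refine if_neg fun h' => hij ?_
    rw [← h'.1, ← h'.2]
    exact h.mem (mem_range.1 hl)

end Listing

/-! ### Selection in linear time -/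

namespace RealRAM

open Selection

/-- Counts in `nv 12` the elements of the group of `nv 13` elements of `ra 6` that starts at
position `nv 15` which precede, in decreasing order, the one at position `nv 16` of the group. -/
def rankProg : Stmt :=
  .seq (.setN 12 (.lit 0)) <| .forUp 11 (.var 13) <|
    .ite (.not (.and
        (.not (.rlt (.get 6 (.add (.var 15) (.var 16))) (.get 6 (.add (.var 15) (.var 11)))))
        (.not (.and
          (.not (.rlt (.get 6 (.add (.var 15) (.var 11))) (.get 6 (.add (.var 15) (.var 16)))))
          (.nlt (.var 11) (.var 16))))))
      (.setN 12 (.add (.var 12) (.lit 1))) .skip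

theorem rankProg_spec {S W : ℕ} (s : State) {b x G : ℕ} (hb : s.nv 15 = b) (hx : s.nv 16 = x)
    (hG : s.nv 13 = G) (hxG : x < G) (hS : b + G ≤ S) (hW : b + G < W) :
    Run S W rankProg s (4 * G + 3) fun s' =>
      s'.nv 12 = rank (fun y => s.ra 6 (b + y)) G x := by
  refine Run.setN_seq (by simp) (Run.weaken (Run.forUp G 2 (fun y s' => s'.nv 12 =
    rank (fun y => s.ra 6 (b + y)) y x) (by omega) ?_ ?_ ?_) (by omega) fun _ _ h => h)
  · intro s' F
    simp [F.nv 13 (by decide), hG]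
  · simp [rank]
  · intro y s' hy F hi hI
    have e13 : s'.nv 13 = G := by simp [F.nv 13 (by decide), hG]
    have e15 : s'.nv 15 = b := by simp [F.nv 15 (by decide), hb]
    have e16 : s'.nv 16 = x := by simp [F.nv 16 (by decide), hx]
    have e6 : s'.ra 6 = s.ra 6 := by simp [F.ra 6 (by decide)]
    have hle : s'.nv 12 ≤ y := hI ▸ rank_le ..
    have htest : ¬ (¬ s.ra 6 (b + x) < s.ra 6 (b + y) ∧
        ¬ (¬ s.ra 6 (b + y) < s.ra 6 (b + x) ∧ y < x)) ↔
        (s.ra 6 (b + x) < s.ra 6 (b + y) ∨ s.ra 6 (b + x) = s.ra 6 (b + y) ∧ y < x) := by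
      constructor
      · intro h
        by_cases h1 : s.ra 6 (b + x) < s.ra 6 (b + y)
        · exact Or.inl h1
        · have h2 : ¬ s.ra 6 (b + y) < s.ra 6 (b + x) ∧ y < x := by tauto
          exact Or.inr ⟨le_antisymm (not_lt.1 h2.1) (not_lt.1 h1), h2.2⟩
      · rintro (h | ⟨h, h'⟩)
        · tauto
        · exact fun h2 => h2.2 ⟨h.le.not_gt, h'⟩
    refine Run.ite ?_ (fun hv => Run.setN ?_ ?_) (fun hv => Run.skip ?_)
    · simp [e15, e16, hi]; omega
    · simp; omega
    · simp only [BExp.val, RExp.val, NExp.val, e15, e16, e6, hi, htest] at hv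
      simp [hi, rank_succ, hI, hv]
    · simp only [BExp.val, RExp.val, NExp.val, e15, e16, e6, hi, htest] at hv
      simp [hi, rank_succ, hI, hv]

/-- Copies every eighth element, in decreasing order, of the group of `nv 13` elements of `ra 6`
that starts at position `nv 15` to `ra 7`. -/
def keepProg : Stmt :=
  .forUp 16 (.var 13) <| .seq rankProg <|
    .ite (.neq (.var 12) (.mul (.lit 8) (.div (.var 12) (.lit 8))))
      (.putR 7 (.div (.add (.var 15) (.var 12)) (.lit 8)) (.get 6 (.add (.var 15) (.var 16))))
      .skip

theorem keepProg_spec {S W : ℕ} (s : State) {u g : ℕ} (hb : s.nv 15 = u * (8 * g))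
    (hG : s.nv 13 = 8 * g) (hS : u * (8 * g) + 8 * g ≤ S) (hW : u * (8 * g) + 8 * g < W) :
    Run S W keepProg s (8 * g * (4 * (8 * g) + 7) + 2) fun s' =>
      (∀ x < 8 * g, 8 ∣ rank (fun y => s.ra 6 (u * (8 * g) + y)) (8 * g) x →
        s'.ra 7 (u * g + rank (fun y => s.ra 6 (u * (8 * g) + y)) (8 * g) x / 8) =
          s.ra 6 (u * (8 * g) + x)) ∧
      ∀ l < u * g, s'.ra 7 l = s.ra 7 l := by
  have hug : u * (8 * g) = 8 * (u * g) := by ring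
  set v : ℕ → ℝ := fun y => s.ra 6 (u * (8 * g) + y) with hv
  refine Run.forUp (8 * g) (4 * (8 * g) + 5) (fun x s' =>
    (∀ z < x, 8 ∣ rank v (8 * g) z → s'.ra 7 (u * g + rank v (8 * g) z / 8) = v z) ∧
      ∀ l < u * g, s'.ra 7 l = s.ra 7 l) (by omega) ?_ ?_ ?_
  · intro s' F
    simp [F.nv 13 (by decide), hG]
  · simp
  · intro x s' hx F hi hI
    have e13 : s'.nv 13 = 8 * g := by simp [F.nv 13 (by decide), hG]
    have e15 : s'.nv 15 = u * (8 * g) := by simp [F.nv 15 (by decide), hb]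
    have e6 : s'.ra 6 = s.ra 6 := by simp [F.ra 6 (by decide)]
    refine Run.weaken (T := 4 * (8 * g) + 3 + 2)
      (Run.seq ((rankProg_spec s' e15 hi e13 hx hS hW).weaken le_rfl
        (Q' := fun s'' => Run S W _ s'' 2 _) fun s'' F' hr => ?_)) (by omega) fun _ _ h => h
    have f13 : s''.nv 13 = 8 * g := by simp [F'.nv 13 (by decide), e13]
    have f15 : s''.nv 15 = 8 * (u * g) := by simp [F'.nv 15 (by decide), e15, hug]
    have f16 : s''.nv 16 = x := by simp [F'.nv 16 (by decide), hi]
    have f6 : s''.ra 6 = s.ra 6 := by simp [F'.ra 6 (by decide), e6]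
    have f7 : s''.ra 7 = s'.ra 7 := by simp [F'.ra 7 (by decide)]
    rw [e6] at hr
    change s''.nv 12 = rank v (8 * g) x at hr
    have hrk : rank v (8 * g) x < 8 * g := rank_lt hx
    have hidx : (8 * (u * g) + rank v (8 * g) x) / 8 = u * g + rank v (8 * g) x / 8 := by omega
    refine Run.ite ?_ (fun ht => Run.putR ?_ ?_ ?_ ⟨?_, ?_, ?_⟩) (fun ht => Run.skip ⟨?_, ?_, ?_⟩)
    · simp [hr]; omega
    · simp [hr, f15]; omega
    · simp only [NExp.val, hr, f15]; omega
    · simp [f15, f16]; omega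
    · simp [f16]
    · intro z hz hdvd
      simp only [State.setN_ra, State.putR_ra, NExp.val, RExp.val, hr, f15, f16, f6, hidx, true_and,
        f7]
      rcases Nat.lt_succ_iff_lt_or_eq.1 hz with h | rfl
      · rw [if_neg, hI.1 z h hdvd]
        intro heq
        -- two different positions have different ranks, so no cell is written twice
        have hne : rank v (8 * g) z ≠ rank v (8 * g) x := fun h' =>
          h.ne (rank_injOn (by simp; omega) (by simpa using hx) h')
        simp only [BExp.val, NExp.val, hr] at ht
        omega
      · rw [if_pos rfl, ← hug]
    · intro l hl
      simp only [State.setN_ra, State.putR_ra, NExp.val, hr, f15, hidx, true_and, f7]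
      rw [if_neg (by omega), hI.2 l hl]
    · simp [f16]
    · intro z hz hdvd
      simp only [State.setN_ra, f7]
      rcases Nat.lt_succ_iff_lt_or_eq.1 hz with h | rfl
      · exact hI.1 z h hdvd
      · exact absurd (by simp only [BExp.val, NExp.val, hr]; omega) ht
    · intro l hl
      simp only [State.setN_ra, f7]
      exact hI.2 l hl

/-- One round of the selection: thins out the `nv 14` elements of `ra 6` and doubles the size
`nv 13` of the groups. -/
def roundProg : Stmt :=
  .seq (.forUp 10 (.div (.var 14) (.var 13)) <|
    .seq (.setN 15 (.mul (.var 10) (.var 13))) keepProg) <|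
  .seq (.setN 14 (.div (.var 14) (.lit 8))) <|
  .seq (.forUp 10 (.var 14) <| .putR 6 (.var 10) (.get 7 (.var 10))) <|
  .setN 13 (.mul (.lit 2) (.var 13))

/-- Computing all ranks in a group takes time quadratic in its size, so the time of a round is the
number of elements times the group size. From one round to the next the first factor shrinks to an
eighth and the second one doubles, which makes the total time of the rounds linear. -/
theorem roundProg_spec {S W : ℕ} (s : State) {q g : ℕ} (hg : 8 ≤ g) (hq : 1 ≤ q)
    (hG : s.nv 13 = 8 * g) (hm : s.nv 14 = q * (8 * g)) (hS : q * (8 * g) ≤ S)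
    (hW : q * (8 * g) + 16 * g < W) :
    Run S W roundProg s (5 * (q * (8 * g) ^ 2)) fun s' =>
      s'.nv 13 = 16 * g ∧ s'.nv 14 = q * g ∧
      ∀ p : ℝ → Prop, (∀ a b, a ≤ b → p a → p b) →
        count p (s.ra 6) (q * (8 * g)) ≤ 8 * count p (s'.ra 6) (q * g) ∧
        8 * count p (s'.ra 6) (q * g) ≤ count p (s.ra 6) (q * (8 * g)) + 7 * q := by
  have hqg : q * (8 * g) = 8 * (q * g) := by ring
  have hdiv : q * (8 * g) / (8 * g) = q := Nat.mul_div_cancel _ (by omega)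
  have hqle : q ≤ q * (8 * g) := Nat.le_mul_of_pos_right _ (by omega)
  refine Run.weaken (T := (q * (8 * g * (4 * (8 * g) + 7) + 3 + 2) + 2) +
    (((q * g * (1 + 2) + 2) + 1) + 1)) (Run.seq ((Run.forUp q (8 * g * (4 * (8 * g) + 7) + 3)
      (fun u s' => ∀ u' < u, ∀ x < 8 * g,
        8 ∣ rank (fun y => s.ra 6 (u' * (8 * g) + y)) (8 * g) x →
        s'.ra 7 (u' * g + rank (fun y => s.ra 6 (u' * (8 * g) + y)) (8 * g) x / 8) =
          s.ra 6 (u' * (8 * g) + x)) (by omega) ?_ ?_ ?_).weaken le_rfl fun s' F h => ?_)) ?_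
      fun _ _ h => h
  · intro s' F
    simp [F.nv 13 (by decide), F.nv 14 (by decide), hG, hm, hdiv]
    omega
  · simp
  · intro u s' hu F hi hI
    have e13 : s'.nv 13 = 8 * g := by simp [F.nv 13 (by decide), hG]
    have e6 : s'.ra 6 = s.ra 6 := by simp [F.ra 6 (by decide)]
    have hug : u * (8 * g) + 8 * g ≤ q * (8 * g) := by
      calc u * (8 * g) + 8 * g = (u + 1) * (8 * g) := by ring
        _ ≤ _ := Nat.mul_le_mul_right _ hu
    refine Run.setN_seq ?_ (Run.weaken (keepProg_spec (u := u) (g := g) _ ?_ ?_ ?_ ?_)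
      le_rfl ?_)
    · simp [hi, e13]; omega
    · simp [hi, e13]
    · simp [e13]
    · omega
    · omega
    · intro s'' F' h
      refine ⟨by simp [F'.nv 10 (by decide), hi], fun u' hu' x hx hdvd => ?_⟩
      simp only [State.setN_ra, e6] at h ⊢
      rcases Nat.lt_succ_iff_lt_or_eq.1 hu' with h' | rfl
      · rw [h.2, hI u' h' x hx hdvd]
        have h1 : rank (fun y => s.ra 6 (u' * (8 * g) + y)) (8 * g) x < 8 * g := rank_lt hx
        have h2 : u' * g + g ≤ u * g := by
          calc u' * g + g = (u' + 1) * g := by ring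
            _ ≤ _ := Nat.mul_le_mul_right _ h'
        omega
      · exact h.1 x hx hdvd
  · have e13 : s'.nv 13 = 8 * g := by simp [F.nv 13 (by decide), hG]
    have e14 : s'.nv 14 = q * (8 * g) := by simp [F.nv 14 (by decide), hm]
    have hqg8 : q * (8 * g) / 8 = q * g := by omega
    refine Run.setN_seq ?_ (Run.seq (T := q * g * (1 + 2) + 2) (T' := 1)
      (Run.weaken (Run.forUp (q * g) 1
      (fun x s'' => ∀ z < x, s''.ra 6 z = s'.ra 7 z) (by omega) ?_ ?_ ?_) le_rfl ?_))
    · simp; omega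
    · intro s'' F'
      simp [F'.nv 14 (by decide), e14, hqg8]
    · simp
    · intro x s'' hx F' hi hI
      refine Run.putR ?_ ?_ ?_ ⟨?_, ?_⟩
      · simp
      · simp [hi]; omega
      · simp [hi]; omega
      · simp [hi]
      · intro z hz
        have e7 : s''.ra 7 = s'.ra 7 := by simp [F'.ra 7 (by decide)]
        simp only [State.setN_ra, State.putR_ra, NExp.val, RExp.val, hi, true_and, e7]
        rcases Nat.lt_succ_iff_lt_or_eq.1 hz with h' | rfl
        · rw [if_neg (by omega), hI z h']
        · simp
    · intro s'' F' h'
      have f13 : s''.nv 13 = 8 * g := by simp [F'.nv 13 (by decide), e13]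
      refine Run.setN ?_ ⟨?_, ?_, fun p hp => ?_⟩
      · simp [f13]; omega
      · simp [f13]; omega
      · simp [F'.nv 14 (by decide), e14, hqg8]
      · refine count_groups hp q fun u hu x hx hdvd => ?_
        rw [State.setN_ra, h', h u hu x hx hdvd]
        have h1 : rank (fun y => s.ra 6 (u * (8 * g) + y)) (8 * g) x < 8 * g := rank_lt hx
        have h2 : u * g + g ≤ q * g := by
          calc u * g + g = (u + 1) * g := by ring
            _ ≤ _ := Nat.mul_le_mul_right _ hu
        omega
  · nlinarith [Nat.mul_le_mul hq hg, Nat.mul_le_mul (Nat.mul_le_mul hq hg) hg,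
      Nat.mul_le_mul_left q hg, Nat.mul_le_mul_left (q * g) hg]

/-- Stores in `rv 2` a threshold for the first `nv 6` elements of `ra 1`, of which there are at most
`nv 3`: an element of middle rank among those that are left after all rounds. -/
def selectProg : Stmt :=
  .seq (.forUp 10 (.var 3) <| .ite (.nlt (.var 10) (.var 6))
    (.putR 6 (.var 10) (.get 1 (.var 10))) (.putR 6 (.var 10) (.lit 0))) <|
  .seq (.setN 13 (.lit 64)) <|
  .seq (.setN 14 (.var 3)) <|
  .seq (.loop (.nlt (.var 13) (.var 14)) roundProg) <|
  .seq (.setN 15 (.lit 0)) <|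
  .forUp 16 (.var 13) <| .seq rankProg <|
    .ite (.neq (.var 12) (.div (.var 13) (.lit 2))) (.setR 2 (.get 6 (.var 16))) .skip

/-- The rounds keep the number of elements with an upward closed property, up to the factor `8 ^ h`
and an additive error that is a geometric sum: a round with `q` groups contributes `7 * q`. -/
theorem roundLoop_spec {S W : ℕ} (s : State) {h : ℕ} (hG : s.nv 13 = 64)
    (hm : s.nv 14 = 64 * 16 ^ h) (hS : 64 * 16 ^ h ≤ S) (hW : 3 * (64 * 16 ^ h) < W) :
    Run S W (.loop (.nlt (.var 13) (.var 14)) roundProg) s (8 * (4096 * 16 ^ h)) fun s' =>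
      s'.nv 13 = 64 * 2 ^ h ∧
      ∀ p : ℝ → Prop, (∀ a b, a ≤ b → p a → p b) →
        count p (s.ra 6) (64 * 16 ^ h) ≤ 8 ^ h * count p (s'.ra 6) (64 * 2 ^ h) ∧
        8 ^ h * count p (s'.ra 6) (64 * 2 ^ h) + 14 * 8 ^ h ≤
          count p (s.ra 6) (64 * 16 ^ h) + 14 * 16 ^ h := by
  refine Run.loop (fun s' f => ∃ j i, j + i = h ∧ f = 8 * (16 ^ i * (64 * 2 ^ j) ^ 2) ∧
    s'.nv 13 = 64 * 2 ^ j ∧ s'.nv 14 = 16 ^ i * (64 * 2 ^ j) ∧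
    ∀ p : ℝ → Prop, (∀ a b, a ≤ b → p a → p b) →
      count p (s.ra 6) (64 * 16 ^ h) ≤ 8 ^ j * count p (s'.ra 6) (16 ^ i * (64 * 2 ^ j)) ∧
      8 ^ j * count p (s'.ra 6) (16 ^ i * (64 * 2 ^ j)) + 14 * 16 ^ i * 8 ^ j ≤
        count p (s.ra 6) (64 * 16 ^ h) + 14 * 16 ^ h)
    ⟨0, h, by simp, by ring, by simp [hG], by rw [hm]; ring, fun p hp => ?_⟩ ?_
  · have h1 : 16 ^ h * (64 * 2 ^ 0) = 64 * 16 ^ h := by ring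
    rw [h1, pow_zero]; omega
  · rintro s' f F ⟨j, i, rfl, rfl, e13, e14, hI⟩
    refine ⟨by simp, fun hv => ?_, fun hv => ?_⟩
    · have hi : i = 0 := by
        by_contra hi
        have h1 : 2 ≤ 16 ^ i := by
          calc 2 ≤ 16 := by norm_num
            _ ≤ 16 ^ i := Nat.le_self_pow hi 16
        have h2 : 0 < 2 ^ j := by positivity
        simp only [BExp.val, NExp.val, e13, e14, not_lt] at hv
        nlinarith
      subst hi
      exact ⟨Nat.one_le_iff_ne_zero.2 (by positivity), by simpa [add_zero] using e13,
        by simpa [add_zero] using hI⟩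
    · obtain ⟨i, rfl⟩ : ∃ i', i = i' + 1 := by
        refine Nat.exists_eq_add_one.2 (Nat.pos_of_ne_zero fun hi => ?_)
        subst hi
        simp [e13, e14] at hv
      have hg : 64 * 2 ^ j = 8 * (8 * 2 ^ j) := by ring
      have hj : 1 ≤ 2 ^ j := Nat.one_le_two_pow
      have hi : 1 ≤ 16 ^ i := Nat.one_le_pow _ _ (by norm_num)
      have hN : 16 ^ (i + 1) * (8 * (8 * 2 ^ j)) ≤ 64 * 16 ^ (j + (i + 1)) := by
        have : 2 ^ j ≤ 16 ^ j := Nat.pow_le_pow_left (by norm_num) j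
        calc 16 ^ (i + 1) * (8 * (8 * 2 ^ j)) = 64 * 2 ^ j * 16 ^ (i + 1) := by ring
          _ ≤ 64 * 16 ^ j * 16 ^ (i + 1) := by gcongr
          _ = _ := by ring
      have hg2 : 16 * (8 * 2 ^ j) ≤ 16 ^ (i + 1) * (8 * (8 * 2 ^ j)) := by
        rw [pow_succ]; nlinarith [Nat.mul_le_mul hi hj]
      refine ⟨_, 8 * (16 ^ i * (64 * 2 ^ (j + 1)) ^ 2), ?_, (roundProg_spec s' (q := 16 ^ (i + 1))
        (g := 8 * 2 ^ j) (by omega) (Nat.one_le_pow _ _ (by norm_num)) (by rw [e13, hg])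
        (by rw [e14, hg]) (by omega) (by omega)).weaken le_rfl fun s'' F' hr =>
          ⟨j + 1, i, by ring, rfl, ?_, ?_, fun p hp => ?_⟩⟩
      · rw [← hg]
        have hx : 1 ≤ 16 ^ i * (2 ^ j) ^ 2 := Nat.one_le_iff_ne_zero.2 (by positivity)
        calc 5 * (16 ^ (i + 1) * (64 * 2 ^ j) ^ 2) + 8 * (16 ^ i * (64 * 2 ^ (j + 1)) ^ 2) + 1
            = 458752 * (16 ^ i * (2 ^ j) ^ 2) + 1 := by ring
          _ ≤ 524288 * (16 ^ i * (2 ^ j) ^ 2) := by omega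
          _ = _ := by ring
      · rw [hr.1]; ring
      · rw [hr.2.1]; ring
      · have h1 := hI p hp
        have h2 := hr.2.2 p hp
        rw [← hg] at h2
        have hsz : 16 ^ (i + 1) * (8 * 2 ^ j) = 16 ^ i * (64 * 2 ^ (j + 1)) := by ring
        rw [hsz] at h2
        constructor
        · calc _ ≤ _ := h1.1
            _ ≤ 8 ^ j * (8 * count p (s''.ra 6) (16 ^ i * (64 * 2 ^ (j + 1)))) :=
              Nat.mul_le_mul_left _ h2.1
            _ = _ := by ring
        · refine le_trans ?_ h1.2
          calc 8 ^ (j + 1) * count p (s''.ra 6) (16 ^ i * (64 * 2 ^ (j + 1))) +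
                14 * 16 ^ i * 8 ^ (j + 1)
              = 8 ^ j * (8 * count p (s''.ra 6) (16 ^ i * (64 * 2 ^ (j + 1)))) +
                112 * 16 ^ i * 8 ^ j := by ring
            _ ≤ 8 ^ j * (count p (s'.ra 6) (16 ^ (i + 1) * (64 * 2 ^ j)) + 7 * 16 ^ (i + 1)) +
                112 * 16 ^ i * 8 ^ j := by gcongr; exact h2.2
            _ = _ := by ring

/-- The threshold `θ` found by the selection is exceeded by at most half of the capacity `N`, and
unless it is `0`, at least a quarter of the capacity is filled with elements not below it. -/
theorem selectProg_spec {S W : ℕ} (s : State) {h m : ℕ} (hN : s.nv 3 = 64 * 16 ^ h)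
    (hm : s.nv 6 = m) (hmN : m ≤ 64 * 16 ^ h) (hS : 64 * 16 ^ h ≤ S) (hW : 3 * (64 * 16 ^ h) < W)
    (hX : ∀ l < m, 0 ≤ s.ra 1 l) :
    Run S W selectProg s (1000 * (64 * 16 ^ h)) fun s' =>
      0 ≤ s'.rv 2 ∧ count (fun x => s'.rv 2 < x) (s.ra 1) m ≤ 32 * 16 ^ h ∧
      (s'.rv 2 = 0 ∨ 16 * 16 ^ h ≤ count (fun x => s'.rv 2 ≤ x) (s.ra 1) m) := by
  have hpos : 1 ≤ 16 ^ h := Nat.one_le_pow _ _ (by norm_num)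
  have h2pos : 1 ≤ 2 ^ h := Nat.one_le_two_pow
  have h2le : 64 * 2 ^ h ≤ 64 * 16 ^ h :=
    Nat.mul_le_mul_left _ (Nat.pow_le_pow_left (by norm_num) h)
  refine Run.weaken (T := (64 * 16 ^ h * (2 + 2) + 2) + (((8 * (4096 * 16 ^ h) +
    ((64 * 2 ^ h * (4 * (64 * 2 ^ h) + 3 + 2 + 2) + 2) + 1)) + 1) + 1))
    (Run.seq ((Run.forUp (64 * 16 ^ h) 2
      (fun x s' => ∀ y < x, s'.ra 6 y = if y < m then s.ra 1 y else 0)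
      (by omega) ?_ ?_ ?_).weaken le_rfl fun s₁ F₁ h₁ => Run.setN_seq ?_ (Run.setN_seq ?_
        (Run.seq ((roundLoop_spec _ (h := h) ?_ ?_ hS hW).weaken le_rfl fun s₂ F₂ h₂ =>
          Run.setN_seq ?_ (Run.weaken (Run.forUp (64 * 2 ^ h) (4 * (64 * 2 ^ h) + 3 + 2)
            (fun x s' => ∀ z < x, rank (s₂.ra 6) (64 * 2 ^ h) z = 32 * 2 ^ h →
              s'.rv 2 = s₂.ra 6 z) ?_ ?_ ?_ ?_) le_rfl fun s₃ F₃ h₃ => ?_))))))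
    ?_ fun _ _ h => h
  · intro s' F
    simp [F.nv 3 (by decide), hN]
  · simp
  · intro x s' hx F hi hI
    have e6 : s'.nv 6 = m := by simp [F.nv 6 (by decide), hm]
    have e1 : s'.ra 1 = s.ra 1 := by simp [F.ra 1 (by decide)]
    refine Run.ite (by simp) (fun hv => Run.putR ?_ ?_ ?_ ⟨?_, ?_⟩)
      (fun hv => Run.putR ?_ ?_ ?_ ⟨?_, ?_⟩)
    any_goals simp [hi]
    · omega
    · omega
    · intro y hy
      split_ifs with h1 h2 h2
      · rw [h1, e1]
      · simp [hi, e6, h1] at hv h2; omega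
      · rw [hI y (by omega), if_pos h2]
      · rw [hI y (by omega), if_neg h2]
    · omega
    · intro y hy
      split_ifs with h1 h2 h2
      · simp [hi, e6] at hv; omega
      · rfl
      · rw [hI y (by omega), if_pos h2]
      · rw [hI y (by omega), if_neg h2]
  · simp; omega
  · simp
  · simp
  · simp [F₁.nv 3 (by decide), hN]
  · simp
  · omega
  · intro s' F
    simp [F.nv 13 (by decide), h₂.1]
  · simp
  · intro x s' hx F hi hI
    have e13 : s'.nv 13 = 64 * 2 ^ h := by simp [F.nv 13 (by decide), h₂.1]
    have e15 : s'.nv 15 = 0 := by simp [F.nv 15 (by decide)]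
    have e6 : s'.ra 6 = s₂.ra 6 := by simp [F.ra 6 (by decide)]
    refine Run.seq ((rankProg_spec s' e15 hi e13 hx (by omega) (by omega)).weaken le_rfl
      fun s'' F' hr => ?_)
    have f13 : s''.nv 13 = 64 * 2 ^ h := by simp [F'.nv 13 (by decide), e13]
    have f16 : s''.nv 16 = x := by simp [F'.nv 16 (by decide), hi]
    have f6 : s''.ra 6 = s₂.ra 6 := by simp [F'.ra 6 (by decide), e6]
    have f2 : s''.rv 2 = s'.rv 2 := by simp [F'.rv 2 (by decide)]
    simp only [zero_add, e6] at hr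
    change s''.nv 12 = rank (s₂.ra 6) (64 * 2 ^ h) x at hr
    refine Run.ite ?_ (fun hv => Run.setR ?_ ⟨?_, ?_⟩) (fun hv => Run.skip ⟨?_, ?_⟩)
    · simp; omega
    · simp [f16]; omega
    · simp [f16]
    · intro z hz hrz
      simp only [BExp.val, NExp.val, hr, f13] at hv
      have : z = x := rank_injOn (v := s₂.ra 6) (m := 64 * 2 ^ h) (by simp; omega)
        (by simpa using hx)
        (by show rank _ _ _ = rank _ _ _; omega)
      simp [f16, f6, this]
    · simp [f16]
    · intro z hz hrz
      simp only [BExp.val, NExp.val, hr, f13] at hv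
      simp only [State.setN_rv, f2]
      rcases Nat.lt_succ_iff_lt_or_eq.1 hz with h' | rfl
      · exact hI z h' hrz
      · omega
  · obtain ⟨z, hz, hrz⟩ := exists_rank_eq (v := s₂.ra 6) (m := 64 * 2 ^ h) (r := 32 * 2 ^ h)
      (by omega)
    have hθ := h₃ z hz hrz
    simp only [State.setN_ra] at h₂
    have hgt := (h₂.2 (fun x => s₃.rv 2 < x) fun a b hab ha => lt_of_lt_of_le ha hab).1
    have hge := (h₂.2 (fun x => s₃.rv 2 ≤ x) fun a b hab ha => le_trans ha hab).2
    have kgt : count (fun x => s₃.rv 2 < x) (s₂.ra 6) (64 * 2 ^ h) ≤ 32 * 2 ^ h := by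
      by_contra hlt
      have := (rank_lt_count_iff (v := s₂.ra 6) (p := fun x => s₃.rv 2 < x)
        (fun a b hab ha => lt_of_lt_of_le ha hab) hz).1 (by omega)
      rw [hθ] at this
      exact lt_irrefl _ this
    have kge : 32 * 2 ^ h + 1 ≤ count (fun x => s₃.rv 2 ≤ x) (s₂.ra 6) (64 * 2 ^ h) := by
      have := (rank_lt_count_iff (v := s₂.ra 6) (p := fun x => s₃.rv 2 ≤ x)
        (fun a b hab ha => le_trans ha hab) hz).2 (by rw [hθ])
      omega
    have e16 : 8 ^ h * 2 ^ h = 16 ^ h := by rw [← mul_pow]; norm_num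
    have cgt : count (fun x => s₃.rv 2 < x) (s₁.ra 6) (64 * 16 ^ h) ≤ 32 * 16 ^ h := by
      refine hgt.trans ((Nat.mul_le_mul_left _ kgt).trans ?_)
      rw [← e16]; apply le_of_eq; ring
    have cge : 18 * 16 ^ h ≤ count (fun x => s₃.rv 2 ≤ x) (s₁.ra 6) (64 * 16 ^ h) := by
      have h1 := Nat.mul_le_mul_left (8 ^ h) kge
      have h2 : 8 ^ h * (32 * 2 ^ h + 1) = 32 * 16 ^ h + 8 ^ h := by rw [← e16]; ring
      omega
    -- the sequence is padded with zeros
    have pad : ∀ p : ℝ → Prop, count p (s₁.ra 6) (64 * 16 ^ h) =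
        count p (s.ra 1) m + count p (fun _ => 0) (64 * 16 ^ h - m) := by
      intro p
      obtain ⟨d, hd⟩ := Nat.exists_eq_add_of_le hmN
      rw [hd] at h₁ ⊢
      rw [count_add, Nat.add_sub_cancel_left]
      congr 1
      · exact count_congr p fun x hx => by rw [h₁ x (by omega), if_pos hx]
      · exact count_congr p fun x hx => by rw [h₁ (m + x) (by omega), if_neg (by omega)]
    have h0 : 0 ≤ s₃.rv 2 := by
      by_contra hneg
      have : count (fun x => s₃.rv 2 < x) (s₁.ra 6) (64 * 16 ^ h) = 64 * 16 ^ h := by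
        refine count_eq_self fun x hx => lt_of_lt_of_le (not_le.1 hneg) ?_
        rw [h₁ x hx]
        split_ifs with hxm
        · exact hX x hxm
        · exact le_rfl
      omega
    refine ⟨h0, ?_, ?_⟩
    · have := pad fun x => s₃.rv 2 < x
      omega
    · rcases h0.eq_or_lt with h0 | h0
      · exact Or.inl h0.symm
      · right
        have h1 := pad fun x => s₃.rv 2 ≤ x
        have h2 : count (fun x => s₃.rv 2 ≤ x) (fun _ => 0) (64 * 16 ^ h - m) = 0 :=
          sum_eq_zero fun x _ => if_neg (not_le.2 h0)
        omega
  · have h1 : 2 ^ h * 2 ^ h ≤ 16 ^ h := by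
      rw [← mul_pow]; exact Nat.pow_le_pow_left (by norm_num) h
    nlinarith

end RealRAM

/-! ### The threshold for an outer product -/

namespace RealRAM

open OuterProduct

/-- Stores in `nv 24` the weight of the samples that are at least `rv 4`, where the two sorted
sequences are in `ra 4` and `ra 5`. -/
def weightProg : Stmt :=
  .seq (.setN 24 (.lit 0)) <| .forPow 22 (.var 0) <| .forPow 23 (.var 0) <|
    .ite (.not (.rlt (.mul (.get 4 (.sub (.var 22) (.lit 1))) (.get 5 (.sub (.var 23) (.lit 1))))
        (.var 4)))
      (.setN 24 (.add (.var 24) (.mul (.var 22) (.var 23)))) .skip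

theorem weightProg_spec {S W : ℕ} (s : State) {n : ℕ} (hn : s.nv 0 = n) (hS : n ≤ S)
    (hW : (2 * n) ^ 2 + 2 * n + 1 < W) :
    Run S W weightProg s (n.size * (n.size * 4 + 4) + 3) fun s' =>
      s'.nv 24 = sampleWeight n (s.ra 4) (s.ra 5) (s.rv 4) := by
  classical
  set θ := s.rv 4
  set w : ℕ → ℕ → ℕ := fun a b =>
    if θ ≤ s.ra 4 (2 ^ a - 1) * s.ra 5 (2 ^ b - 1) then 2 ^ (a + b) else 0 with hw
  refine Run.setN_seq (by simp) (Run.weaken (Run.forPow n (n.size * 4 + 2)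
    (fun a s' => s'.nv 24 = ∑ a' ∈ range a, ∑ b ∈ range n.size, w a' b) (by omega)
    ?_ ?_ ?_) (le_of_eq (by ring)) ?_)
  · intro s' F
    simp [F.nv 0 (by decide), hn]
  · simp
  · intro a s' ha F hi hI
    have e0 : s'.nv 0 = n := by simp [F.nv 0 (by decide), hn]
    have e4 : s'.ra 4 = s.ra 4 := by simp [F.ra 4 (by decide)]
    have e5 : s'.ra 5 = s.ra 5 := by simp [F.ra 5 (by decide)]
    have eθ : s'.rv 4 = θ := by simp [F.rv 4 (by decide), θ]
    refine Run.weaken (Run.forPow n 2 (fun b s'' => s''.nv 24 =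
      ∑ a' ∈ range a, ∑ b ∈ range n.size, w a' b + ∑ b' ∈ range b, w a b') (by omega)
      ?_ ?_ ?_) (by omega) ?_
    · intro s'' F'
      simp [F'.nv 0 (by decide), e0]
    · simp [hI]
    · intro b s'' hb F' hi' hI'
      have f4 : s''.ra 4 = s.ra 4 := by simp [F'.ra 4 (by decide), e4]
      have f5 : s''.ra 5 = s.ra 5 := by simp [F'.ra 5 (by decide), e5]
      have fθ : s''.rv 4 = θ := by simp [F'.rv 4 (by decide), eθ]
      have f22 : s''.nv 22 = 2 ^ a := by simp [F'.nv 22 (by decide), hi]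
      have k1 := two_pow_sub_one_lt ha
      have k2 := two_pow_sub_one_lt hb
      have l1 := Nat.lt_size.1 ha
      have l2 := Nat.lt_size.1 hb
      have hprod : 2 ^ a * 2 ^ b ≤ n * n := Nat.mul_le_mul l1 l2
      have hsq : (2 * n) ^ 2 = 4 * (n * n) := by ring
      have htot : s''.nv 24 + w a b ≤ (2 * n) ^ 2 := by
        refine le_trans ?_ (sampleWeight_le_sq n (s.ra 4) (s.ra 5) θ)
        have h1 : ∑ b' ∈ range (b + 1), w a b' ≤ ∑ b' ∈ range n.size, w a b' :=
          sum_le_sum_of_subset (range_subset_range.2 hb)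
        have h2 : ∑ a' ∈ range (a + 1), ∑ b ∈ range n.size, w a' b ≤
            ∑ a' ∈ range n.size, ∑ b ∈ range n.size, w a' b :=
          sum_le_sum_of_subset (range_subset_range.2 ha)
        rw [sum_range_succ] at h1 h2
        have h3 : sampleWeight n (s.ra 4) (s.ra 5) θ =
            ∑ a' ∈ range n.size, ∑ b ∈ range n.size, w a' b := rfl
        omega
      refine Run.ite ?_ (fun hv => Run.setN ?_ ?_) (fun hv => Run.skip ?_)
      · simp [hi', f22]; omega
      · have hwab : w a b = 2 ^ a * 2 ^ b := by
          rw [hw, ← pow_add]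
          simp only [BExp.val, RExp.val, NExp.val, not_lt, f22, hi', f4, f5, fθ] at hv
          exact if_pos hv
        simp [hi', f22]; omega
      · have hwab : w a b = 2 ^ a * 2 ^ b := by
          rw [hw, ← pow_add]
          simp only [BExp.val, RExp.val, NExp.val, not_lt, f22, hi', f4, f5, fθ] at hv
          exact if_pos hv
        simp [hi', f22, sum_range_succ _ b, hI', hwab]; omega
      · have hwab : w a b = 0 := by
          simp only [BExp.val, RExp.val, NExp.val, not_lt, f22, hi', f4, f5, fθ] at hv
          exact if_neg hv
        simp [hi', sum_range_succ _ b, hI', hwab]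
    · intro s'' F' h
      refine ⟨by simp [F'.nv 22 (by decide), hi], ?_⟩
      simp [h, sum_range_succ _ a]
  · intro s' _ h
    exact h

/-- Stores in `rv 1` the largest sample of weight at least `4 * nv 2`, or `0` if there is none. -/
def thresholdProg : Stmt :=
  .seq (.setR 1 (.lit 0)) <| .forPow 20 (.var 0) <| .forPow 21 (.var 0) <|
    .seq (.setR 4 (.mul (.get 4 (.sub (.var 20) (.lit 1))) (.get 5 (.sub (.var 21) (.lit 1))))) <|
    .seq weightProg <|
    .ite (.and (.not (.nlt (.var 24) (.mul (.lit 4) (.var 2)))) (.rlt (.var 1) (.var 4)))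
      (.setR 1 (.var 4)) .skip

/-- The two bounds are the hypotheses under which `OuterProduct.sampleWeight_le` and
`OuterProduct.card_lt_lt` show that about `ell` products reach the threshold. -/
theorem thresholdProg_spec {S W : ℕ} (s : State) {n ell : ℕ} (hn : s.nv 0 = n)
    (hell : s.nv 2 = ell) (hn1 : 1 ≤ n) (hS : n ≤ S) (hW : (2 * n) ^ 2 + 2 * n + 4 * ell + 4 < W) :
    Run S W thresholdProg s (1200 * n) fun s' => 0 ≤ s'.rv 1 ∧
      (s'.rv 1 = 0 ∨ 4 * ell ≤ sampleWeight n (s.ra 4) (s.ra 5) (s'.rv 1)) ∧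
      ∀ a < n.size, ∀ b < n.size, s'.rv 1 < s.ra 4 (2 ^ a - 1) * s.ra 5 (2 ^ b - 1) →
        sampleWeight n (s.ra 4) (s.ra 5) (s.ra 4 (2 ^ a - 1) * s.ra 5 (2 ^ b - 1)) < 4 * ell := by
  set Ts := n.size * (n.size * 4 + 4) + 3 with hTs
  refine Run.weaken (T := n.size * ((n.size * ((Ts + 2 + 1) + 2) + 2) + 2) + 2 + 1)
    (Run.setR_seq (by simp) (Run.forPow n (n.size * ((Ts + 2 + 1) + 2) + 2)
    (fun a s' => 0 ≤ s'.rv 1 ∧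
      (s'.rv 1 = 0 ∨ 4 * ell ≤ sampleWeight n (s.ra 4) (s.ra 5) (s'.rv 1)) ∧
      ∀ a' < a, ∀ b < n.size, s'.rv 1 < s.ra 4 (2 ^ a' - 1) * s.ra 5 (2 ^ b - 1) →
        sampleWeight n (s.ra 4) (s.ra 5) (s.ra 4 (2 ^ a' - 1) * s.ra 5 (2 ^ b - 1)) < 4 * ell)
    (by omega) ?_ ?_ ?_)) ?_ fun _ _ h => h
  · intro s' F
    simp [F.nv 0 (by decide), hn]
  · simp
  · intro a s' ha F hi hI
    have e0 : s'.nv 0 = n := by simp [F.nv 0 (by decide), hn]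
    have e2 : s'.nv 2 = ell := by simp [F.nv 2 (by decide), hell]
    have e4 : s'.ra 4 = s.ra 4 := by simp [F.ra 4 (by decide)]
    have e5 : s'.ra 5 = s.ra 5 := by simp [F.ra 5 (by decide)]
    refine Run.weaken (Run.forPow n (Ts + 2 + 1) (fun b s'' => 0 ≤ s''.rv 1 ∧
      (s''.rv 1 = 0 ∨ 4 * ell ≤ sampleWeight n (s.ra 4) (s.ra 5) (s''.rv 1)) ∧
      (∀ a' < a, ∀ b < n.size, s''.rv 1 < s.ra 4 (2 ^ a' - 1) * s.ra 5 (2 ^ b - 1) →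
        sampleWeight n (s.ra 4) (s.ra 5) (s.ra 4 (2 ^ a' - 1) * s.ra 5 (2 ^ b - 1)) < 4 * ell) ∧
      ∀ b' < b, s''.rv 1 < s.ra 4 (2 ^ a - 1) * s.ra 5 (2 ^ b' - 1) →
        sampleWeight n (s.ra 4) (s.ra 5) (s.ra 4 (2 ^ a - 1) * s.ra 5 (2 ^ b' - 1)) < 4 * ell)
      (by omega) ?_ ?_ ?_) le_rfl ?_
    · intro s'' F'
      simp [F'.nv 0 (by decide), e0]
    · simpa using hI
    · intro b s'' hb F' hi' hI'
      have f0 : s''.nv 0 = n := by simp [F'.nv 0 (by decide), e0]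
      have f2 : s''.nv 2 = ell := by simp [F'.nv 2 (by decide), e2]
      have f4 : s''.ra 4 = s.ra 4 := by simp [F'.ra 4 (by decide), e4]
      have f5 : s''.ra 5 = s.ra 5 := by simp [F'.ra 5 (by decide), e5]
      have f20 : s''.nv 20 = 2 ^ a := by simp [F'.nv 20 (by decide), hi]
      have k1 := two_pow_sub_one_lt ha
      have k2 := two_pow_sub_one_lt hb
      have l1 := Nat.lt_size.1 ha
      have l2 := Nat.lt_size.1 hb
      refine Run.setR_seq ?_ (Run.seq ((weightProg_spec _ (n := n) ?_ hS (by omega)).weaken le_rfl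
        fun s₃ F₃ h₃ => ?_))
      · simp [f20, hi']; omega
      · simp [f0]
      · have g2 : s₃.nv 2 = ell := by simp [F₃.nv 2 (by decide), f2]
        have g1 : s₃.rv 1 = s''.rv 1 := by simp [F₃.rv 1 (by decide)]
        have g4 : s₃.rv 4 = s.ra 4 (2 ^ a - 1) * s.ra 5 (2 ^ b - 1) := by
          simp [F₃.rv 4 (by decide), f4, f5, f20, hi']
        have g21 : s₃.nv 21 = 2 ^ b := by simp [F₃.nv 21 (by decide), hi']
        simp [f4, f5, f20, hi'] at h₃
        refine Run.ite ?_ (fun hv => Run.setR (by simp) ⟨?_, ?_, ?_, ?_, ?_⟩)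
          (fun hv => Run.skip ⟨?_, ?_, ?_, ?_, ?_⟩)
        · simp [g2]; omega
        all_goals simp [g2, g1, g4, h₃] at hv
        · simp [g21]
        · simp [g4]; linarith [hI'.1]
        · simp [g4]; exact Or.inr hv.1
        · simp [g4]
          exact fun a' ha' b' hb' h => hI'.2.2.1 a' ha' b' hb' (hv.2.trans h)
        · simp [g4]
          intro b' hb' h
          rcases Nat.lt_or_eq_of_le hb' with h' | rfl
          · exact hI'.2.2.2 b' h' (hv.2.trans h)
          · exact absurd h (lt_irrefl _)
        · simp [g21]
        · simpa [g1] using hI'.1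
        · simpa [g1] using hI'.2.1
        · simpa [g1] using hI'.2.2.1
        · simp [g1]
          intro b' hb' h
          rcases Nat.lt_or_eq_of_le hb' with h' | rfl
          · exact hI'.2.2.2 b' h' h
          · by_contra hc
            exact absurd h (not_lt.2 (hv (not_lt.1 hc)))
    · intro s'' F' h
      refine ⟨by simp [F'.nv 20 (by decide), hi], ?_⟩
      simp only [State.setN_rv]
      refine ⟨h.1, h.2.1, fun a' ha' b hb => ?_⟩
      rcases Nat.lt_succ_iff_lt_or_eq.1 ha' with h' | rfl
      · exact h.2.2.1 a' h' b hb
      · exact h.2.2.2 b hb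
  · have h1 : 1 ≤ n.size := Nat.size_pos.2 hn1
    have h4 := size_pow_four_le hn1
    have h2 : n.size ≤ n.size ^ 4 := Nat.le_self_pow (by norm_num) _
    have h3 : n.size ^ 2 ≤ n.size ^ 4 := Nat.pow_le_pow_right h1 (by norm_num)
    have h5 : n.size ^ 3 ≤ n.size ^ 4 := Nat.pow_le_pow_right h1 (by norm_num)
    have h6 : n.size * ((n.size * ((Ts + 2 + 1) + 2) + 2) + 2) + 2 + 1 =
        4 * n.size ^ 4 + 4 * n.size ^ 3 + 8 * n.size ^ 2 + 4 * n.size + 3 := by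
      rw [hTs]; ring
    omega

end RealRAM

/-! ### Merging a list of entries with an outer product -/

theorem lt_card_filter_range_iff {m : ℕ} {p : ℕ → Prop} [DecidablePred p]
    (hp : ∀ x y, x ≤ y → y < m → p y → p x) {x : ℕ} (hx : x < m) :
    x < #{y ∈ range m | p y} ↔ p x := by
  constructor
  · intro h
    by_contra hpx
    have : {y ∈ range m | p y} ⊆ range x := fun y hy => by
      simp only [mem_filter, mem_range] at hy ⊢
      by_contra hxy
      exact hpx (hp x y (not_lt.1 hxy) hy.1 hy.2)
    have := card_le_card this
    rw [card_range] at this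
    omega
  · intro hpx
    have : range (x + 1) ⊆ {y ∈ range m | p y} := fun y hy => by
      simp only [mem_filter, mem_range] at hy ⊢
      exact ⟨by omega, hp y x (by omega) hx hpx⟩
    have := card_le_card this
    rw [card_range] at this
    omega

open Classical in
/-- The positions of the positive entries of a matrix of size `n`. -/
noncomputable def posSupport (n : ℕ) (Y : ℕ → ℕ → ℝ) : Finset (ℕ × ℕ) :=
  {e ∈ range n ×ˢ range n | 0 < Y e.1 e.2}

theorem mem_posSupport {n : ℕ} {Y : ℕ → ℕ → ℝ} {i j : ℕ} :
    (i, j) ∈ posSupport n Y ↔ (i < n ∧ j < n) ∧ 0 < Y i j := by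
  simp [posSupport]

namespace RealRAM

/-- `Y` is obtained from the nonnegative matrix `Z`, whose positive entries are listed row by row,
by adding the part above `θ` of an outer product `a bᵀ`; `b` is given in decreasing order, with the
original position of its entry `j` being `σ j`. -/
structure MergeData (n m N : ℕ) (θ : ℝ) (R C σ : ℕ → ℕ) (X a b : ℕ → ℝ) (Z Y : ℕ → ℕ → ℝ) :
    Prop where
  list : Listing (posSupport n Z) Z m R C X
  mono : ∀ l l', l ≤ l' → l' < m → R l ≤ R l'
  nonneg : ∀ i j, 0 ≤ Z i j
  a_nonneg : ∀ i < n, 0 ≤ a i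
  b_anti : ∀ j j', j ≤ j' → j' < n → b j' ≤ b j
  σ_lt : ∀ j < n, σ j < n
  σ_inj : ∀ j < n, ∀ j' < n, σ j = σ j' → j = j'
  eq : ∀ i < n, ∀ j < n, Y i (σ j) = Z i (σ j) + max (a i * b j - θ) 0
  card_le : #(posSupport n Y) ≤ N

/-- The number of listed entries in rows above row `i`. -/
def rowStart (m : ℕ) (R : ℕ → ℕ) (i : ℕ) : ℕ := #{l ∈ range m | R l < i}

open Classical in
/-- The number of entries in row `i` of the outer product that exceed the threshold. -/
noncomputable def exceed (n : ℕ) (θ : ℝ) (a b : ℕ → ℝ) (i : ℕ) : ℕ := #{j ∈ range n | θ < a i * b j}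

namespace MergeData

variable {n m N : ℕ} {θ : ℝ} {R C σ : ℕ → ℕ} {X a b : ℕ → ℝ} {Z Y : ℕ → ℕ → ℝ}

theorem σ_surj (h : MergeData n m N θ R C σ X a b Z Y) {c : ℕ} (hc : c < n) :
    ∃ j < n, σ j = c := by
  obtain ⟨j, hj, h'⟩ := surj_on_of_inj_on_of_card_le (s := range n) (t := range n)
    (fun j _ => σ j) (fun j hj => mem_range.2 (h.σ_lt j (mem_range.1 hj)))
    (fun j j' hj hj' => h.σ_inj j (mem_range.1 hj) j' (mem_range.1 hj')) le_rfl c (mem_range.2 hc)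
  exact ⟨j, mem_range.1 hj, h'.symm⟩

theorem lt_rowStart (h : MergeData n m N θ R C σ X a b Z Y) {i l : ℕ} (hl : l < m) :
    l < rowStart m R i ↔ R l < i :=
  lt_card_filter_range_iff (fun x y hxy hy hR => (h.mono x y hxy hy).trans_lt hR) hl

theorem rowStart_le (m : ℕ) (R : ℕ → ℕ) (i : ℕ) : rowStart m R i ≤ m :=
  (card_filter_le _ _).trans (by simp)

theorem rowStart_mono (m : ℕ) (R : ℕ → ℕ) {i i' : ℕ} (hi : i ≤ i') :
    rowStart m R i ≤ rowStart m R i' :=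
  card_le_card fun l hl => by
    simp only [mem_filter] at hl ⊢
    exact ⟨hl.1, hl.2.trans_le hi⟩

theorem row_eq (h : MergeData n m N θ R C σ X a b Z Y) {i l : ℕ} (hl : l < m) :
    R l = i ↔ rowStart m R i ≤ l ∧ l < rowStart m R (i + 1) := by
  rw [h.lt_rowStart hl, ← not_lt, h.lt_rowStart hl]; omega

theorem lt_exceed (h : MergeData n m N θ R C σ X a b Z Y) {i j : ℕ} (hi : i < n) (hj : j < n) :
    j < exceed n θ a b i ↔ θ < a i * b j := by
  classical
  exact lt_card_filter_range_iff (fun x y hxy hy hθ =>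
    hθ.trans_le (mul_le_mul_of_nonneg_left (h.b_anti x y hxy hy) (h.a_nonneg i hi))) hj

theorem exceed_le (n : ℕ) (θ : ℝ) (a b : ℕ → ℝ) (i : ℕ) : exceed n θ a b i ≤ n := by
  classical
  exact (card_filter_le _ _).trans (by simp)

theorem eq_zero (h : MergeData n m N θ R C σ X a b Z Y) {i c : ℕ} (hi : i < n) (hc : c < n)
    (hic : (i, c) ∉ posSupport n Z) : Z i c = 0 := by
  by_contra h0
  exact hic (mem_posSupport.2 ⟨⟨hi, hc⟩, (h.nonneg i c).lt_of_ne' h0⟩)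

theorem le_Y (h : MergeData n m N θ R C σ X a b Z Y) {i c : ℕ} (hi : i < n) (hc : c < n) :
    Z i c ≤ Y i c := by
  obtain ⟨j, hj, rfl⟩ := h.σ_surj hc
  rw [h.eq i hi j hj]
  linarith [le_max_right (a i * b j - θ) 0]

open Classical in
theorem sum_exceed (n : ℕ) (θ : ℝ) (a b : ℕ → ℝ) : ∑ i ∈ range n, exceed n θ a b i =
    #{e ∈ range n ×ˢ range n | θ < a e.1 * b e.2} := by
  rw [card_filter, sum_product]
  simp only [exceed, card_filter]

end MergeData

/-- The memory holds the operands of the merging step. -/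
structure MergeMem (n m : ℕ) (θ : ℝ) (R C σ : ℕ → ℕ) (X a b : ℕ → ℝ) (s : State) : Prop where
  nv0 : s.nv 0 = n
  nv4 : s.nv 4 = m
  rv1 : s.rv 1 = θ
  na0 : s.na 0 = R
  na1 : s.na 1 = C
  na4 : s.na 4 = σ
  ra0 : s.ra 0 = X
  ra3 : s.ra 3 = a
  ra5 : s.ra 5 = b

variable {n m N : ℕ} {θ : ℝ} {R C σ : ℕ → ℕ} {X a b : ℕ → ℝ} {Z Y : ℕ → ℕ → ℝ}

theorem MergeMem.of_frame {p : Stmt} {s s' : State} (h : MergeMem n m θ R C σ X a b s)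
    (F : Frame p s s') (hp : (0 ∉ p.wnv ∧ 4 ∉ p.wnv) ∧ 1 ∉ p.wrv ∧
      (0 ∉ p.wna ∧ 1 ∉ p.wna ∧ 4 ∉ p.wna) ∧ 0 ∉ p.wra ∧ 3 ∉ p.wra ∧ 5 ∉ p.wra) :
    MergeMem n m θ R C σ X a b s' where
  nv0 := (F.nv 0 hp.1.1).trans h.nv0
  nv4 := (F.nv 4 hp.1.2).trans h.nv4
  rv1 := (F.rv 1 hp.2.1).trans h.rv1
  na0 := (F.na 0 hp.2.2.1.1).trans h.na0
  na1 := (F.na 1 hp.2.2.1.2.1).trans h.na1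
  na4 := (F.na 4 hp.2.2.1.2.2).trans h.na4
  ra0 := (F.ra 0 hp.2.2.2.1).trans h.ra0
  ra3 := (F.ra 3 hp.2.2.2.2.1).trans h.ra3
  ra5 := (F.ra 5 hp.2.2.2.2.2).trans h.ra5

/-- The state of the merged list `na 2`, `na 3`, `ra 1` while row `i` is processed: the list holds
the entries of `Y` at the positions in `U`, row by row and without a row below row `i`, and the
work array `ra 2` holds the entries of row `i` of `Z` at the other positions. -/
structure RowInv (n i : ℕ) (U : Finset (ℕ × ℕ)) (Z Y : ℕ → ℕ → ℝ) (s : State) : Prop where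
  list : Listing U Y (s.nv 6) (s.na 2) (s.na 3) (s.ra 1)
  sub : U ⊆ posSupport n Y
  row_le : ∀ e ∈ U, e.1 ≤ i
  mono : ∀ l l', l ≤ l' → l' < s.nv 6 → s.na 2 l ≤ s.na 2 l'
  work : ∀ c < n, s.ra 2 c = if (i, c) ∈ U then 0 else Z i c

theorem RowInv.of_eq {i : ℕ} {U : Finset (ℕ × ℕ)} {s s' : State} (h : RowInv n i U Z Y s)
    (h1 : s'.nv 6 = s.nv 6) (h2 : s'.na 2 = s.na 2) (h3 : s'.na 3 = s.na 3)
    (h4 : s'.ra 1 = s.ra 1) (h5 : s'.ra 2 = s.ra 2) : RowInv n i U Z Y s' := by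
  constructor
  · rw [h1, h2, h3, h4]; exact h.list
  · exact h.sub
  · exact h.row_le
  · rw [h1, h2]; exact h.mono
  · rw [h5]; exact h.work

/-- Appends the entry in row `nv 32` and column `c`, whose value is `e`, to the merged list. -/
def appendProg (c : NExp) (e : RExp) : Stmt :=
  .seq (.putN 2 (.var 6) (.var 32)) <| .seq (.putN 3 (.var 6) c) <| .seq (.putR 1 (.var 6) e) <|
  .seq (.putR 2 c (.lit 0)) <| .setN 6 (.add (.var 6) (.lit 1))

/-- The instructions of `appendProg` before the last one only write to cells outside the memory
that its operands `c` and `e` depend on. -/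
theorem appendProg_spec {S W : ℕ} {s : State} {i j : ℕ} {U : Finset (ℕ × ℕ)} {c : NExp} {e : RExp}
    (hI : RowInv n i U Z Y s) (hi : s.nv 32 = i) (hN : #(posSupport n Y) ≤ N) (hNS : N ≤ S)
    (hNW : N < W) (hjS : j < S) (hij : (i, j) ∈ posSupport n Y) (hU : (i, j) ∉ U)
    (hc : ∀ s', (∀ x, s'.nv x = s.nv x) → (∀ x, x ≠ 2 → x ≠ 3 → s'.na x = s.na x) →
      (∀ x, x ≠ 1 → s'.ra x = s.ra x) → c.ok S W s' ∧ c.val s' = j)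
    (he : ∀ s', (∀ x, s'.nv x = s.nv x) → (∀ x, s'.rv x = s.rv x) →
      (∀ x, x ≠ 2 → x ≠ 3 → s'.na x = s.na x) →
      (∀ x, s'.ra x = s.ra x) → e.ok S W s' ∧ e.val s' = Y i j) :
    Run S W (appendProg c e) s 5 fun s' => RowInv n i (insert (i, j) U) Z Y s' := by
  have hlt : s.nv 6 < N := by
    have h1 := card_le_card (insert_subset hij hI.sub)
    rw [card_insert_of_notMem hU, hI.list.card_eq] at h1
    omega
  have key : ∀ s' : State, (∀ l, s'.na 2 l = if l = s.nv 6 then i else s.na 2 l) →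
      (∀ l, s'.na 3 l = if l = s.nv 6 then j else s.na 3 l) →
      (∀ l, s'.ra 1 l = if l = s.nv 6 then Y i j else s.ra 1 l) →
      (∀ l, s'.ra 2 l = if l = j then 0 else s.ra 2 l) → s'.nv 6 = s.nv 6 + 1 →
      RowInv n i (insert (i, j) U) Z Y s' := by
    intro s' h1 h2 h3 h4 h5
    refine ⟨?_, insert_subset hij hI.sub, ?_, ?_, ?_⟩
    · rw [h5]
      exact hI.list.append hU h1 h2 h3
    · intro e he
      rcases mem_insert.1 he with rfl | he
      · exact le_rfl
      · exact hI.row_le e he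
    · intro l l' hll hl'
      rw [h5] at hl'
      rw [h1, h1]
      split_ifs with h6 h7 h7
      · exact le_rfl
      · omega
      · exact hI.row_le _ (hI.list.mem (l := l) (by omega))
      · exact hI.mono l l' hll (by omega)
    · intro c hc
      rw [h4]
      by_cases hcj : c = j
      · simp [hcj]
      · rw [if_neg hcj, hI.work c hc]
        simp [hcj]
  refine Run.putN_seq (by simp) (by simp; omega) (by simp) (Run.putN_seq (by simp) (by simp; omega)
    ?_ (Run.putR_seq (by simp) (by simp; omega) ?_ (Run.putR_seq ?_ ?_ (by simp)
      (Run.setN ?_ ?_))))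
  · exact (hc _ (by simp) (fun x h2 h3 => by ext; simp [h2]) (by simp)).1
  · exact (he _ (by simp) (by simp) (fun x h2 h3 => by ext; simp [h2, h3]) (by simp)).1
  · exact (hc _ (by simp) (fun x h2 h3 => by ext; simp [h2, h3])
      (fun x h1 => by ext; simp [h1])).1
  · rw [(hc _ (by simp) (fun x h2 h3 => by ext; simp [h2, h3])
      (fun x h1 => by ext; simp [h1])).2]
    exact hjS
  · simp; omega
  · refine key _ ?_ ?_ ?_ ?_ (by simp)
    · simp [hi]
    · intro l
      have := (hc (s.putN 2 (s.nv 6) (s.nv 32)) (by simp) (fun x h2 h3 => by ext; simp [h2])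
        (by simp)).2
      simp [this]
    · intro l
      have := (he _ (by simp) (by simp) (fun x h2 h3 => by ext; simp [h2, h3]) (by simp) :
        e.ok S W ((s.putN 2 (s.nv 6) (s.nv 32)).putN 3 (s.nv 6)
          (c.val (s.putN 2 (s.nv 6) (s.nv 32)))) ∧ _).2
      simp [this]
    · intro l
      simp only [State.setN_ra, State.putR_ra, NExp.val, RExp.val, State.putN_ra, Nat.cast_zero,
        true_and, OfNat.ofNat_ne_one, false_and, if_false]
      rw [(hc _ (by simp) (fun x h2 h3 => by ext; simp [h2, h3])
        (fun x h1 => by ext; simp [h1])).2]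

/-- Copies the listed entries of row `nv 32` to the work array and stores the end of this part of
the list in `nv 31`. -/
def scatterProg : Stmt :=
  .seq (.setN 31 (.var 30)) <|
  .loop (.and (.nlt (.var 31) (.var 4)) (.neq (.get 0 (.var 31)) (.var 32)))
    (.seq (.putR 2 (.get 1 (.var 31)) (.get 0 (.var 31))) (.setN 31 (.add (.var 31) (.lit 1))))

theorem scatterProg_spec {S W : ℕ} {s : State} {i : ℕ} {U : Finset (ℕ × ℕ)}
    (h : MergeData n m N θ R C σ X a b Z Y) (hM : MergeMem n m θ R C σ X a b s) (hin : i < n)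
    (hnS : n ≤ S) (hmS : m ≤ S) (hmW : m < W) (hI : RowInv n i U (fun _ _ => 0) Y s)
    (hU : ∀ e ∈ U, e.1 < i) (hi : s.nv 32 = i) (h30 : s.nv 30 = rowStart m R i) :
    Run S W scatterProg s (3 * (rowStart m R (i + 1) - rowStart m R i) + 2) fun s' =>
      RowInv n i U Z Y s' ∧ s'.nv 31 = rowStart m R (i + 1) := by
  classical
  have hle := MergeData.rowStart_mono m R (Nat.le_add_right i 1)
  refine Run.setN_seq (by simp) (Run.loop (fun s' f => ∃ l, rowStart m R i ≤ l ∧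
    l ≤ rowStart m R (i + 1) ∧ f = 3 * (rowStart m R (i + 1) - l) + 1 ∧ s'.nv 31 = l ∧
    ∀ c < n, s'.ra 2 c = if ∃ l', rowStart m R i ≤ l' ∧ l' < l ∧ C l' = c then Z i c else 0)
    ⟨_, le_rfl, hle, rfl, by simp [h30], ?_⟩ ?_)
  · intro c hc
    rw [if_neg (by rintro ⟨l', h1, h2, -⟩; omega)]
    simpa using hI.work c hc
  · rintro s' f F ⟨l, hl1, hl2, rfl, h31, hw⟩
    have hM' : MergeMem n m θ R C σ X a b s' :=
      (hM.of_frame (p := scatterProg) (Frame.setN scatterProg (by decide)) (by decide)).of_frame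
        F (by decide)
    have e32 : s'.nv 32 = i := by simp [F.nv 32 (by decide), hi]
    have hlm := hl2.trans (MergeData.rowStart_le m R (i + 1))
    refine ⟨?_, fun hv => ⟨by omega, ?_⟩, fun hv => ?_⟩
    · simp [hM'.nv4, h31]; omega
    · have hl : l = rowStart m R (i + 1) := by
        by_contra hne
        have hlt : l < rowStart m R (i + 1) := by omega
        have hlm : l < m := hlt.trans_le (MergeData.rowStart_le m R (i + 1))
        refine hv ?_
        simp only [BExp.val, NExp.val, h31, hM'.nv4, hM'.na0, e32]
        exact ⟨hlm, (h.row_eq hlm).2 ⟨hl1, hlt⟩⟩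
      subst hl
      refine ⟨⟨?_, hI.sub, hI.row_le, ?_, ?_⟩, h31⟩
      · simpa [F.nv 6 (by decide), F.na 2 (by decide), F.na 3 (by decide), F.ra 1 (by decide)]
          using hI.list
      · simpa [F.nv 6 (by decide), F.na 2 (by decide)] using hI.mono
      · intro c hc
        have hcU : (i, c) ∉ U := fun hc => (hU _ hc).ne rfl
        rw [hw c hc, if_neg hcU]
        split_ifs with hex
        · rfl
        · refine (h.eq_zero hin hc fun hic => hex ?_).symm
          obtain ⟨l', hl', hR, hC⟩ := h.list.exists_of_mem hic
          have := (h.row_eq hl').1 hR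
          exact ⟨l', this.1, this.2, hC⟩
    · simp only [BExp.val, NExp.val, h31, hM'.nv4, hM'.na0, e32] at hv
      have hrow := (h.row_eq hv.1).1 hv.2
      have hmem := h.list.mem hv.1
      have hCn : C l < n := (mem_posSupport.1 hmem).1.2
      refine ⟨2, _, ?_, Run.putR_seq ?_ ?_ ?_ (Run.setN ?_ ⟨l + 1, by omega, hrow.2, rfl, ?_, ?_⟩)⟩
      · omega
      · simp [h31]; omega
      · simp [h31, hM'.na1]; omega
      · simp [h31]; omega
      · simp [h31]; omega
      · simp [h31]
      · intro c hc
        simp only [State.setN_ra, State.putR_ra, NExp.val, RExp.val, h31, hM'.na1, hM'.ra0,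
          true_and]
        by_cases hcl : c = C l
        · rw [if_pos hcl, if_pos ⟨l, hl1, by omega, hcl.symm⟩, h.list.val_eq l hv.1, hv.2, hcl]
        · rw [if_neg hcl, hw c hc]
          refine if_congr ⟨?_, ?_⟩ rfl rfl
          · rintro ⟨l', h1, h2, h3⟩
            exact ⟨l', h1, by omega, h3⟩
          · rintro ⟨l', h1, h2, h3⟩
            refine ⟨l', h1, lt_of_le_of_ne (by omega) ?_, h3⟩
            rintro rfl
            exact hcl h3.symm

/-- Appends the entries of row `nv 32` at which the outer product exceeds the threshold. -/
def outerProg : Stmt :=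
  .seq (.setN 33 (.lit 0)) <|
  .loop (.and (.nlt (.var 33) (.var 0))
      (.rlt (.var 1) (.mul (.get 3 (.var 32)) (.get 5 (.var 33)))))
    (.seq (appendProg (.get 4 (.var 33)) (.add (.get 2 (.get 4 (.var 33)))
      (.sub (.mul (.get 3 (.var 32)) (.get 5 (.var 33))) (.var 1))))
      (.setN 33 (.add (.var 33) (.lit 1))))

theorem outerProg_spec {S W : ℕ} {s : State} {i : ℕ} {U : Finset (ℕ × ℕ)}
    (h : MergeData n m N θ R C σ X a b Z Y) (hM : MergeMem n m θ R C σ X a b s) (hin : i < n)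
    (hnS : n ≤ S) (hNS : N ≤ S) (hnW : n < W) (hNW : N < W) (hI : RowInv n i U Z Y s)
    (hU : ∀ e ∈ U, e.1 < i) (hi : s.nv 32 = i) :
    Run S W outerProg s (7 * exceed n θ a b i + 2) fun s' => ∃ U', RowInv n i U' Z Y s' ∧ U ⊆ U' ∧
      ∀ j < exceed n θ a b i, (i, σ j) ∈ U' := by
  have hJ := MergeData.exceed_le n θ a b i
  refine Run.setN_seq (by simp) (Run.loop (fun s' f => ∃ j U', j ≤ exceed n θ a b i ∧
    f = 7 * (exceed n θ a b i - j) + 1 ∧ s'.nv 33 = j ∧ RowInv n i U' Z Y s' ∧ U ⊆ U' ∧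
    ∀ c, (i, c) ∈ U' ↔ ∃ j' < j, σ j' = c)
    ⟨0, U, by omega, rfl, by simp, hI.of_eq (by simp) rfl rfl rfl rfl, Subset.rfl, ?_⟩ ?_)
  · simpa using fun c hc => (hU _ hc).ne rfl
  · rintro s' f F ⟨j, U', hj, rfl, h33, hI', hUU', hUj⟩
    have hM' : MergeMem n m θ R C σ X a b s' :=
      (hM.of_frame (p := outerProg) (Frame.setN outerProg (by decide)) (by decide)).of_frame
        F (by decide)
    have e32 : s'.nv 32 = i := by simp [F.nv 32 (by decide), hi]
    have hval : (BExp.and (.nlt (.var 33) (.var 0))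
        (.rlt (.var 1) (.mul (.get 3 (.var 32)) (.get 5 (.var 33))))).val s' ↔
        j < exceed n θ a b i := by
      simp only [BExp.val, NExp.val, RExp.val, h33, e32, hM'.nv0, hM'.rv1, hM'.ra3, hM'.ra5]
      constructor
      · exact fun h' => (h.lt_exceed hin h'.1).2 h'.2
      · exact fun h' => ⟨by omega, (h.lt_exceed hin (by omega)).1 h'⟩
    refine ⟨?_, fun hv => ⟨by omega, U', hI', hUU', fun j' hj' => ?_⟩, fun hv => ?_⟩
    · simp [h33, e32, hM'.nv0]; omega
    · rw [hval] at hv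
      exact (hUj _).2 ⟨j', by omega, rfl⟩
    · rw [hval] at hv
      have hjn : j < n := by omega
      have hθ := (h.lt_exceed hin hjn).1 hv
      have hY := h.eq i hin j hjn
      rw [max_eq_left (by linarith)] at hY
      have hnot : (i, σ j) ∉ U' := by
        rw [hUj]
        rintro ⟨j', hj', hjj⟩
        exact hj'.ne (h.σ_inj j' (by omega) j hjn hjj)
      have hσ := h.σ_lt j hjn
      refine ⟨5 + 1, _, ?_, Run.seq ((appendProg_spec (N := N) (j := σ j) hI' e32 h.card_le hNS hNW
        (by omega) ?_ hnot ?_ ?_).weaken le_rfl fun s'' F' hI'' =>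
          Run.setN ?_ ⟨j + 1, insert (i, σ j) U', hv, rfl, ?_, hI''.of_eq (by simp) rfl rfl rfl rfl,
            hUU'.trans (subset_insert _ _), fun c => ?_⟩)⟩
      · omega
      · exact mem_posSupport.2 ⟨⟨hin, hσ⟩, by have := h.nonneg i (σ j); linarith⟩
      · intro s'' h1 h2 h3
        simp only [NExp.ok, NExp.val, h1, h2 4 (by decide) (by decide), h33, hM'.na4]
        exact ⟨⟨trivial, by omega⟩, trivial⟩
      · intro s'' h1 h1' h2 h3
        simp only [RExp.ok, RExp.val, NExp.ok, NExp.val, h1, h1', h2 4 (by decide) (by decide), h3,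
          h33, e32, hM'.na4, hM'.ra3, hM'.ra5, hM'.rv1, hI'.work _ hσ, if_neg hnot, hY]
        refine ⟨⟨⟨⟨trivial, by omega⟩, by omega⟩, ⟨⟨trivial, by omega⟩, trivial, by omega⟩,
          trivial⟩,
          trivial⟩
      · simp [F'.nv 33 (by decide), h33]; omega
      · simp [F'.nv 33 (by decide), h33]
      · rw [mem_insert, hUj, Prod.mk.injEq]
        constructor
        · rintro (⟨-, rfl⟩ | ⟨j', hj', hc⟩)
          · exact ⟨j, by omega, rfl⟩
          · exact ⟨j', by omega, hc⟩
        · rintro ⟨j', hj', hc⟩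
          rcases Nat.lt_succ_iff_lt_or_eq.1 hj' with h' | rfl
          · exact Or.inr ⟨j', h', hc⟩
          · exact Or.inl ⟨rfl, hc.symm⟩

/-- Appends the entries of row `nv 32` that are left in the work array; those that were already part
of an appended entry have been set to `0`. -/
def restProg : Stmt :=
  .loop (.nlt (.var 30) (.var 31)) <|
    .seq (.ite (.rlt (.lit 0) (.get 2 (.get 1 (.var 30))))
      (appendProg (.get 1 (.var 30)) (.get 2 (.get 1 (.var 30)))) .skip)
      (.setN 30 (.add (.var 30) (.lit 1)))

theorem restProg_spec {S W : ℕ} {s : State} {i : ℕ} {U : Finset (ℕ × ℕ)}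
    (h : MergeData n m N θ R C σ X a b Z Y) (hM : MergeMem n m θ R C σ X a b s) (hin : i < n)
    (hnS : n ≤ S) (hNS : N ≤ S) (hmS : m ≤ S) (hmW : m < W) (hNW : N < W)
    (hI : RowInv n i U Z Y s) (hU : ∀ j < exceed n θ a b i, (i, σ j) ∈ U) (hi : s.nv 32 = i)
    (h30 : s.nv 30 = rowStart m R i) (h31 : s.nv 31 = rowStart m R (i + 1)) :
    Run S W restProg s (8 * (rowStart m R (i + 1) - rowStart m R i) + 1) fun s' =>
      s'.nv 30 = rowStart m R (i + 1) ∧ ∃ U', RowInv n i U' Z Y s' ∧ U ⊆ U' ∧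
      ∀ l, rowStart m R i ≤ l → l < rowStart m R (i + 1) → (i, C l) ∈ U' := by
  have hle := MergeData.rowStart_mono m R (Nat.le_add_right i 1)
  have hle' := MergeData.rowStart_le m R (i + 1)
  refine Run.loop (fun s' f => ∃ l U', rowStart m R i ≤ l ∧
    l ≤ rowStart m R (i + 1) ∧ f = 8 * (rowStart m R (i + 1) - l) + 1 ∧ s'.nv 30 = l ∧
    RowInv n i U' Z Y s' ∧ U ⊆ U' ∧ ∀ l', rowStart m R i ≤ l' → l' < l → (i, C l') ∈ U')
    ⟨_, U, le_rfl, hle, rfl, h30, hI, Subset.rfl, fun l' h1 h2 => by omega⟩ ?_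
  rintro s' f F ⟨l, U', hl1, hl2, rfl, e30, hI', hUU', hUl⟩
  have hM' : MergeMem n m θ R C σ X a b s' := hM.of_frame F (by decide)
  have e32 : s'.nv 32 = i := by simp [F.nv 32 (by decide), hi]
  have e31 : s'.nv 31 = rowStart m R (i + 1) := by simp [F.nv 31 (by decide), h31]
  refine ⟨by simp, fun hv => ?_, fun hv => ?_⟩
  · simp only [BExp.val, NExp.val, e30, e31] at hv
    obtain rfl : l = rowStart m R (i + 1) := by omega
    exact ⟨by omega, e30, U', hI', hUU', hUl⟩
  · simp only [BExp.val, NExp.val, e30, e31] at hv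
    have hlm : l < m := by omega
    have hrow := (h.row_eq hlm).2 ⟨hl1, hv⟩
    have hmem := h.list.mem hlm
    rw [hrow, mem_posSupport] at hmem
    have hCn := hmem.1.2
    have hYpos := hmem.2.trans_le (h.le_Y hin hCn)
    have hwork := hI'.work _ hCn
    refine ⟨6 + 1, 8 * (rowStart m R (i + 1) - (l + 1)) + 1, by omega,
      Run.seq (Run.weaken (Q := fun s'' => s''.nv 30 = l ∧ ∃ U'', RowInv n i U'' Z Y s'' ∧
        U' ⊆ U'' ∧ (i, C l) ∈ U'') (T := 6) ?_ le_rfl ?_)⟩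
    · refine Run.ite (T := 5) ?_ (fun hw => ?_) (fun hw => ?_)
      · simp [e30, hM'.na1]; omega
      · simp only [BExp.val, RExp.val, NExp.val, e30, hM'.na1, hwork, Nat.cast_zero] at hw
        have hnot : (i, C l) ∉ U' := fun h' => by simp [h'] at hw
        have hYZ : Y i (C l) = Z i (C l) := by
          obtain ⟨j, hj, hjC⟩ := h.σ_surj hCn
          rw [← hjC, h.eq i hin j hj, max_eq_right, add_zero]
          by_contra hgt
          refine hnot ?_
          rw [← hjC]
          exact hUU' (hU j ((h.lt_exceed hin hj).2 (by linarith)))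
        refine (appendProg_spec (N := N) (j := C l) hI' e32 h.card_le hNS hNW (by omega)
          (mem_posSupport.2 ⟨hmem.1, hYpos⟩) hnot ?_ ?_).weaken le_rfl fun s'' F' hI'' =>
          ⟨?_, _, hI'', subset_insert _ _, mem_insert_self _ _⟩
        · intro s'' h1 h2 h3
          simp only [NExp.ok, NExp.val, h1, h2 1 (by decide) (by decide), e30, hM'.na1]
          exact ⟨⟨trivial, by omega⟩, trivial⟩
        · intro s'' h1 h1' h2 h3
          simp only [RExp.ok, RExp.val, NExp.ok, NExp.val, h1, h2 1 (by decide) (by decide), h3,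
            e30, hM'.na1, hwork, if_neg hnot, hYZ]
          exact ⟨⟨⟨trivial, by omega⟩, by omega⟩, trivial⟩
        · simp [F'.nv 30 (by decide), e30]
      · simp only [BExp.val, RExp.val, NExp.val, e30, hM'.na1, hwork, Nat.cast_zero] at hw
        have hin' : (i, C l) ∈ U' := by
          by_contra hnot
          rw [if_neg hnot] at hw
          exact hw hmem.2
        exact (Run.skip ⟨e30, U', hI', Subset.rfl, hin'⟩).weaken (by omega) fun _ _ h => h
    · rintro s'' F' ⟨f30, U'', hI'', hUU'', hCU⟩
      refine Run.setN ?_ ⟨l + 1, U'', by omega, hv, rfl, by simp [f30],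
        hI''.of_eq (by simp) rfl rfl rfl rfl, hUU'.trans hUU'', fun l' h1 h2 => ?_⟩
      · simp [f30]; omega
      · rcases Nat.lt_succ_iff_lt_or_eq.1 h2 with h' | rfl
        · exact hUU'' (hUl l' h1 h')
        · exact hCU

/-- Stores the list of the positive entries of `Y` in `na 2`, `na 3`, `ra 1`, and its length in
`nv 6`. -/
def mergeProg : Stmt :=
  .seq (.setN 6 (.lit 0)) <| .seq (.setN 30 (.lit 0)) <| .forUp 32 (.var 0) <|
    .seq scatterProg <| .seq outerProg restProg

/-- Every listed entry and every entry of the outer product above the threshold is touched a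
constant number of times, and every row costs constant extra time; the dense work row is never
cleared as a whole. -/
theorem mergeProg_spec {S W : ℕ} {s : State} (h : MergeData n m N θ R C σ X a b Z Y)
    (hM : MergeMem n m θ R C σ X a b s) (hnS : n ≤ S) (hNS : N ≤ S) (hmS : m ≤ S) (hnW : n < W)
    (hmW : m < W) (hNW : N < W) (hwork : ∀ c < n, s.ra 2 c = 0) :
    Run S W mergeProg s (11 * m + 7 * ∑ i ∈ range n, exceed n θ a b i + 7 * n + 4) fun s' =>
      Listing (posSupport n Y) Y (s'.nv 6) (s'.na 2) (s'.na 3) (s'.ra 1) ∧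
      (∀ l l', l ≤ l' → l' < s'.nv 6 → s'.na 2 l ≤ s'.na 2 l') ∧ ∀ c < n, s'.ra 2 c = 0 := by
  set T : ℕ → ℕ := fun i => (3 * (rowStart m R (i + 1) - rowStart m R i) + 2) +
    ((7 * exceed n θ a b i + 2) + (8 * (rowStart m R (i + 1) - rowStart m R i) + 1)) with hT
  refine Run.weaken (Run.setN_seq (by simp) (Run.setN_seq (by simp) (Run.forUp_sum n T (fun i s' =>
    s'.nv 30 = rowStart m R i ∧ ∃ U, RowInv n i U (fun _ _ => 0) Y s' ∧ (∀ e ∈ U, e.1 < i) ∧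
      ∀ e ∈ posSupport n Y, e.1 < i → e ∈ U) hnW ?_ ?_ ?_))) ?_ ?_
  · intro s' F
    simp [F.nv 0 (by decide), hM.nv0]
  · refine ⟨by simp [rowStart], ∅, ⟨?_, by simp, by simp, by simp, ?_⟩, by simp, by simp⟩
    · simpa using Listing.empty ..
    · simpa using hwork
  · rintro i s' hin F hi ⟨h30, U, hI, hUlt, hUall⟩
    have hM' : MergeMem n m θ R C σ X a b s' :=
      (hM.of_frame (p := mergeProg) ((Frame.setN mergeProg (by decide)).trans
        (Frame.setN mergeProg (by decide))) (by decide)).of_frame F (by decide)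
    refine Run.seq ((scatterProg_spec h hM' hin hnS hmS hmW hI hUlt hi h30).weaken le_rfl
      fun s₁ F₁ h₁ => ?_)
    have hM₁ := hM'.of_frame F₁ (by decide)
    have f32 : s₁.nv 32 = i := by simp [F₁.nv 32 (by decide), hi]
    have f30 : s₁.nv 30 = rowStart m R i := by simp [F₁.nv 30 (by decide), h30]
    refine Run.seq ((outerProg_spec h hM₁ hin hnS hNS hnW hNW h₁.1 hUlt f32).weaken le_rfl ?_)
    rintro s₂ F₂ ⟨U₂, hI₂, hU₂, hJ⟩
    have g32 : s₂.nv 32 = i := by simp [F₂.nv 32 (by decide), f32]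
    have g30 : s₂.nv 30 = rowStart m R i := by simp [F₂.nv 30 (by decide), f30]
    have g31 : s₂.nv 31 = rowStart m R (i + 1) := by simp [F₂.nv 31 (by decide), h₁.2]
    refine (restProg_spec h (hM₁.of_frame F₂ (by decide)) hin hnS hNS hmS hmW hNW hI₂ hJ g32 g30
      g31).weaken le_rfl ?_
    rintro s₃ F₃ ⟨k30, U₃, hI₃, hU₃, hC⟩
    have hrow : ∀ c, (i, c) ∈ posSupport n Y → (i, c) ∈ U₃ := by
      intro c hc
      rw [mem_posSupport] at hc
      by_cases hZ : (i, c) ∈ posSupport n Z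
      · obtain ⟨l, hl, hR, rfl⟩ := h.list.exists_of_mem hZ
        have := (h.row_eq hl).1 hR
        exact hC l this.1 this.2
      · obtain ⟨j, hj, rfl⟩ := h.σ_surj hc.1.2
        have hY := h.eq i hin j hj
        rw [h.eq_zero hin hc.1.2 hZ] at hY
        refine hU₃ (hJ j ((h.lt_exceed hin hj).2 ?_))
        by_contra hle
        rw [max_eq_right (by linarith)] at hY
        linarith [hc.2]
    refine ⟨by simp [F₃.nv 32 (by decide), g32], by simp [k30], U₃,
      ⟨?_, hI₃.sub, ?_, ?_, ?_⟩, ?_, ?_⟩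
    · simpa using hI₃.list
    · exact fun e he => (hI₃.row_le e he).trans (Nat.le_succ i)
    · simpa using hI₃.mono
    · intro c hc
      simp only [State.setN_ra, hI₃.work c hc, ite_self]
      split_ifs with hcU
      · rfl
      · refine le_antisymm ?_ (h.nonneg i c)
        by_contra hpos
        exact hcU (hrow c (mem_posSupport.2 ⟨⟨hin, hc⟩, (not_le.1 hpos).trans_le (h.le_Y hin hc)⟩))
    · exact fun e he => Nat.lt_succ_of_le (hI₃.row_le e he)
    · rintro ⟨i', c⟩ he hlt
      rcases Nat.lt_succ_iff_lt_or_eq.1 hlt with h' | h'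
      · exact hU₃ (hU₂ (hUall _ he h'))
      · simp only at h'
        subst h'
        exact hrow c he
  · have h1 : ∑ i ∈ range n, (rowStart m R (i + 1) - rowStart m R i) ≤ m := by
      rw [sum_range_tsub fun i j hij => MergeData.rowStart_mono m R hij]
      exact (Nat.sub_le _ _).trans (MergeData.rowStart_le m R n)
    have h2 : ∑ i ∈ range n, (T i + 2) =
        11 * ∑ i ∈ range n, (rowStart m R (i + 1) - rowStart m R i) +
        7 * ∑ i ∈ range n, exceed n θ a b i + 7 * n := by
      rw [mul_sum, mul_sum, ← sum_add_distrib]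
      have : 7 * n = ∑ _i ∈ range n, 7 := by simp [mul_comm]
      rw [this, ← sum_add_distrib]
      exact sum_congr rfl fun i _ => by rw [hT]; ring
    omega
  · rintro s' - ⟨-, U, hI, -, hall⟩
    have hU : U = posSupport n Y := hI.sub.antisymm fun e he =>
      hall e he (mem_posSupport.1 (show (e.1, e.2) ∈ _ from he)).1.1
    refine ⟨hU ▸ hI.list, hI.mono, fun c hc => ?_⟩
    simpa using hI.work c hc

end RealRAM

/-! ### Removing small entries from a list -/

theorem Listing.count_eq {T : Finset (ℕ × ℕ)} {Y : ℕ → ℕ → ℝ} {m : ℕ} {R C : ℕ → ℕ} {X : ℕ → ℝ}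
    (h : Listing T Y m R C X) (p : ℝ → Prop) [DecidablePred fun e : ℕ × ℕ => p (Y e.1 e.2)] :
    Selection.count p X m = #{e ∈ T | p (Y e.1 e.2)} := by
  classical
  rw [Selection.count_eq_card]
  refine card_bij (fun l _ => (R l, C l)) ?_ ?_ ?_
  · intro l hl
    simp only [mem_filter, mem_range] at hl ⊢
    exact ⟨h.mem hl.1, h.val_eq l hl.1 ▸ hl.2⟩
  · intro l hl l' hl' heq
    simp only [mem_filter, mem_range] at hl hl'
    exact h.inj hl.1 hl'.1 (Prod.mk.inj heq).1 (Prod.mk.inj heq).2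
  · rintro ⟨i, j⟩ he
    simp only [mem_filter] at he
    obtain ⟨l, hl, rfl, rfl⟩ := h.exists_of_mem he.1
    exact ⟨l, by simpa [hl, h.val_eq l hl] using he.2, rfl⟩

namespace RealRAM

/-- Subtracts the threshold `rv 2` from the list in `na 2`, `na 3`, `ra 1` and stores the positive
results as a list in `na 0`, `na 1`, `ra 0`. -/
def compactProg : Stmt :=
  .seq (.setN 4 (.lit 0)) <| .forUp 10 (.var 6) <|
    .ite (.rlt (.var 2) (.get 1 (.var 10)))
      (.seq (.putN 0 (.var 4) (.get 2 (.var 10))) <| .seq (.putN 1 (.var 4) (.get 3 (.var 10))) <|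
        .seq (.putR 0 (.var 4) (.sub (.get 1 (.var 10)) (.var 2))) <|
        .setN 4 (.add (.var 4) (.lit 1))) .skip

theorem compactProg_spec {S W n m : ℕ} {s : State} {Y Z : ℕ → ℕ → ℝ} {θ : ℝ} (hm : s.nv 6 = m)
    (hθ : s.rv 2 = θ) (hθ0 : 0 ≤ θ) (hmS : m ≤ S) (hmW : m < W)
    (h : Listing (posSupport n Y) Y m (s.na 2) (s.na 3) (s.ra 1))
    (hmono : ∀ l l', l ≤ l' → l' < m → s.na 2 l ≤ s.na 2 l')
    (hZ : ∀ i j, Z i j = max (Y i j - θ) 0) :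
    Run S W compactProg s (7 * m + 3) fun s' =>
      Listing (posSupport n Z) Z (s'.nv 4) (s'.na 0) (s'.na 1) (s'.ra 0) ∧
      ∀ l l', l ≤ l' → l' < s'.nv 4 → s'.na 0 l ≤ s'.na 0 l' := by
  have hpos : ∀ l < m, ((s.na 2 l, s.na 3 l) ∈ posSupport n Z ↔ θ < s.ra 1 l) := by
    intro l hl
    have := mem_posSupport.1 (h.mem hl)
    rw [mem_posSupport, hZ, h.val_eq l hl]
    simp only [this.1, and_self, true_and, lt_max_iff, lt_irrefl, or_false, sub_pos]
  refine Run.weaken (Run.setN_seq (by simp) (Run.forUp m 5 (fun x s' => s'.nv 4 ≤ x ∧ ∃ U,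
    Listing U Z (s'.nv 4) (s'.na 0) (s'.na 1) (s'.ra 0) ∧ U ⊆ posSupport n Z ∧
    (∀ e ∈ U, ∃ l < x, s.na 2 l = e.1 ∧ s.na 3 l = e.2) ∧
    (∀ l < x, θ < s.ra 1 l → (s.na 2 l, s.na 3 l) ∈ U) ∧
    ∀ l l', l ≤ l' → l' < s'.nv 4 → s'.na 0 l ≤ s'.na 0 l') hmW ?_ ?_ ?_)) (by omega) ?_
  · intro s' F
    simp [F.nv 6 (by decide), hm]
  · refine ⟨by simp, ∅, by simpa using Listing.empty .., by simp, by simp, by simp, by simp⟩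
  · rintro x s' hx F hi ⟨hle, U, hU, hsub, hex, hall, hmo⟩
    have e2 : s'.na 2 = s.na 2 := by simp [F.na 2 (by decide)]
    have e3 : s'.na 3 = s.na 3 := by simp [F.na 3 (by decide)]
    have e1 : s'.ra 1 = s.ra 1 := by simp [F.ra 1 (by decide)]
    have eθ : s'.rv 2 = θ := by simp [F.rv 2 (by decide), hθ]
    have hmemY := h.mem hx
    refine Run.weaken (T := 4 + 1) (Run.ite (by simp [hi]; omega) (fun hv => ?_)
      (fun hv => (Run.skip ?_).weaken (by omega) fun _ _ h => h)) le_rfl fun _ _ h => h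
    · simp only [BExp.val, RExp.val, NExp.val, eθ, hi, e1] at hv
      have hmemZ := (hpos x hx).2 hv
      have hnot : (s.na 2 x, s.na 3 x) ∉ U := by
        intro hmem
        obtain ⟨l, hl, h1, h2⟩ := hex _ hmem
        exact hl.ne (h.inj (by omega) hx h1 h2)
      refine Run.putN_seq (by simp) (by simp; omega) (by simp [hi]; omega) (Run.putN_seq (by simp)
        (by simp; omega) (by simp [hi]; omega) (Run.putR_seq (by simp) (by simp; omega)
        (by simp [hi]; omega) (Run.setN (by simp; omega) ⟨?_, ?_, insert (s.na 2 x, s.na 3 x) U, ?_,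
          insert_subset hmemZ hsub, ?_, ?_, ?_⟩)))
      · simp [hi]
      · simp; omega
      · have hval : Z (s.na 2 x) (s.na 3 x) = s.ra 1 x - θ := by
          rw [hZ, ← h.val_eq x hx, max_eq_left (by linarith)]
        simp only [State.setN_nv, if_true, NExp.val, State.putR_nv, State.putN_nv]
        refine hU.append hnot ?_ ?_ ?_ <;> intro l <;> simp [hi, e1, e2, e3, eθ, hval]
      · intro e he
        rcases mem_insert.1 he with rfl | he
        · exact ⟨x, by omega, rfl, rfl⟩
        · obtain ⟨l, hl, h'⟩ := hex e he
          exact ⟨l, by omega, h'⟩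
      · intro l hl hlt
        rcases Nat.lt_succ_iff_lt_or_eq.1 hl with h' | rfl
        · exact mem_insert_of_mem (hall l h' hlt)
        · exact mem_insert_self _ _
      · intro l l' hll hl'
        simp [hi, e2] at hl' ⊢
        split_ifs with h1 h2 h2
        · exact le_rfl
        · omega
        · obtain ⟨l₂, hl₂, h3, -⟩ := hex _ (hU.mem (l := l) (by omega))
          calc s'.na 0 l = s.na 2 l₂ := h3.symm
            _ ≤ _ := hmono l₂ x (by omega) hx
        · exact hmo l l' hll (by omega)
    · simp only [BExp.val, RExp.val, NExp.val, eθ, hi, e1] at hv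
      refine ⟨by simp [hi], by simp; omega, U, by simpa using hU, hsub, ?_, ?_, by simpa using hmo⟩
      · intro e he
        obtain ⟨l, hl, h'⟩ := hex e he
        exact ⟨l, by omega, h'⟩
      · intro l hl hlt
        rcases Nat.lt_succ_iff_lt_or_eq.1 hl with h' | rfl
        · exact hall l h' hlt
        · exact absurd hlt hv
  · rintro s' F' ⟨-, U, hU, hsub, -, hall, hmo⟩
    have hUZ : U = posSupport n Z := by
      refine hsub.antisymm ?_
      rintro ⟨i, j⟩ he
      have h1 := mem_posSupport.1 he
      have h2 : (i, j) ∈ posSupport n Y := by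
        refine mem_posSupport.2 ⟨h1.1, ?_⟩
        have := h1.2
        rw [hZ, lt_max_iff] at this
        rcases this with h3 | h3
        · linarith
        · exact absurd h3 (lt_irrefl _)
      obtain ⟨l, hl, rfl, rfl⟩ := h.exists_of_mem h2
      exact hall l hl ((hpos l hl).1 he)
    exact ⟨hUZ ▸ hU, hmo⟩

/-! ### Reading and sorting a column or a row -/

theorem Stmt.shift_wnv {k x : ℕ} (p : Stmt) (hx : x < k) : x ∉ (p.shift k).wnv := by
  induction p <;> simp_all [Stmt.shift, Stmt.wnv]
  omega

/-- Reads the next `nv 0` numbers from tape `τ` into `ra a` and stores them in decreasing order in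
`ra d` and their original positions in `na 4`. The sorting program `P` works in the memory with
names from `100` on. -/
def loadProg (P : Stmt) (τ : Fin 2) (a d : ℕ) : Stmt :=
  .seq (.forUp 10 (.var 0) <|
    .seq (.read τ 3) <| .seq (.putR 100 (.var 10) (.var 3)) <| .putR a (.var 10) (.var 3)) <|
  .seq (.setN 100 (.var 0)) <|
  .seq (P.shift 100) <|
  .forUp 10 (.var 0) <|
    .seq (.putR d (.var 10) (.get 100 (.sub (.sub (.var 0) (.lit 1)) (.var 10)))) <|
    .putN 4 (.var 10) (.get 100 (.sub (.sub (.var 0) (.lit 1)) (.var 10)))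

theorem loadProg_spec {P : Stmt} {sortTime : ℕ → ℕ} {S W n : ℕ} (s : State) (τ : Fin 2) {a d : ℕ}
    (ha : a < 100) (hd : d < 100) (hda : d ≠ a) (hn : s.nv 0 = n) (hn1 : 1 ≤ n) (hnS : n ≤ S)
    (hnW : n < W) (v : ℕ → ℝ) (rest : List ℝ)
    (htape : s.tape τ = (List.range n).map v ++ rest)
    (hP : ∀ s : State, s.nv 0 = n → ∃ (s' : State) (t : ℕ), Exec S W P s s' t ∧ t ≤ sortTime n ∧
      s'.tape = s.tape ∧ (∀ i j, i < j → j < n → s'.ra 0 i ≤ s'.ra 0 j) ∧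
      ∃ π : Equiv.Perm (Fin n), ∀ i : Fin n, s'.na 0 i = π i ∧ s'.ra 0 i = s.ra 0 (π i)) :
    Run S W (loadProg P τ a d) s (sortTime n + 20 * n) fun s' =>
      (∀ x < 100, x ≠ 10 → s'.nv x = s.nv x) ∧ (∀ x < 100, x ≠ 3 → s'.rv x = s.rv x) ∧
      (∀ x < 100, x ≠ 4 → s'.na x = s.na x) ∧
      (∀ x < 100, x ≠ a → x ≠ d → s'.ra x = s.ra x) ∧
      (∀ σ, σ ≠ τ → s'.tape σ = s.tape σ) ∧ s'.tape τ = rest ∧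
      (∀ j < n, s'.ra a j = v j) ∧ (∀ j < n, s'.na 4 j < n) ∧
      (∀ j < n, ∀ j' < n, s'.na 4 j = s'.na 4 j' → j = j') ∧
      (∀ j < n, s'.ra d j = v (s'.na 4 j)) ∧
      ∀ j j', j ≤ j' → j' < n → s'.ra d j' ≤ s'.ra d j := by
  refine Run.weaken (T := (n * (3 + 2) + 2) + ((sortTime n + (n * (2 + 2) + 2)) + 1)) (Run.seq
    ((Run.forUp n 3 (fun x s' => s'.tape τ = ((List.range n).map v).drop x ++ rest ∧
      ∀ j < x, s'.ra 100 j = v j ∧ s'.ra a j = v j) hnW ?_ ?_ ?_).weaken le_rfl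
        fun s₁ F₁ h₁ => Run.setN_seq (by simp) (Run.seq (T := sortTime n) (Run.weaken
          (Q := fun s₂ => (∃ u, s₂ = s₁.glue 100 u ∧ u.tape = s₁.tape ∧
            (∀ i j, i < j → j < n → u.ra 0 i ≤ u.ra 0 j) ∧
            ∃ π : Equiv.Perm (Fin n), ∀ i : Fin n, u.na 0 i = π i ∧ u.ra 0 i = v (π i)))
          ?_ le_rfl ?_)))) (by omega) fun _ _ h => h
  · intro s' F
    have : s'.nv 0 = s.nv 0 := F.nv 0 (by simp [Stmt.forUp, Stmt.wnv])
    simp [this, hn]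
  · simpa using htape
  · rintro x s' hx F hi ⟨ht, hv⟩
    have ht' : s'.tape τ = v x :: (((List.range n).map v).drop (x + 1) ++ rest) := by
      rw [ht, List.drop_eq_getElem_cons (by simpa using hx)]
      simp
    refine Run.read_seq ht' (Run.putR_seq (by simp) (by simp [hi]; omega) (by simp)
      (Run.putR (by simp) (by simp [hi]; omega) (by simp) ⟨?_, ?_, ?_⟩))
    · simp [hi]
    · simp
    · intro j hj
      have h100 : (100 : ℕ) ≠ a := by omega
      simp only [State.setN_ra, State.putR_ra, NExp.val, RExp.val, State.putR_nv, State.setTape_nv,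
        State.setR_nv, hi, State.putR_rv, State.setTape_rv, State.setR_rv, State.setTape_ra,
        State.setR_ra, h100, h100.symm, false_and, if_false, true_and, if_true]
      rcases Nat.lt_succ_iff_lt_or_eq.1 hj with h' | rfl
      · rw [if_neg (by omega), if_neg (by omega)]
        exact hv j h'
      · simp
  · have e0 : s₁.nv 0 = n := by
      have : s₁.nv 0 = s.nv 0 := F₁.nv 0 (by simp [Stmt.forUp, Stmt.wnv])
      rw [this, hn]
    obtain ⟨u, t, hE, ht, htp, hsort, π, hπ⟩ :=
      hP ((s₁.setN 100 (NExp.val s₁ (.var 0))).above 100) (by simp [State.above, e0])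
    refine ⟨_, t, ?_, ht, u, rfl, htp, hsort, π, fun i => ⟨(hπ i).1, ?_⟩⟩
    · have := hE.shift (k := 100) (s₁.setN 100 (NExp.val s₁ (.var 0)))
      rw [State.glue_above] at this
      convert this using 1
      simp only [State.glue, State.mk.injEq, State.setN_rv, State.setN_na, State.setN_ra, and_true]
      ext x
      by_cases hx : x < 100
      · have : x ≠ 100 := by omega
        simp [hx, this]
      · simp [hx]
    · rw [(hπ i).2, ← (h₁.2 _ (π i).2).1]
      simp [State.above]
  · rintro s₂ - ⟨u, rfl, htp, hsort, π, hπ⟩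
    have e0 : s₁.nv 0 = n := by
      have : s₁.nv 0 = s.nv 0 := F₁.nv 0 (by simp [Stmt.forUp, Stmt.wnv])
      rw [this, hn]
    have key : ∀ j < n, ∃ i : Fin n, n - 1 - j = i := fun j hj => ⟨⟨n - 1 - j, by omega⟩, rfl⟩
    refine Run.weaken (Run.forUp n 2 (fun x s' => ∀ j < x, s'.ra d j = u.ra 0 (n - 1 - j) ∧
      s'.na 4 j = u.na 0 (n - 1 - j)) hnW ?_ ?_ ?_) (by omega) ?_
    · intro s' F
      have : s'.nv 0 = (s₁.glue 100 u).nv 0 := F.nv 0 (by simp [Stmt.forUp, Stmt.wnv])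
      simp [this, State.glue, e0]
    · simp
    · intro x s' hx F hi hI
      have f0 : s'.nv 0 = n := by
        have : s'.nv 0 = (s₁.glue 100 u).nv 0 := F.nv 0 (by simp [Stmt.forUp, Stmt.wnv])
        simp [this, State.glue, e0]
      have fr : s'.ra 100 = u.ra 0 := by
        have : s'.ra 100 = (s₁.glue 100 u).ra 100 :=
          F.ra 100 (by simp [Stmt.forUp, Stmt.wra]; omega)
        simp [this, State.glue]
      have fn : s'.na 100 = u.na 0 := by
        have : s'.na 100 = (s₁.glue 100 u).na 100 := F.na 100 (by simp [Stmt.forUp, Stmt.wna])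
        simp [this, State.glue]
      refine Run.putR_seq (by simp) (by simp [hi]; omega) (by simp [f0, hi]; omega)
        (Run.putN (by simp) (by simp [hi]; omega) (by simp [f0, hi]; omega) ⟨by simp [hi], ?_⟩)
      intro j hj
      simp [hi, f0, fr, fn]
      rcases Nat.lt_succ_iff_lt_or_eq.1 hj with h' | rfl
      · rw [if_neg (by omega), if_neg (by omega)]
        exact hI j h'
      · simp
    · intro s₃ F₃ h₃
      refine ⟨?_, ?_, ?_, ?_, ?_, ?_, ?_, ?_, ?_, ?_, ?_⟩
      · intro x hx hx'
        rw [F₃.nv x (by simp [Stmt.forUp, Stmt.wnv, hx']), ← F₁.nv x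
          (by simp [Stmt.forUp, Stmt.wnv, hx'])]
        simp [State.glue, hx]
      · intro x hx hx'
        rw [F₃.rv x (by simp [Stmt.forUp, Stmt.wrv]), ← F₁.rv x
          (by simp [Stmt.forUp, Stmt.wrv, hx'])]
        simp [State.glue, hx]
      · intro x hx hx'
        rw [F₃.na x (by simp [Stmt.forUp, Stmt.wna, hx']), ← F₁.na x
          (by simp [Stmt.forUp, Stmt.wna])]
        simp [State.glue, hx]
      · intro x hx hxa hxd
        rw [F₃.ra x (by simp [Stmt.forUp, Stmt.wra, hxd]), ← F₁.ra x
          (by simp [Stmt.forUp, Stmt.wra, hxa]; omega)]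
        simp [State.glue, hx]
      · intro σ hσ
        rw [F₃.tape σ (by simp [Stmt.forUp, Stmt.rtape]), ← F₁.tape σ
          (by simp [Stmt.forUp, Stmt.rtape, hσ])]
        simp [State.glue, htp]
      · rw [F₃.tape τ (by simp [Stmt.forUp, Stmt.rtape])]
        simp [State.glue, htp, h₁.1]
      · intro j hj
        rw [F₃.ra a (by simp [Stmt.forUp, Stmt.wra, hda.symm]), ← (h₁.2 j hj).2]
        simp [State.glue, ha]
      · intro j hj
        obtain ⟨i, hi⟩ := key j hj
        rw [(h₃ j hj).2, hi, (hπ i).1]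
        exact (π i).2
      · intro j hj j' hj' heq
        obtain ⟨i, hi⟩ := key j hj
        obtain ⟨i', hi'⟩ := key j' hj'
        rw [(h₃ j hj).2, (h₃ j' hj').2, hi, hi', (hπ i).1, (hπ i').1] at heq
        have := congrArg Fin.val (π.injective (Fin.ext heq))
        omega
      · intro j hj
        obtain ⟨i, hi⟩ := key j hj
        rw [(h₃ j hj).2, (h₃ j hj).1, hi, (hπ i).1, (hπ i).2]
      · intro j j' hjj hj'
        rw [(h₃ j (by omega)).1, (h₃ j' hj').1]
        rcases hjj.eq_or_lt with rfl | hlt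
        · exact le_rfl
        · exact hsort _ _ (by omega) (by omega)

/-! ### The parameters -/

/-- Computes `k + ⌈k / ε⌉` in `nv 2` and the capacity `64 * 16 ^ h` of the lists in `nv 3`, and
clears the list of entries and the work array. As words cannot be converted to real numbers, `k` is
recomputed as a real number by counting, and `⌈k / ε⌉` is found by linear search. -/
def initProg : Stmt :=
  .seq (.setR 5 (.lit 0)) <|
  .seq (.forUp 10 (.var 1) (.setR 5 (.add (.var 5) (.lit 1)))) <|
  .seq (.setN 11 (.lit 0)) <|
  .seq (.setR 6 (.lit 0)) <|
  .seq (.loop (.rlt (.mul (.var 6) (.var 0)) (.var 5))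
    (.seq (.setR 6 (.add (.var 6) (.lit 1))) (.setN 11 (.add (.var 11) (.lit 1))))) <|
  .seq (.setN 2 (.add (.var 1) (.var 11))) <|
  .seq (.setN 3 (.lit 64)) <|
  .seq (.loop (.nlt (.var 3) (.mul (.lit 8) (.var 2))) (.setN 3 (.mul (.lit 16) (.var 3)))) <|
  .seq (.forUp 10 (.var 0) (.putR 2 (.var 10) (.lit 0))) <|
  .setN 4 (.lit 0)

theorem initProg_spec {S W n k ell : ℕ} {ε : ℝ} (s : State) (hn : s.nv 0 = n) (hk : s.nv 1 = k)
    (hε : s.rv 0 = ε) (hε0 : 0 < ε) (hell : ell = k + ⌈k / ε⌉₊) (hell1 : 1 ≤ ell) (hnS : n ≤ S)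
    (hnW : n < W) (hW : 128 * ell < W) :
    Run S W initProg s (300 * ell + 3 * n + 20) fun s' => s'.nv 2 = ell ∧ s'.nv 4 = 0 ∧
      (∃ h, s'.nv 3 = 64 * 16 ^ h ∧ 8 * ell ≤ s'.nv 3 ∧ s'.nv 3 ≤ 128 * ell) ∧
      ∀ c < n, s'.ra 2 c = 0 := by
  set L := ⌈k / ε⌉₊ with hL
  refine Run.weaken (T := ((k * (1 + 2) + 2) + (((3 * L + 1) + ((((2 * (128 * ell) + 1) +
    ((n * (1 + 2) + 2) + 1)) + 1) + 1)) + 1 + 1)) + 1)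
    (Run.setR_seq (by simp) (Run.seq ((Run.forUp k 1 (fun x s' => s'.rv 5 = x) (by omega)
      ?_ ?_ ?_).weaken le_rfl fun s₁ F₁ h₁ => Run.setN_seq (by simp) (Run.setR_seq (by simp)
      (Run.seq (T := 3 * L + 1) ((Run.loop (Q := fun s' => s'.nv 11 = L) (fun s' f => ∃ x ≤ L,
        f = 3 * (L - x) + 1 ∧ s'.nv 11 = x ∧ s'.rv 6 = x) ⟨0, by simp⟩ ?_).weaken le_rfl
        fun s₂ F₂ h₂ => Run.setN_seq ?_ (Run.setN_seq ?_ (Run.seq (T := 2 * (128 * ell) + 1)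
          ((Run.loop (Q := fun s' => ∃ h, s'.nv 3 = 64 * 16 ^ h ∧ 8 * ell ≤ s'.nv 3 ∧
            s'.nv 3 ≤ 128 * ell) (fun s' f => ∃ h, f = 2 * (128 * ell - 64 * 16 ^ h) + 1 ∧
            s'.nv 3 = 64 * 16 ^ h ∧ 64 * 16 ^ h ≤ 128 * ell)
            (f₀ := 2 * (128 * ell - 64 * 16 ^ 0) + 1) ⟨0, rfl, ?_, ?_⟩ ?_).weaken (by omega)
            fun s₃ F₃ h₃ => Run.seq (T := n * (1 + 2) + 2) (T' := 1) ((Run.forUp n 1 (fun x s' =>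
              ∀ c < x, s'.ra 2 c = 0) hnW ?_ ?_ ?_).weaken le_rfl
              fun s₄ F₄ h₄ => Run.setN (by simp) ⟨?_, ?_, ?_, ?_⟩)))))))))) ?_ fun _ _ h => h
  · intro s' F
    simp [F.nv 1 (by decide), hk]
  · simp
  · intro x s' hx F hi hI
    exact Run.setR (by simp) ⟨by simp [hi], by simp [hI]⟩
  · rintro s' f F ⟨x, hx, rfl, h11, h6⟩
    have e0 : s'.rv 0 = ε := by simp [F.rv 0 (by decide), F₁.rv 0 (by decide), hε]
    have e5 : s'.rv 5 = k := by simp [F.rv 5 (by decide), h₁]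
    have hiff : (BExp.rlt (.mul (.var 6) (.var 0)) (.var 5)).val s' ↔ x < L := by
      simp only [BExp.val, RExp.val, e0, e5, h6]
      rw [hL, Nat.lt_ceil, lt_div_iff₀ hε0]
    refine ⟨by simp, fun hv => ?_, fun hv => ?_⟩
    · rw [hiff] at hv
      exact ⟨by omega, by omega⟩
    · rw [hiff] at hv
      refine ⟨2, _, ?_, Run.setR_seq (by simp) (Run.setN (by simp [h11]; omega)
        ⟨x + 1, hv, rfl, by simp [h11], by simp [h6]⟩)⟩
      omega
  · have e1 : s₂.nv 1 = k := by simp [F₂.nv 1 (by decide), F₁.nv 1 (by decide), hk]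
    simp [e1, h₂]; omega
  · simp; omega
  · simp
  · simp; omega
  · rintro s' f F ⟨h, rfl, h3, hle⟩
    have e2 : s'.nv 2 = ell := by
      have e1 : s₂.nv 1 = k := by simp [F₂.nv 1 (by decide), F₁.nv 1 (by decide), hk]
      simp [F.nv 2 (by decide), e1, h₂, hell]
    have hpos : 1 ≤ 16 ^ h := Nat.one_le_pow _ _ (by norm_num)
    refine ⟨by simp [e2]; omega, fun hv => ?_, fun hv => ?_⟩
    · simp only [BExp.val, NExp.val, h3, e2] at hv
      exact ⟨by omega, h, h3, by omega, by omega⟩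
    · simp only [BExp.val, NExp.val, h3, e2] at hv
      refine ⟨1, 2 * (128 * ell - 64 * 16 ^ (h + 1)) + 1, ?_,
        Run.setN (by simp [h3]; omega) ⟨h + 1, rfl, ?_, ?_⟩⟩
      · rw [pow_succ]; omega
      · simp [h3]; ring
      · rw [pow_succ]; omega
  · intro s' F
    simp [F.nv 0 (by decide), F₃.nv 0 (by decide), F₂.nv 0 (by decide), F₁.nv 0 (by decide), hn]
  · simp
  · intro x s' hx F hi hI
    refine Run.putR (by simp) (by simp [hi]; omega) (by simp) ⟨by simp [hi], ?_⟩
    intro c hc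
    simp [hi]
    intro hne
    exact hI c (by omega)
  · omega
  · have e1 : s₂.nv 1 = k := by simp [F₂.nv 1 (by decide), F₁.nv 1 (by decide), hk]
    simp [F₄.nv 2 (by decide), F₃.nv 2 (by decide), e1, h₂, hell]
  · simp
  · simpa [F₄.nv 3 (by decide)] using h₃
  · simpa using h₄

end RealRAM

/-! ### The error of the approximation -/

/-- `Z` approximates `Y` from below with entrywise error at most `Δ`, and the total error is at
least `ell * Δ`: every subtraction of a threshold that is counted in `Δ` has removed at least
`ell` times this threshold. -/
structure LowerApprox (n ell : ℕ) (Y Z : ℕ → ℕ → ℝ) (Δ : ℝ) : Prop where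
  nonneg : 0 ≤ Δ
  le : ∀ i < n, ∀ j < n, Z i j ≤ Y i j
  sub_le : ∀ i < n, ∀ j < n, Y i j - Z i j ≤ Δ
  mul_le : ell * Δ ≤ ∑ i ∈ range n, ∑ j ∈ range n, (Y i j - Z i j)

namespace LowerApprox

variable {n ell : ℕ} {Y Z Y' Z' X : ℕ → ℕ → ℝ} {Δ Δ' θ : ℝ}

theorem refl (n ell : ℕ) (Y : ℕ → ℕ → ℝ) : LowerApprox n ell Y Y 0 :=
  ⟨le_rfl, by simp, by simp, by simp⟩

theorem trans (h : LowerApprox n ell X Y Δ) (h' : LowerApprox n ell Y Z Δ') :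
    LowerApprox n ell X Z (Δ + Δ') where
  nonneg := add_nonneg h.nonneg h'.nonneg
  le i hi j hj := (h'.le i hi j hj).trans (h.le i hi j hj)
  sub_le i hi j hj := by linarith [h.sub_le i hi j hj, h'.sub_le i hi j hj]
  mul_le := by
    have : ∑ i ∈ range n, ∑ j ∈ range n, (X i j - Z i j) =
        ∑ i ∈ range n, ∑ j ∈ range n, (X i j - Y i j) +
          ∑ i ∈ range n, ∑ j ∈ range n, (Y i j - Z i j) := by
      simp only [← sum_add_distrib]
      exact sum_congr rfl fun i _ => sum_congr rfl fun j _ => by ring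
    rw [this, mul_add]
    exact add_le_add h.mul_le h'.mul_le

theorem congr (h : LowerApprox n ell Y Z Δ)
    (hsub : ∀ i < n, ∀ j < n, Y' i j - Z' i j = Y i j - Z i j) :
    LowerApprox n ell Y' Z' Δ where
  nonneg := h.nonneg
  le i hi j hj := by linarith [h.le i hi j hj, hsub i hi j hj]
  sub_le i hi j hj := (hsub i hi j hj).le.trans (h.sub_le i hi j hj)
  mul_le := h.mul_le.trans (sum_le_sum fun i hi => sum_le_sum fun j hj =>
    (hsub i (mem_range.1 hi) j (mem_range.1 hj)).ge)

open Classical in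
/-- Subtracting a threshold that at least `ell` entries reach. -/
theorem of_threshold (hY : ∀ i < n, ∀ j < n, 0 ≤ Y i j) (hθ : 0 ≤ θ)
    (h : θ = 0 ∨ ell ≤ #{e ∈ range n ×ˢ range n | θ ≤ Y e.1 e.2})
    (hZ : ∀ i < n, ∀ j < n, Z i j = max (Y i j - θ) 0) : LowerApprox n ell Y Z θ where
  nonneg := hθ
  le i hi j hj := by
    rw [hZ i hi j hj]
    exact max_le (by linarith) (hY i hi j hj)
  sub_le i hi j hj := by
    rw [hZ i hi j hj]
    linarith [le_max_left (Y i j - θ) 0]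
  mul_le := by
    have hle : ∀ i < n, ∀ j < n, (if θ ≤ Y i j then θ else 0) ≤ Y i j - Z i j := by
      intro i hi j hj
      rw [hZ i hi j hj]
      split_ifs with hc
      · rw [max_eq_left (by linarith)]; linarith
      · rw [max_eq_right (by linarith)]; linarith [hY i hi j hj]
    calc ell * θ ≤ #{e ∈ range n ×ˢ range n | θ ≤ Y e.1 e.2} * θ := by
          rcases h with rfl | h
          · simp
          · exact mul_le_mul_of_nonneg_right (by exact_mod_cast h) hθ
      _ = ∑ i ∈ range n, ∑ j ∈ range n, if θ ≤ Y i j then θ else 0 := by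
          rw [← sum_product', ← sum_filter, sum_const, nsmul_eq_mul]
      _ ≤ _ := sum_le_sum fun i hi => sum_le_sum fun j hj =>
          hle i (mem_range.1 hi) j (mem_range.1 hj)

end LowerApprox

open Classical in
theorem card_filter_perm {n : ℕ} {σ τ : ℕ → ℕ} (hσ : ∀ j < n, σ j < n)
    (hσi : ∀ j < n, ∀ j' < n, σ j = σ j' → j = j') (hτ : ∀ j < n, τ j < n)
    (hτi : ∀ j < n, ∀ j' < n, τ j = τ j' → j = j') (p : ℕ → ℕ → Prop) :
    #{e ∈ range n ×ˢ range n | p (σ e.1) (τ e.2)} = #{e ∈ range n ×ˢ range n | p e.1 e.2} := by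
  have hsurj : ∀ ρ : ℕ → ℕ, (∀ j < n, ρ j < n) → (∀ j < n, ∀ j' < n, ρ j = ρ j' → j = j') →
      ∀ c < n, ∃ j < n, ρ j = c := by
    intro ρ h hi c hc
    obtain ⟨j, hj, h'⟩ := surj_on_of_inj_on_of_card_le (s := range n) (t := range n)
      (fun j _ => ρ j) (fun j hj => mem_range.2 (h j (mem_range.1 hj)))
      (fun j j' hj hj' => hi j (mem_range.1 hj) j' (mem_range.1 hj')) le_rfl c (mem_range.2 hc)
    exact ⟨j, mem_range.1 hj, h'.symm⟩
  refine card_bij (fun e _ => (σ e.1, τ e.2)) ?_ ?_ ?_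
  · intro e he
    simp only [mem_filter, mem_product, mem_range] at he ⊢
    exact ⟨⟨hσ _ he.1.1, hτ _ he.1.2⟩, he.2⟩
  · intro e he e' he' heq
    simp only [mem_filter, mem_product, mem_range] at he he'
    exact Prod.ext (hσi _ he.1.1 _ he'.1.1 (Prod.mk.inj heq).1)
      (hτi _ he.1.2 _ he'.1.2 (Prod.mk.inj heq).2)
  · rintro ⟨i, j⟩ he
    simp only [mem_filter, mem_product, mem_range] at he
    obtain ⟨i', hi', rfl⟩ := hsurj σ hσ hσi i he.1.1
    obtain ⟨j', hj', rfl⟩ := hsurj τ hτ hτi j he.1.2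
    exact ⟨(i', j'), by simpa [hi', hj'] using he.2, rfl⟩

namespace EntryNorm

/-- If the errors are at most `Δ` and sum up to at least `(k + k / ε) * Δ`, then comparing their sum
with `k * Δ` plus the sum of the entries outside the `k` largest ones bounds `Δ` and this sum by the
residual norm. The bound for general `p` follows by interpolation. -/
theorem entryNorm_sub_le {n k : ℕ} (hk : 1 ≤ k) {ε Δ L : ℝ} (hε : 0 < ε) (hΔ : 0 ≤ Δ)
    (hL : k + k / ε ≤ L) {C Z : Matrix (Fin n) (Fin n) ℝ} (hZ : ∀ i j, 0 ≤ Z i j)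
    (hZC : ∀ i j, Z i j ≤ C i j) (hsub : ∀ i j, C i j - Z i j ≤ Δ)
    (hsum : L * Δ ≤ ∑ i, ∑ j, (C i j - Z i j)) {p : ℝ} (hp : 1 ≤ p) :
    entryNorm p (C - Z) ≤ (1 + ε) ^ (1 / p) * (ε / k) ^ (1 - 1 / p) * residualNorm k 1 C := by
  have hkpos : (0 : ℝ) < k := by exact_mod_cast hk
  set T := topEntries C k with hT
  have hTcard : #T ≤ k := by
    have h := (Classical.choose_spec (exists_isTop C k)).1
    rw [hT, topEntries, h]
    exact min_le_left _ _
  set R := residualNorm k 1 C with hR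
  have hC : ∀ i j, 0 ≤ C i j := fun i j => (hZ i j).trans (hZC i j)
  have hReq : R = ∑ i, ∑ j, if (i, j) ∈ T then 0 else C i j := by
    rw [hR, residualNorm, entryNorm]
    simp only [Real.rpow_one, div_one, Matrix.of_apply]
    refine sum_congr rfl fun i _ => sum_congr rfl fun j _ => ?_
    rw [abs_of_nonneg]
    split_ifs
    exacts [le_rfl, hC i j]
  have hR0 : 0 ≤ R := by
    rw [hReq]
    refine sum_nonneg fun i _ => sum_nonneg fun j _ => ?_
    split_ifs
    exacts [le_rfl, hC i j]
  set s := ∑ i, ∑ j, (C i j - Z i j) with hs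
  have hsR : s ≤ k * Δ + R := by
    calc s ≤ ∑ i, ∑ j, ((if (i, j) ∈ T then Δ else 0) + if (i, j) ∈ T then 0 else C i j) := by
          refine sum_le_sum fun i _ => sum_le_sum fun j _ => ?_
          split_ifs
          · simpa using hsub i j
          · simpa using hZ i j
      _ = #T * Δ + R := by
          simp only [sum_add_distrib]
          rw [← hReq, ← sum_product', univ_product_univ, ← sum_filter, sum_const, nsmul_eq_mul]
          simp
      _ ≤ _ := by
          have : (#T : ℝ) ≤ k := by exact_mod_cast hTcard
          nlinarith
  have hΔR : Δ ≤ ε / k * R := by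
    have h1 : k / ε * Δ ≤ R := by nlinarith
    calc Δ = ε / k * (k / ε * Δ) := by field_simp
      _ ≤ _ := mul_le_mul_of_nonneg_left h1 (by positivity)
  have hs' : s ≤ (1 + ε) * R := by
    have h1 : k * Δ ≤ ε * R := by
      calc k * Δ ≤ k * (ε / k * R) := mul_le_mul_of_nonneg_left hΔR hkpos.le
        _ = ε * R := by field_simp
    linarith
  have hp0 : 0 < p := by linarith
  have hpow : ∀ x : ℝ, 0 ≤ x → x ^ p = x * x ^ (p - 1) := by
    intro x hx
    conv_lhs => rw [show p = 1 + (p - 1) by ring]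
    rw [Real.rpow_add' hx (by linarith), Real.rpow_one]
  have hmain : ∑ i, ∑ j, |(C - Z) i j| ^ p ≤ (1 + ε) * (ε / k) ^ (p - 1) * R ^ p := by
    calc ∑ i, ∑ j, |(C - Z) i j| ^ p ≤ ∑ i, ∑ j, (C i j - Z i j) * (ε / k * R) ^ (p - 1) := by
          refine sum_le_sum fun i _ => sum_le_sum fun j _ => ?_
          have h0 : 0 ≤ C i j - Z i j := sub_nonneg.2 (hZC i j)
          rw [Matrix.sub_apply, abs_of_nonneg h0, hpow _ h0]
          exact mul_le_mul_of_nonneg_left (Real.rpow_le_rpow h0 ((hsub i j).trans hΔR)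
            (by linarith)) h0
      _ = s * (ε / k * R) ^ (p - 1) := by
          rw [hs, sum_mul]
          exact sum_congr rfl fun i _ => (sum_mul ..).symm
      _ ≤ (1 + ε) * R * (ε / k * R) ^ (p - 1) :=
          mul_le_mul_of_nonneg_right hs' (by positivity)
      _ = _ := by
          rw [Real.mul_rpow (by positivity) hR0, hpow R hR0]; ring
  calc entryNorm p (C - Z) ≤ ((1 + ε) * (ε / k) ^ (p - 1) * R ^ p) ^ (1 / p) :=
        Real.rpow_le_rpow (by positivity) hmain (by positivity)
    _ = _ := by
        rw [Real.mul_rpow (by positivity) (by positivity), Real.mul_rpow (by positivity)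
          (by positivity), ← Real.rpow_mul (by positivity), ← Real.rpow_mul hR0,
          mul_one_div_cancel hp0.ne', Real.rpow_one]
        congr 3
        field_simp

end EntryNorm

namespace RealRAM

/-! ### The algorithm -/

/-- Processes one outer product: load its two factors, subtract a threshold from it, add it to the
list of entries, and subtract a threshold from the list. -/
def stepProg (P : Stmt) : Stmt :=
  .seq (loadProg P 0 3 4) <| .seq (loadProg P 1 8 5) <| .seq thresholdProg <| .seq mergeProg <|
    .seq selectProg compactProg

/-- The whole algorithm, using the sorting program `P`. -/
def recoverProg (P : Stmt) : Stmt :=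
  .seq initProg <| .seq (.forUp 5 (.var 0) (stepProg P)) (.setN 0 (.var 4))

/-- The memory between two outer products: it holds a list of the positive entries of a matrix that
approximates `Y` from below, row by row and filling at most half of the capacity of the lists; the
work array is clear. -/
structure Approximates (n ell h : ℕ) (Y : ℕ → ℕ → ℝ) (s : State) : Prop where
  nv0 : s.nv 0 = n
  nv2 : s.nv 2 = ell
  nv3 : s.nv 3 = 64 * 16 ^ h
  work : ∀ c < n, s.ra 2 c = 0
  mono : ∀ l l', l ≤ l' → l' < s.nv 4 → s.na 0 l ≤ s.na 0 l'
  len_le : s.nv 4 ≤ 32 * 16 ^ h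
  list : ∃ Z Δ, Listing (posSupport n Z) Z (s.nv 4) (s.na 0) (s.na 1) (s.ra 0) ∧
    (∀ i j, 0 ≤ Z i j) ∧ LowerApprox n ell Y Z Δ

theorem Approximates.setN {n ell h : ℕ} {Y : ℕ → ℕ → ℝ} {s : State}
    (hs : Approximates n ell h Y s) (v : ℕ) : Approximates n ell h Y (s.setN 5 v) := by
  constructor
  · simpa using hs.nv0
  · simpa using hs.nv2
  · simpa using hs.nv3
  · simpa using hs.work
  · simpa using hs.mono
  · simpa using hs.len_le
  · simpa using hs.list

/-- The threshold `θ` of the outer product keeps fewer than `4 * ell` of its entries, so that the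
sum fits into the lists, and the threshold `η` of the sum restores the bound on the length of the
list. Both are `0` or reached by at least `ell` entries, as the error bound requires. -/
theorem stepProg_spec {P : Stmt} {sortTime : ℕ → ℕ} {S W n ell h : ℕ} {Y : ℕ → ℕ → ℝ} {s : State}
    (hs : Approximates n ell h Y s) (hn1 : 1 ≤ n) (hell1 : 1 ≤ ell) (hell : 8 * ell ≤ 64 * 16 ^ h)
    (hnS : n ≤ S) (hNS : 64 * 16 ^ h ≤ S) (hW : (2 * n) ^ 2 + 2 * n + 4 * ell + 4 < W)
    (hNW : 3 * (64 * 16 ^ h) < W) {a b : ℕ → ℝ} (ha : ∀ i, 0 ≤ a i) (hb : ∀ j, 0 ≤ b j)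
    {r₀ r₁ : List ℝ} (ht₀ : s.tape 0 = (List.range n).map a ++ r₀)
    (ht₁ : s.tape 1 = (List.range n).map b ++ r₁)
    (hP : ∀ s : State, s.nv 0 = n → ∃ (s' : State) (t : ℕ), Exec S W P s s' t ∧ t ≤ sortTime n ∧
      s'.tape = s.tape ∧ (∀ i j, i < j → j < n → s'.ra 0 i ≤ s'.ra 0 j) ∧
      ∃ π : Equiv.Perm (Fin n), ∀ i : Fin n, s'.na 0 i = π i ∧ s'.ra 0 i = s.ra 0 (π i)) :
    Run S W (stepProg P) s (2 * sortTime n + 1250 * n + 1100 * (64 * 16 ^ h)) fun s' =>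
      Approximates n ell h (fun i j => Y i j + a i * b j) s' ∧ s'.nv 5 = s.nv 5 ∧
      s'.tape 0 = r₀ ∧ s'.tape 1 = r₁ := by
  classical
  obtain ⟨Z, Δ, hlist, hZ0, happ⟩ := hs.list
  have hpos : 1 ≤ 16 ^ h := Nat.one_le_pow _ _ (by norm_num)
  refine Run.weaken (Run.seq ((loadProg_spec s 0 (a := 3) (d := 4) (by decide) (by decide)
    (by decide) hs.nv0 hn1 hnS (by omega) a r₀ ht₀ hP).weaken le_rfl ?_))
      (T := (sortTime n + 20 * n) + ((sortTime n + 20 * n) + (1200 * n +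
        ((11 * (32 * 16 ^ h) + 7 * (4 * ell) + 7 * n + 4) +
        (1000 * (64 * 16 ^ h) + (7 * (64 * 16 ^ h) + 3)))))) (by omega) fun _ _ h => h
  rintro s₁ - ⟨nv₁, rv₁, na₁, ra₁, tp₁, tp₁', a₁, σlt, σinj, d₁, anti₁⟩
  have e0 : s₁.nv 0 = n := (nv₁ 0 (by decide) (by decide)).trans hs.nv0
  refine Run.seq ((loadProg_spec s₁ 1 (a := 8) (d := 5) (by decide) (by decide)
    (by decide) e0 hn1 hnS (by omega) b r₁ ((tp₁ 1 (by decide)).trans ht₁) hP).weaken le_rfl ?_)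
  rintro s₂ - ⟨nv₂, rv₂, na₂, ra₂, tp₂, tp₂', -, τlt, τinj, d₂, anti₂⟩
  have f0 : s₂.nv 0 = n := (nv₂ 0 (by decide) (by decide)).trans e0
  have f2 : s₂.nv 2 = ell :=
    (nv₂ 2 (by decide) (by decide)).trans ((nv₁ 2 (by decide) (by decide)).trans hs.nv2)
  have r3 : s₂.ra 3 = s₁.ra 3 := ra₂ 3 (by decide) (by decide) (by decide)
  have r4 : s₂.ra 4 = s₁.ra 4 := ra₂ 4 (by decide) (by decide) (by decide)
  set σ := s₁.na 4
  set τ := s₂.na 4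
  refine Run.seq ((thresholdProg_spec s₂ f0 f2 hn1 hnS hW).weaken le_rfl ?_)
  rintro s₃ F₃ ⟨hθ0, hθ1, hθ2⟩
  set θ := s₃.rv 1
  -- the threshold was computed from the sorted factors, but sorting only permutes the positions
  have hf0 : ∀ i < n, 0 ≤ s₂.ra 4 i := fun i hi => by rw [r4, d₁ i hi]; exact ha _
  have hg0 : ∀ i < n, 0 ≤ s₂.ra 5 i := fun i hi => by rw [d₂ i hi]; exact hb _
  have hfa : ∀ i j, i ≤ j → j < n → s₂.ra 4 j ≤ s₂.ra 4 i := by rw [r4]; exact anti₁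
  have hperm : ∀ q : ℝ → Prop, #{e ∈ range n ×ˢ range n | q (s₂.ra 4 e.1 * s₂.ra 5 e.2)} =
      #{e ∈ range n ×ˢ range n | q (a e.1 * b e.2)} := by
    intro q
    rw [← card_filter_perm σlt σinj τlt τinj fun i j => q (a i * b j)]
    congr 1
    refine filter_congr fun e he => ?_
    rw [mem_product, mem_range, mem_range] at he
    rw [r4, d₁ _ he.1, d₂ _ he.2]
  have hlt : #{e ∈ range n ×ˢ range n | θ < a e.1 * b e.2} < 4 * ell := by
    rw [← hperm fun x => θ < x]
    exact OuterProduct.card_lt_lt hfa anti₂ hf0 hg0 (by omega) hθ2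
  have hge : θ = 0 ∨ ell ≤ #{e ∈ range n ×ˢ range n | θ ≤ a e.1 * b e.2} := by
    refine hθ1.imp_right fun h => ?_
    rw [← hperm fun x => θ ≤ x]
    have := OuterProduct.sampleWeight_le hfa anti₂ hf0 hg0 θ
    omega
  -- the list and the less than `4 * ell` new entries fit into the capacity
  set V : ℕ → ℕ → ℝ := fun i j => Z i j + max (a i * b j - θ) 0 with hV
  have hV0 : ∀ i j, 0 ≤ V i j := fun i j => add_nonneg (hZ0 i j) (le_max_right _ _)
  have hcard : #(posSupport n V) ≤ 64 * 16 ^ h := by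
    have hsub : posSupport n V ⊆
        posSupport n Z ∪ {e ∈ range n ×ˢ range n | θ < a e.1 * b e.2} := by
      rintro ⟨i, j⟩ hij
      rw [mem_posSupport] at hij
      rw [mem_union, mem_posSupport, mem_filter, mem_product, mem_range, mem_range]
      by_cases hc : θ < a i * b j
      · exact Or.inr ⟨hij.1, hc⟩
      · refine Or.inl ⟨hij.1, ?_⟩
        have := hij.2
        rw [hV] at this
        simp only at this
        rwa [max_eq_right (by linarith), add_zero] at this
    have h1 := card_le_card hsub
    have h2 := card_union_le (posSupport n Z) {e ∈ range n ×ˢ range n | θ < a e.1 * b e.2}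
    have h3 := hlist.card_eq
    have h4 := hs.len_le
    omega
  have g4 : s₃.nv 4 = s.nv 4 := by
    rw [F₃.nv 4 (by decide), nv₂ 4 (by decide) (by decide), nv₁ 4 (by decide) (by decide)]
  have gn0 : s₃.na 0 = s.na 0 := by
    rw [F₃.na 0 (by decide), na₂ 0 (by decide) (by decide), na₁ 0 (by decide) (by decide)]
  have gn1 : s₃.na 1 = s.na 1 := by
    rw [F₃.na 1 (by decide), na₂ 1 (by decide) (by decide), na₁ 1 (by decide) (by decide)]
  have gr0 : s₃.ra 0 = s.ra 0 := by
    rw [F₃.ra 0 (by decide), ra₂ 0 (by decide) (by decide) (by decide),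
      ra₁ 0 (by decide) (by decide) (by decide)]
  have gr2 : s₃.ra 2 = s.ra 2 := by
    rw [F₃.ra 2 (by decide), ra₂ 2 (by decide) (by decide) (by decide),
      ra₁ 2 (by decide) (by decide) (by decide)]
  have gr3 : s₃.ra 3 = s₁.ra 3 := by rw [F₃.ra 3 (by decide), r3]
  have gr5 : s₃.ra 5 = s₂.ra 5 := F₃.ra 5 (by decide)
  have hdata : MergeData n (s.nv 4) (64 * 16 ^ h) θ (s.na 0) (s.na 1) τ (s.ra 0) (s₁.ra 3)
      (s₂.ra 5) Z V :=
    { list := hlist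
      mono := hs.mono
      nonneg := hZ0
      a_nonneg := fun i hi => by rw [a₁ i hi]; exact ha i
      b_anti := anti₂
      σ_lt := τlt
      σ_inj := τinj
      eq := fun i hi j hj => by rw [hV, a₁ i hi, d₂ j hj]
      card_le := hcard }
  have hmem : MergeMem n (s.nv 4) θ (s.na 0) (s.na 1) τ (s.ra 0) (s₁.ra 3) (s₂.ra 5) s₃ :=
    ⟨(F₃.nv 0 (by decide)).trans f0, g4, rfl, gn0, gn1, F₃.na 4 (by decide), gr0, gr3, gr5⟩
  have hexc : ∑ i ∈ range n, exceed n θ (s₁.ra 3) (s₂.ra 5) i < 4 * ell := by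
    rw [MergeData.sum_exceed]
    refine lt_of_eq_of_lt ?_ hlt
    rw [← card_filter_perm (σ := id) (fun j hj => hj) (fun j _ j' _ h => h) τlt τinj
      fun i j => θ < a i * b j]
    congr 1
    refine filter_congr fun e he => ?_
    rw [mem_product, mem_range, mem_range] at he
    rw [a₁ _ he.1, d₂ _ he.2, id]
  have hlen := hs.len_le
  refine Run.seq ((mergeProg_spec hdata hmem hnS hNS (by omega) (by omega) (by omega) (by omega)
    (by rw [gr2]; exact hs.work)).weaken (by omega) ?_)
  rintro s₄ F₄ ⟨hlist₄, hmono₄, hwork₄⟩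
  have hm₄ : s₄.nv 6 ≤ 64 * 16 ^ h := hlist₄.card_eq ▸ hcard
  have k3 : s₄.nv 3 = 64 * 16 ^ h := by
    rw [F₄.nv 3 (by decide), F₃.nv 3 (by decide), nv₂ 3 (by decide) (by decide),
      nv₁ 3 (by decide) (by decide), hs.nv3]
  refine Run.seq ((selectProg_spec s₄ k3 rfl hm₄ hNS hNW fun l hl => ?_).weaken le_rfl ?_)
  · rw [hlist₄.val_eq l hl]
    exact hV0 _ _
  rintro s₅ F₅ ⟨hη0, hη1, hη2⟩
  set η := s₅.rv 2
  have l6 : s₅.nv 6 = s₄.nv 6 := F₅.nv 6 (by decide)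
  have l2 : s₅.na 2 = s₄.na 2 := F₅.na 2 (by decide)
  have l3 : s₅.na 3 = s₄.na 3 := F₅.na 3 (by decide)
  have l1 : s₅.ra 1 = s₄.ra 1 := F₅.ra 1 (by decide)
  refine (compactProg_spec l6 rfl hη0 (m := s₄.nv 6) (n := n) (Y := V)
    (Z := fun i j => max (V i j - η) 0) (by omega) (by omega) ?_ ?_ fun i j => rfl).weaken
    (by omega) ?_
  · rw [l1, l2, l3]; exact hlist₄
  · rw [l2]; exact hmono₄
  rintro s₆ F₆ ⟨hlist₆, hmono₆⟩
  have hcnt : ∀ q : ℝ → Prop, Selection.count q (s₅.ra 1) (s₄.nv 6) =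
      #{e ∈ posSupport n V | q (V e.1 e.2)} := fun q => by rw [l1]; exact hlist₄.count_eq q
  refine ⟨⟨?_, ?_, ?_, ?_, hmono₆, ?_, fun i j => max (V i j - η) 0, Δ + θ + η, hlist₆,
    fun i j => le_max_right _ _, ?_⟩, ?_, ?_, ?_⟩
  · rw [F₆.nv 0 (by decide), F₅.nv 0 (by decide), F₄.nv 0 (by decide), F₃.nv 0 (by decide), f0]
  · rw [F₆.nv 2 (by decide), F₅.nv 2 (by decide), F₄.nv 2 (by decide), F₃.nv 2 (by decide), f2]
  · rw [F₆.nv 3 (by decide), F₅.nv 3 (by decide), k3]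
  · rw [F₆.ra 2 (by decide), F₅.ra 2 (by decide)]
    exact hwork₄
  · rw [← hlist₆.card_eq]
    refine le_trans (card_le_card (t := {e ∈ posSupport n V | η < V e.1 e.2}) ?_)
      ((hcnt _).symm.le.trans ?_)
    · rintro ⟨i, j⟩ hij
      rw [mem_posSupport] at hij
      have hlt : η < V i j := by simpa using hij.2
      exact mem_filter.2 ⟨mem_posSupport.2 ⟨hij.1, hη0.trans_lt hlt⟩, hlt⟩
    · rw [← l1] at hη1
      exact hη1
  · have h1 : LowerApprox n ell (fun i j => Y i j + a i * b j) (fun i j => Z i j + a i * b j) Δ :=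
      happ.congr fun i _ j _ => by ring
    have h2 : LowerApprox n ell (fun i j => Z i j + a i * b j) V θ :=
      (LowerApprox.of_threshold (Z := fun i j => max (a i * b j - θ) 0)
        (fun i _ j _ => mul_nonneg (ha i) (hb j)) hθ0 hge fun i _ j _ => rfl).congr
        fun i _ j _ => by rw [hV]; ring
    refine (h1.trans h2).trans (LowerApprox.of_threshold (fun i _ j _ => hV0 i j) hη0 ?_
      fun i _ j _ => rfl)
    refine hη2.imp_right fun h => ?_
    rw [← l1, hcnt] at h
    have := card_le_card (filter_subset_filter (fun e : ℕ × ℕ => η ≤ V e.1 e.2)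
      (filter_subset (fun e : ℕ × ℕ => 0 < V e.1 e.2) (range n ×ˢ range n)))
    rw [posSupport] at h
    omega
  · rw [F₆.nv 5 (by decide), F₅.nv 5 (by decide), F₄.nv 5 (by decide), F₃.nv 5 (by decide),
      nv₂ 5 (by decide) (by decide), nv₁ 5 (by decide) (by decide)]
  · rw [F₆.tape 0 (by decide), F₅.tape 0 (by decide), F₄.tape 0 (by decide), F₃.tape 0 (by decide),
      tp₂ 0 (by decide), tp₁']
  · rw [F₆.tape 1 (by decide), F₅.tape 1 (by decide), F₄.tape 1 (by decide), F₃.tape 1 (by decide),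
      tp₂']

end RealRAM

namespace RealRAM

/-- The result of the algorithm for tapes that hold the columns `a x` and the rows `b x`, with
explicit constants. -/
theorem recoverProg_spec {P : Stmt} {sortTime : ℕ → ℕ} {S W n k ell : ℕ} {ε : ℝ} {s : State}
    (hn : s.nv 0 = n) (hk : s.nv 1 = k) (hε : s.rv 0 = ε) (hε0 : 0 < ε)
    (hell : ell = k + ⌈k / ε⌉₊) (hn1 : 1 ≤ n) (hell1 : 1 ≤ ell) (hnS : n ≤ S)
    (hellS : 128 * ell ≤ S) (hW : (2 * n) ^ 2 + 2 * n + 384 * ell + 4 < W) {a b : ℕ → ℕ → ℝ}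
    (ha : ∀ x i, 0 ≤ a x i) (hb : ∀ x j, 0 ≤ b x j)
    (ht₀ : s.tape 0 = (List.range n).flatMap fun x => (List.range n).map (a x))
    (ht₁ : s.tape 1 = (List.range n).flatMap fun x => (List.range n).map (b x))
    (hP : ∀ s : State, s.nv 0 = n → ∃ (s' : State) (t : ℕ), Exec S W P s s' t ∧ t ≤ sortTime n ∧
      s'.tape = s.tape ∧ (∀ i j, i < j → j < n → s'.ra 0 i ≤ s'.ra 0 j) ∧
      ∃ π : Equiv.Perm (Fin n), ∀ i : Fin n, s'.na 0 i = π i ∧ s'.ra 0 i = s.ra 0 (π i)) :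
    Run S W (recoverProg P) s
      (n * (2 * sortTime n + 1250 * n + 140800 * ell + 2) + 300 * ell + 3 * n + 23) fun s' =>
      s'.nv 0 ≤ S ∧ ∃ Z Δ, Listing (posSupport n Z) Z (s'.nv 0) (s'.na 0) (s'.na 1) (s'.ra 0) ∧
        (∀ i j, 0 ≤ Z i j) ∧
        LowerApprox n ell (fun i j => ∑ x ∈ range n, a x i * b x j) Z Δ := by
  have hdrop : ∀ x < n, ∀ f : ℕ → List ℝ, ((List.range n).drop x).flatMap f =
      f x ++ ((List.range n).drop (x + 1)).flatMap f := by
    intro x hx f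
    rw [List.drop_eq_getElem_cons (by simpa using hx), List.flatMap_cons, List.getElem_range]
  have hW₁ : n < W ∧ 384 * ell < W ∧ (2 * n) ^ 2 + 2 * n + 4 * ell + 4 < W := by
    have := Nat.zero_le ((2 * n) ^ 2)
    omega
  refine Run.weaken (Run.seq ((initProg_spec s hn hk hε hε0 hell hell1 hnS hW₁.1
    (by omega)).weaken le_rfl ?_)) (T := (300 * ell + 3 * n + 20) +
      ((n * ((2 * sortTime n + 1250 * n + 140800 * ell) + 2) + 2) + 1)) (by omega) fun _ _ h => h
  rintro s₁ F₁ ⟨i2, i4, ⟨h, i3, hle, hge⟩, iwork⟩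
  rw [i3] at hle hge
  have i0 : s₁.nv 0 = n := (F₁.nv 0 (by decide)).trans hn
  refine Run.seq ((Run.forUp n _ (fun x s' =>
    Approximates n ell h (fun i j => ∑ y ∈ range x, a y i * b y j) s' ∧
    (s'.tape 0 = ((List.range n).drop x).flatMap fun y => (List.range n).map (a y)) ∧
    s'.tape 1 = ((List.range n).drop x).flatMap fun y => (List.range n).map (b y))
    hW₁.1 ?_ ?_ ?_).weaken le_rfl ?_)
  · intro s' F
    have h0 : (0 : ℕ) ∉ (Stmt.forUp 5 (.var 0) (stepProg P)).wnv := by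
      simp only [Stmt.forUp, stepProg, loadProg, Stmt.wnv, List.mem_append, not_or]
      simp only [Stmt.shift_wnv P (show 0 < 100 by norm_num), not_false_eq_true, true_and]
      and_intros <;> decide
    exact ⟨trivial, (F.nv 0 h0).trans i0⟩
  · refine ⟨Approximates.setN ⟨i0, i2, i3, iwork, ?_, ?_, fun _ _ => 0, 0, ?_,
      fun _ _ => le_rfl, ?_⟩ 0, ?_, ?_⟩
    · intro l l' _ hl
      omega
    · omega
    · have : posSupport n (fun _ _ => (0 : ℝ)) = ∅ := by simp [posSupport]
      rw [i4, this]
      exact Listing.empty ..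
    · simpa using LowerApprox.refl n ell fun _ _ => 0
    · simpa [F₁.tape 0 (by decide)] using ht₀
    · simpa [F₁.tape 1 (by decide)] using ht₁
  · rintro x s' hx F h5 ⟨happ, h₀, h₁⟩
    rw [hdrop x hx] at h₀ h₁
    refine (stepProg_spec happ hn1 hell1 hle hnS (by omega) hW₁.2.2 (by omega) (ha x) (hb x) h₀ h₁
      hP).weaken (by omega) ?_
    rintro s'' - ⟨happ', h5', h₀', h₁'⟩
    refine ⟨h5'.trans h5, Approximates.setN ?_ _, by simpa using h₀', by simpa using h₁'⟩
    simpa only [sum_range_succ] using happ'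
  · rintro s₂ - ⟨happ, -, -⟩
    obtain ⟨Z, Δ, hlist, hZ, hZY⟩ := happ.list
    have := happ.len_le
    refine Run.setN (by simp) ⟨?_, Z, Δ, ?_, hZ, hZY⟩
    · simp
      omega
    · simpa using hlist

/-- The entries of a matrix, continued by zeros. -/
noncomputable def extend {n : ℕ} (M : Matrix (Fin n) (Fin n) ℝ) (i j : ℕ) : ℝ :=
  if h : i < n ∧ j < n then M ⟨i, h.1⟩ ⟨j, h.2⟩ else 0

theorem extend_val {n : ℕ} (M : Matrix (Fin n) (Fin n) ℝ) (i j : Fin n) :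
    extend M i j = M i j := by
  simp [extend]

theorem extend_nonneg {n : ℕ} {M : Matrix (Fin n) (Fin n) ℝ} (hM : ∀ i j, 0 ≤ M i j) (i j : ℕ) :
    0 ≤ extend M i j := by
  rw [extend]
  split_ifs
  exacts [hM _ _, le_rfl]

theorem rowMajor_eq {n : ℕ} (M : Matrix (Fin n) (Fin n) ℝ) :
    rowMajor M = (List.range n).flatMap fun i => (List.range n).map (extend M i) := by
  rw [rowMajor, ← List.map_coe_finRange_eq_range, List.flatMap_map]
  simp only [List.map_map, Function.comp_def, extend_val]

end RealRAM

theorem theorem1 (P : RealRAM.Stmt) (sortTime : ℕ → ℕ) (hP : RealRAM.IsSorter P sortTime)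
    (hsort : ∀ m, m ≤ sortTime m) :
    ∃ (Q : RealRAM.Stmt) (c : ℝ) (d : ℕ),
      ∀ (n k : ℕ) (ε : ℝ), 1 ≤ n → 1 ≤ k → 0 < ε → ε < 1 →
      ∀ A B : Matrix (Fin n) (Fin n) ℝ, (∀ i j, 0 ≤ A i j) → (∀ i j, 0 ≤ B i j) →
      ∀ s : RealRAM.State, RealRAM.IsInput s k ε A B →
      ∃ (S W : ℕ) (s' : RealRAM.State) (t : ℕ) (Chat : Matrix (Fin n) (Fin n) ℝ),
        RealRAM.Exec S W Q s s' t ∧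
        RealRAM.IsOutput S s' Chat ∧
        (t : ℝ) ≤ c * (n * sortTime n + n * k / ε) ∧
        (S : ℝ) ≤ c * (n + k / ε) ∧
        (W : ℝ) ≤ (c * (n + k / ε)) ^ d ∧
        ∀ p : ℝ, 1 ≤ p →
          EntryNorm.entryNorm p (A * B - Chat) ≤
            (1 + ε) ^ (1 / p) * (ε / k) ^ (1 - 1 / p) * EntryNorm.residualNorm k 1 (A * B) := by
  obtain ⟨c₀, d₀, hP⟩ := hP
  refine ⟨RealRAM.recoverProg P, 500000 + 2 * c₀, d₀ + 3, ?_⟩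
  rintro n k ε hn1 hk1 hε0 hε1 A B hA hB s ⟨hn, hk, hε, ht₀, ht₁⟩
  set ell := k + ⌈k / ε⌉₊ with hell
  set S := c₀ * (n + 1) + n + 128 * ell with hS
  -- the exponent makes room for the words of the sorting program and for the weights of samples
  set W := (S + 10) ^ (d₀ + 3) with hW
  have hcS : c₀ * (n + 1) ≤ S := by omega
  have hW₁ : (c₀ * (n + 1)) ^ d₀ ≤ W :=
    (Nat.pow_le_pow_left (hcS.trans (Nat.le_add_right S 10)) d₀).trans
      (Nat.pow_le_pow_right (by omega) (by omega))
  have hW₂ : (2 * n) ^ 2 + 2 * n + 384 * ell + 4 < W := by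
    have hn : n ≤ S := by omega
    have hl : 128 * ell ≤ S := by omega
    have h3 : (S + 10) ^ 3 ≤ W := Nat.pow_le_pow_right (by omega) (by omega)
    nlinarith [Nat.mul_le_mul hn hn, Nat.zero_le (S ^ 3)]
  obtain ⟨s', t, hexec, ht, hlen, Z, Δ, hlist, hZ, happ⟩ :=
    RealRAM.recoverProg_spec hn hk hε hε0 hell hn1 (by omega) (by omega) (by omega) hW₂
      (S := S) (a := fun x i => RealRAM.extend A.transpose x i)
      (b := fun x j => RealRAM.extend B x j)
      (fun x i => RealRAM.extend_nonneg (fun i j => hA j i) x i)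
      (fun x j => RealRAM.extend_nonneg hB x j)
      (ht₀.trans (RealRAM.rowMajor_eq _)) (ht₁.trans (RealRAM.rowMajor_eq _))
      fun s hs => by
        obtain ⟨s', t, h, h'⟩ := hP n s hs
        exact ⟨s', t, h.mono hcS hW₁, h'⟩
  have hY : ∀ i j : Fin n, ∑ x ∈ range n, RealRAM.extend A.transpose x i * RealRAM.extend B x j =
      (A * B) i j := by
    intro i j
    rw [Matrix.mul_apply, Finset.sum_range]
    simp only [RealRAM.extend_val, Matrix.transpose_apply]
  -- the bounds for time, space and word size, in terms of `x = k / ε ≥ 1`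
  have hkε : (k : ℝ) ≤ k / ε := le_div_self (by positivity) hε0 hε1.le
  have hceil : (⌈k / ε⌉₊ : ℝ) < k / ε + 1 := Nat.ceil_lt_add_one (by positivity)
  have hle : (k : ℝ) + k / ε ≤ ell := by
    rw [hell, Nat.cast_add]
    exact add_le_add_right (Nat.le_ceil _) _
  have hk1' : (1 : ℝ) ≤ k := by exact_mod_cast hk1
  have hn1' : (1 : ℝ) ≤ n := by exact_mod_cast hn1
  have hsn : (n : ℝ) ≤ sortTime n := by exact_mod_cast hsort n
  have hell3 : (ell : ℝ) ≤ 3 * (k / ε) := by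
    rw [hell, Nat.cast_add]
    linarith
  have hc₀ : (0 : ℝ) ≤ c₀ := by positivity
  rw [mul_div_assoc]
  set x := (k : ℝ) / ε
  have hx1 : 1 ≤ x := hk1'.trans hkε
  have hS10 : (S : ℝ) + 10 ≤ (500000 + 2 * c₀) * (n + x) := by
    rw [hS]
    push_cast
    nlinarith [mul_nonneg hc₀ (sub_nonneg.2 hn1'), mul_nonneg hc₀ (zero_le_one.trans hx1)]
  refine ⟨S, W, s', t, Matrix.of fun i j => Z i j, hexec, ⟨hlen, ?_, ?_, ?_⟩, ?_, by linarith, ?_,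
    fun p hp => ?_⟩
  · intro l hl
    exact (mem_posSupport.1 (hlist.mem hl)).1
  · intro l hl l' hl' hR hC
    exact hlist.inj hl hl' hR hC
  · intro i j
    refine (hlist.sum_eq i j fun h => ?_).trans (sum_congr rfl fun l _ => ?_)
    · by_contra h0
      exact h (mem_posSupport.2 ⟨⟨i.2, j.2⟩, (hZ i j).lt_of_ne' h0⟩)
    · congr
  · have ht' : (t : ℝ) ≤ n * (2 * sortTime n + 1250 * n + 140800 * ell + 2) + 300 * ell + 3 * n +
        23 := by exact_mod_cast ht
    have h1 : (n : ℝ) * n ≤ n * sortTime n := mul_le_mul_of_nonneg_left hsn (by positivity)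
    have h2 : (n : ℝ) * ell ≤ n * (3 * x) := mul_le_mul_of_nonneg_left hell3 (by positivity)
    have h3 : 1 * x ≤ n * x := mul_le_mul_of_nonneg_right hn1' (by positivity)
    have h4 : (n : ℝ) * 1 ≤ n * n := mul_le_mul_of_nonneg_left hn1' (by positivity)
    have h5 : 0 ≤ c₀ * ((n : ℝ) * sortTime n + n * x) := by positivity
    nlinarith
  · rw [hW]
    push_cast
    exact pow_le_pow_left₀ (by positivity) hS10 _
  · refine EntryNorm.entryNorm_sub_le hk1 hε0 happ.nonneg hle (fun i j => hZ i j) (fun i j => ?_)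
      (fun i j => ?_) ?_ hp
    · rw [← hY]
      exact happ.le i i.2 j j.2
    · rw [← hY]
      exact happ.sub_le i i.2 j j.2
    · simp only [← hY]
      simpa only [Finset.sum_range] using happ.mul_le
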